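/- Let $d\ge 2$ and let $\Omega\subset\mathbb R^d$ be a domain (nonempty, open, connected) with $\Omega=\operatorname{int}\overline\Omega$; every Lipschitz domain has this last property. Let $\kappa\in[L^\infty(\Omega)]^{d\times d}$ be symmetric with $\kappa\ge\kappa_0 I$ a.e. for some $\kappa_0>0$. Let $\partial\Omega$ be the disjoint union of measurable sets $\Gamma_D,\Gamma_N,\Gamma_R$, and let $\lambda\in L^\infty(\Gamma_N\cup\Gamma_R)$ with $\lambda=0$ on $\Gamma_N$ and $\lambda>0$ on $\Gamma_R$. Consider the mixed form $$\nabla u+\kappa^{-1}\sigma=0,\quad \nabla\cdot\sigma=f\ \text{ in }\Omega,\qquad u=g\ \text{ on }\Gamma_D,\qquad -\sigma\cdot n+\lambda u=g\ \text{ on }\Gamma_N\cup\Gamma_R$$ of $-\nabla\cdot(\kappa\nabla u)=f$. Inequalities between matrices are meant in the sense of quadratic forms. **Framework.** With $z=(\sigma,u)$ the mixed equations are $\sum_k\partial_k(A_kz)+Gz=(0,f)$, where $$G=\begin{bmatrix}\kappa^{-1}&0\\0&0\end{bmatrix},\qquad A_k=\begin{bmatrix}0&B_k\\B_k^T&C_k\end{bmatrix},\quad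 B_k=e_k,\ C_k=0 ,$$ and $e_k$ is the $k$-th canonical basis vector of $\mathbb R^d$. (For $\kappa$ invertible, $\nabla u+\kappa^{-1}\sigma=0$ means $\sigma=-\kappa\nabla u$.) The assumptions of two-field Friedrichs' systems with partial coercivity hold: $G$, $A_k$ and $\sum_k\partial_kA_k$ (distributional) are essentially bounded; $A_k=A_k^T$; $G+G^T+\sum_k\partial_kA_k\ge2\mu_0\begin{bmatrix}I_d&0\\0&0\end{bmatrix}$ for some $\mu_0>0$; the off-diagonal blocks of $G$ vanish and the $B_k$ are constant; the leading $d\times d$ block of each $A_k$ vanishes, and that of $G$ is $\ge k_0I$ for some $k_0>0$. For a unit vector $n$ put $A=\sum_kn_kA_k$, $B=\sum_kn_kB_k$, $C=\sum_kn_kC_k$, and let $|A|=R|\Lambda|R^{-1}$ for an eigendecomposition $A=R\Lambda R^{-1}$, with blocks $\mathcal A^{\sigma\sigma},\mathcal A^{\sigma u},\mathcal A^{u\sigma},\mathcal A^{uu}$. Then $\mathcal A^{\sigma u}=0$ (flux case (F2)), the stabilization $T:=\mathcal A^{uu}$ equals $1$, $\tfrac12C+T>0$, $\bigcap_k\operatorname{Range}(B_k)=\{0\}$,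 and $\operatorname{Null}(B_k)=\{0\}$ for every $k$. The boundary operator $M=\begin{bmatrix}0&-\alpha B\\\alpha B^T&2\varrho+C\end{bmatrix}$, with $\alpha=1,\varrho=\frac12$ on $\Gamma_D$ and $\alpha=-1,\varrho=\lambda$ on $\Gamma_N\cup\Gamma_R$, satisfies $M\ge0$ and $\operatorname{Null}(A-M)+\operatorname{Null}(A+M)=\mathbb R^{d+1}$, and $(A-M)z=(A-M)z'$ is equivalent to $u=u'$ on $\Gamma_D$ and to $-\sigma\cdot n+\lambda u=-\sigma'\cdot n+\lambda u'$ on $\Gamma_N\cup\Gamma_R$, where $z=(\sigma,u)$ and $z'=(\sigma',u')$. **$hp$-HDG formulation.** Let $\mathcal T_h$ be any finite family of disjoint nonempty bounded open convex polytopes $K$ with $\bigcup_K\overline K=\overline\Omega$ (hanging nodes allowed), with arbitrary degrees $p_K\ge0$. The mortars are the sets $e=F^-\cap F^+$ of positive surface measure, $F^\pm$ faces of two different elements $K^\pm$ (interior mortars), and the sets $e=F\cap\partial\Omega$ of positive surface measure, $F$ a face of an element $K$ (boundary mortars); $p_e=\max(p_{K^-},p_{K^+})$, respectively $p_e=p_K$.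 The unknowns are $\sigma_h|_K\in P_{p_K}(K)^d$, $u_h|_K\in P_{p_K}(K)$ and $\hat u_h|_e\in P_{p_e}(e)$, where $P_p$ denotes polynomials of total degree at most $p$. On each element $K$, with outward unit normal $n$, the local equations are $$-(u_h,\nabla\cdot s)_K+(\kappa^{-1}\sigma_h,s)_K+\langle\hat u_h,s\cdot n\rangle_{\partial K}=(f^\sigma,s)_K\quad\forall s\in P_{p_K}(K)^d,$$ $$-(\sigma_h,\nabla v)_K+\langle\sigma_h\cdot n+T(u_h-\hat u_h),v\rangle_{\partial K}=(f^u,v)_K\quad\forall v\in P_{p_K}(K).$$ They are complemented, for all $\hat v\in P_{p_e}(e)$, by the following conditions. - On every interior mortar: the sum over the two sides of $\langle\sigma_h\cdot n+T(u_h-\hat u_h),\hat v\rangle_e$ is $0$. - On every boundary mortar in $\Gamma_N\cup\Gamma_R$: $\langle\sigma_h\cdot n+T(u_h-\hat u_h),\hat v\rangle_e=\langle\lambda\hat u_h-g,\hat v\rangle_e$. - On every boundary mortar in $\Gamma_D$: $\langle\hat u_h,\hat v\rangle_e=\langle g,\hat v\rangle_e$. **Local well-posedness.** For every $(f^\sigma,f^u)\in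 L^2(\Omega)^{d+1}$ (in particular $(0,f)$), every trace field $\hat u_h$ and every $K$, the local equations have exactly one solution $(\sigma_h,u_h)|_K$. **Global well-posedness.** If every boundary mortar lies, up to a null set, in one of $\Gamma_D,\Gamma_N,\Gamma_R$, and if $\Gamma_D\cup\Gamma_R$ has positive surface measure, then for all $(f^\sigma,f^u)\in L^2(\Omega)^{d+1}$ and $g\in L^2(\partial\Omega)$ the complete formulation has exactly one solution $(\sigma_h,u_h,\hat u_h)$. -/

import Mathlib

open MeasureTheory Matrix

noncomputable section

namespace HDG

/-- The Euclidean space `ℝ^d`. -/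
abbrev E (d : ℕ) : Type := EuclideanSpace ℝ (Fin d)

/-- The `k`-th canonical basis vector of `ℝ^d`. -/
abbrev basisVec {d : ℕ} (k : Fin d) : E d := EuclideanSpace.single k (1 : ℝ)

/-- Surface measure: the normalised `(d-1)`-dimensional Hausdorff measure on `ℝ^d`. -/
abbrev surf (d : ℕ) : Measure (E d) := Measure.euclideanHausdorffMeasure (d - 1)

/-! ## Matrices -/

/-- `M ≥ 0` in the sense of quadratic forms (the matrix need not be symmetric). -/
def NonnegForm {m : Type} [Fintype m] (M : Matrix m m ℝ) : Prop :=
  ∀ z : m → ℝ, 0 ≤ z ⬝ᵥ (M *ᵥ z)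

/-- `M > 0` in the sense of quadratic forms. -/
def PosForm {m : Type} [Fintype m] (M : Matrix m m ℝ) : Prop :=
  ∀ z : m → ℝ, z ≠ 0 → 0 < z ⬝ᵥ (M *ᵥ z)

open scoped Classical in
/-- The absolute value `|A| = R |Λ| R⁻¹` of a symmetric real matrix `A = R Λ R⁻¹`, where `R` is an
orthogonal matrix of eigenvectors (junk value `0` if `A` is not symmetric). -/
def symAbs {m : Type} [Fintype m] [DecidableEq m] (A : Matrix m m ℝ) : Matrix m m ℝ :=
  if h : A.IsHermitian then
    (h.eigenvectorUnitary : Matrix m m ℝ) * diagonal (fun i => |h.eigenvalues i|) *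
      (h.eigenvectorUnitary : Matrix m m ℝ)⁻¹
  else 0

/-! ## Two-field Friedrichs' systems -/

/-- The coefficients of a first order system `∑ₖ ∂ₖ (Aₖ z) + G z = f` for an unknown
`z = (σ, u)` whose two fields have components indexed by `ι` and `υ`. -/
structure TwoFieldSystem (d : ℕ) (ι υ : Type) where
  A : Fin d → E d → Matrix (ι ⊕ υ) (ι ⊕ υ) ℝ
  G : E d → Matrix (ι ⊕ υ) (ι ⊕ υ) ℝ

namespace TwoFieldSystem

variable {d : ℕ} {ι υ : Type}

/-- The block `Bₖ` of `Aₖ`. -/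
def B (S : TwoFieldSystem d ι υ) (k : Fin d) (x : E d) : Matrix ι υ ℝ := (S.A k x).toBlocks₁₂

/-- The block `Cₖ` of `Aₖ`. -/
def C (S : TwoFieldSystem d ι υ) (k : Fin d) (x : E d) : Matrix υ υ ℝ := (S.A k x).toBlocks₂₂

/-- `A = ∑ₖ nₖ Aₖ`. -/
def An (S : TwoFieldSystem d ι υ) (x n : E d) : Matrix (ι ⊕ υ) (ι ⊕ υ) ℝ := ∑ k, n k • S.A k x

/-- `B = ∑ₖ nₖ Bₖ`. -/
def Bn (S : TwoFieldSystem d ι υ) (x n : E d) : Matrix ι υ ℝ := ∑ k, n k • S.B k x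

/-- `C = ∑ₖ nₖ Cₖ`. -/
def Cn (S : TwoFieldSystem d ι υ) (x n : E d) : Matrix υ υ ℝ := ∑ k, n k • S.C k x

/-- The left hand side `∑ₖ ∂ₖ (Aₖ z) + G z` of the system in strong form, at the point `x`. -/
def strongForm [Fintype ι] [Fintype υ] (S : TwoFieldSystem d ι υ) (z : E d → ι ⊕ υ → ℝ)
    (x : E d) : ι ⊕ υ → ℝ :=
  ∑ k, fderiv ℝ (fun y => S.A k y *ᵥ z y) x (basisVec k) + S.G x *ᵥ z x

/-- `D` is essentially bounded and `D = ∑ₖ ∂ₖ Aₖ` in `Ω` in the sense of distributions. -/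
def HasBoundedDiv (Ω : Set (E d)) (S : TwoFieldSystem d ι υ)
    (D : E d → Matrix (ι ⊕ υ) (ι ⊕ υ) ℝ) : Prop :=
  (∀ i j, MemLp (fun x => D x i j) ⊤ (volume.restrict Ω)) ∧
  ∀ φ : E d → ℝ, ContDiff ℝ ((⊤ : ℕ∞) : WithTop ℕ∞) φ → HasCompactSupport φ → tsupport φ ⊆ Ω →
    ∀ i j, ∫ x in Ω, ∑ k, S.A k x i j * fderiv ℝ φ x (basisVec k) = -∫ x in Ω, D x i j * φ x

/-- The assumptions of the two-field theory with partial coercivity. -/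
structure IsPartiallyCoercive [Fintype ι] [Fintype υ] [DecidableEq ι]
    (Ω : Set (E d)) (S : TwoFieldSystem d ι υ) : Prop where
  /-- `G` is essentially bounded. -/
  A1 : ∀ i j, MemLp (fun x => S.G x i j) ⊤ (volume.restrict Ω)
  /-- The `Aₖ` and `∑ₖ ∂ₖ Aₖ` are essentially bounded. -/
  A2 : (∀ k i j, MemLp (fun x => S.A k x i j) ⊤ (volume.restrict Ω)) ∧ ∃ D, HasBoundedDiv Ω S D
  /-- The `Aₖ` are symmetric. -/
  A3 : ∀ k, ∀ᵐ x ∂volume.restrict Ω, (S.A k x)ᵀ = S.A k x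
  /-- `G + Gᵀ + ∑ₖ ∂ₖ Aₖ ≥ 2 μ₀ diag(I, 0)`. -/
  A4a : ∃ μ₀ : ℝ, 0 < μ₀ ∧ ∃ D, HasBoundedDiv Ω S D ∧
    ∀ᵐ x ∂volume.restrict Ω,
      NonnegForm (S.G x + (S.G x)ᵀ + D x - (2 * μ₀) • fromBlocks (1 : Matrix ι ι ℝ) 0 0 0)
  /-- The off-diagonal blocks of `G` vanish and the `Bₖ` are constant over `Ω`. -/
  A4b : (∀ᵐ x ∂volume.restrict Ω, (S.G x).toBlocks₁₂ = 0 ∧ (S.G x).toBlocks₂₁ = 0) ∧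
    ∀ k, ∃ B₀ : Matrix ι υ ℝ, ∀ᵐ x ∂volume.restrict Ω, S.B k x = B₀
  /-- The leading blocks of the `Aₖ` vanish. -/
  A5 : ∀ k, ∀ᵐ x ∂volume.restrict Ω, (S.A k x).toBlocks₁₁ = 0
  /-- The leading block of `G` is uniformly positive. -/
  A6 : ∃ k₀ : ℝ, 0 < k₀ ∧
    ∀ᵐ x ∂volume.restrict Ω, NonnegForm ((S.G x).toBlocks₁₁ - k₀ • (1 : Matrix ι ι ℝ))

section Flux

variable [Fintype ι] [Fintype υ] [DecidableEq ι] [DecidableEq υ]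

/-- The flux case (F2): the off-diagonal block `𝒜^{σu}` of `|A|` vanishes, for all unit normals. -/
def FluxCaseF2 (Ω : Set (E d)) (S : TwoFieldSystem d ι υ) : Prop :=
  ∀ x ∈ closure Ω, ∀ n : E d, ‖n‖ = 1 → (symAbs (S.An x n)).toBlocks₁₂ = 0

/-- The stabilisation matrix `T = 𝒜^{uu}` attached to the flux case (F2). -/
def T (S : TwoFieldSystem d ι υ) (x n : E d) : Matrix υ υ ℝ := (symAbs (S.An x n)).toBlocks₂₂

/-- The boundary operator `M = [0, -α B; α Bᵀ, 2 ρ I + C]`. -/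
def boundaryOp (S : TwoFieldSystem d ι υ) (α ρ : ℝ) (x n : E d) :
    Matrix (ι ⊕ υ) (ι ⊕ υ) ℝ :=
  fromBlocks 0 (-(α • S.Bn x n)) (α • (S.Bn x n)ᵀ) ((2 * ρ) • (1 : Matrix υ υ ℝ) + S.Cn x n)

/-- The two requirements `M ≥ 0` and `Null (A - M) + Null (A + M) = ℝ^m` on a boundary operator. -/
def AdmissibleBoundaryOp (A M : Matrix (ι ⊕ υ) (ι ⊕ υ) ℝ) : Prop :=
  NonnegForm M ∧ LinearMap.ker (A - M).mulVecLin ⊔ LinearMap.ker (A + M).mulVecLin = ⊤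

end Flux

end TwoFieldSystem

/-! ## Meshes, faces, mortars -/

/-- An affine element: a nonempty bounded open convex polytope
`{x | ⟪nᵢ, x⟫ < bᵢ for all i}`, given by pairwise distinct half-spaces with unit outward
normals `nᵢ`. -/
structure Element (d : ℕ) where
  numFaces : ℕ
  normal : Fin numFaces → E d
  offset : Fin numFaces → ℝ
  norm_normal : ∀ i, ‖normal i‖ = 1
  distinct : Function.Injective fun i => (normal i, offset i)
  isBounded : Bornology.IsBounded {x : E d | ∀ i, inner ℝ (normal i) x < offset i}
  nonempty : {x : E d | ∀ i, inner ℝ (normal i) x < offset i}.Nonempty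

namespace Element

variable {d : ℕ}

/-- The open set occupied by the element. -/
def carrier (K : Element d) : Set (E d) := {x | ∀ i, inner ℝ (K.normal i) x < K.offset i}

/-- The `i`-th closed face. (If the `i`-th half-space is redundant it is a null set.) -/
def face (K : Element d) (i : Fin K.numFaces) : Set (E d) :=
  {x | (∀ j, inner ℝ (K.normal j) x ≤ K.offset j) ∧ inner ℝ (K.normal i) x = K.offset i}

end Element

/-- A partition of `Ω` into finitely many disjoint elements whose closures cover the closure
of `Ω`. No conformity is required. -/
structure Mesh {d : ℕ} (Ω : Set (E d)) where
  N : ℕ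
  elem : Fin N → Element d
  disjoint : ∀ K K', K ≠ K' → Disjoint (elem K).carrier (elem K').carrier
  cover : ⋃ K, closure (elem K).carrier = closure Ω

namespace Mesh

variable {d : ℕ} {Ω : Set (E d)}

/-- A face of the mesh: an element together with one of its faces. -/
abbrev Face (𝓣 : Mesh Ω) : Type := (K : Fin 𝓣.N) × Fin (𝓣.elem K).numFaces

/-- The point set of a face. -/
def faceSet (𝓣 : Mesh Ω) (F : 𝓣.Face) : Set (E d) := (𝓣.elem F.1).face F.2

/-- The outward unit normal on a face. -/
def normal (𝓣 : Mesh Ω) (F : 𝓣.Face) : E d := (𝓣.elem F.1).normal F.2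

/-- The mortars (the mesh skeleton). Interior mortars are the intersections `F⁻ ∩ F⁺`, of positive
surface measure, of a face of an element with a face of another element (each unordered pair is
listed once); boundary mortars are the intersections `F ∩ ∂Ω` of positive surface measure. -/
abbrev Mortar (𝓣 : Mesh Ω) : Type :=
  {q : 𝓣.Face × 𝓣.Face //
    q.1.1 < q.2.1 ∧ surf d (𝓣.faceSet q.1 ∩ 𝓣.faceSet q.2) ≠ 0} ⊕
  {F : 𝓣.Face // surf d (𝓣.faceSet F ∩ frontier Ω) ≠ 0}

instance (𝓣 : Mesh Ω) : Fintype 𝓣.Mortar := Fintype.ofFinite _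

/-- The point set of a mortar. -/
def mortarSet (𝓣 : Mesh Ω) : 𝓣.Mortar → Set (E d)
  | .inl q => 𝓣.faceSet q.1.1 ∩ 𝓣.faceSet q.1.2
  | .inr F => 𝓣.faceSet F.1 ∩ frontier Ω

/-- The faces that contain a mortar: two for an interior mortar, one for a boundary mortar. -/
def sides (𝓣 : Mesh Ω) : 𝓣.Mortar → Finset 𝓣.Face
  | .inl q => {q.1.1, q.1.2}
  | .inr F => {F.1}

/-- Surface measure on a mortar. -/
def mortarMeasure (𝓣 : Mesh Ω) (e : 𝓣.Mortar) : Measure (𝓣.mortarSet e) :=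
  (surf d).comap Subtype.val

/-- The degree on a mortar: the maximum of the degrees of the adjacent elements. -/
def mortarDegree (𝓣 : Mesh Ω) (p : Fin 𝓣.N → ℕ) (e : 𝓣.Mortar) : ℕ :=
  (𝓣.sides e).sup fun F => p F.1

/-- The mortar `e` lies in the part `Γ` of the boundary, up to a set of zero surface measure. -/
def LiesOn (𝓣 : Mesh Ω) (e : 𝓣.Mortar) (Γ : Set (E d)) : Prop := surf d (𝓣.mortarSet e \ Γ) = 0

/-- The integral `⟨·,·⟩_{∂K}`: the sum over the faces `F` of `K` and the mortars `e ⊆ F` of the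
integrals over `e`. -/
def boundaryIntegral (𝓣 : Mesh Ω) (K : Fin 𝓣.N)
    (f : (F : 𝓣.Face) → (e : 𝓣.Mortar) → 𝓣.mortarSet e → ℝ) : ℝ :=
  ∑ i : Fin (𝓣.elem K).numFaces, ∑ e : 𝓣.Mortar with (⟨K, i⟩ : 𝓣.Face) ∈ 𝓣.sides e,
    ∫ x, f ⟨K, i⟩ e x ∂𝓣.mortarMeasure e

end Mesh

/-- The decomposition of the boundary of `Ω` into its Dirichlet, Neumann and Robin parts. -/
structure BoundaryParts {d : ℕ} (Ω : Set (E d)) where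
  D : Set (E d)
  N : Set (E d)
  R : Set (E d)
  measurable_D : MeasurableSet D
  measurable_N : MeasurableSet N
  measurable_R : MeasurableSet R
  disjoint_DN : Disjoint D N
  disjoint_DR : Disjoint D R
  disjoint_NR : Disjoint N R
  union : D ∪ N ∪ R = frontier Ω

/-- The mesh resolves the boundary parts: each boundary mortar is of one type. -/
def BoundaryParts.ResolvedBy {d : ℕ} {Ω : Set (E d)} (Γ : BoundaryParts Ω) (𝓣 : Mesh Ω) : Prop :=
  ∀ F, 𝓣.LiesOn (.inr F) Γ.D ∨ 𝓣.LiesOn (.inr F) Γ.N ∨ 𝓣.LiesOn (.inr F) Γ.R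

/-! ## Approximation spaces -/

/-- Polynomials in `d` variables of total degree at most `p`. Polynomials on an element are
represented by these (an element has nonempty interior). -/
abbrev Poly (d p : ℕ) : Type := MvPolynomial.restrictTotalDegree (Fin d) ℝ p

/-- The vector of values at `x` of a vector of polynomials. -/
def vec {d : ℕ} {ι : Type} (s : ι → MvPolynomial (Fin d) ℝ) (x : E d) : ι → ℝ :=
  fun i => MvPolynomial.eval (fun k => x k) (s i)

/-- The space of functions on a set `D` that are restrictions of polynomials of total degree at
most `p`. -/
def polyOn {d : ℕ} (p : ℕ) (D : Set (E d)) : Submodule ℝ (D → ℝ) :=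
  (MvPolynomial.restrictTotalDegree (Fin d) ℝ p).map
    ({ toFun := fun q x => MvPolynomial.eval (fun k => x.1 k) q
       map_add' := by intros; ext; simp
       map_smul' := by intros; ext; simp } : MvPolynomial (Fin d) ℝ →ₗ[ℝ] D → ℝ)

section Scheme

variable {d : ℕ} {Ω : Set (E d)} {ι υ : Type}

/-- Piecewise polynomial fields on the elements, with components indexed by `ι`. -/
abbrev VolSpace (𝓣 : Mesh Ω) (p : Fin 𝓣.N → ℕ) (ι : Type) : Type :=
  (K : Fin 𝓣.N) → ι → Poly d (p K)

/-- Piecewise polynomial fields on the mesh skeleton, with components indexed by `υ`. -/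
abbrev TraceSpace (𝓣 : Mesh Ω) (p : Fin 𝓣.N → ℕ) (υ : Type) : Type :=
  (e : 𝓣.Mortar) → υ → polyOn (𝓣.mortarDegree p e) (𝓣.mortarSet e)

/-- The polynomials underlying a vector of elements of `Poly`. -/
abbrev coes {p : ℕ} (s : ι → Poly d p) : ι → MvPolynomial (Fin d) ℝ := fun i => (s i).1

/-- The componentwise partial derivative. -/
abbrev dcoes {p : ℕ} (k : Fin d) (s : ι → Poly d p) : ι → MvPolynomial (Fin d) ℝ :=
  fun i => MvPolynomial.pderiv k (s i).1

/-- The vector of values at `x` of a trace field on one mortar. -/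
abbrev tvec {q : ℕ} {D : Set (E d)} (w : υ → polyOn q D) (x : D) : υ → ℝ := fun j => (w j).1 x

variable [Fintype ι] [Fintype υ] [DecidableEq ι] [DecidableEq υ]

/-- The second component `Bᵀ σ + C u + T (u - û)` of the numerical flux, at the point `x` and for
the unit normal `n`. -/
def flux (S : TwoFieldSystem d ι υ) (x n : E d) (s : ι → ℝ) (u uh : υ → ℝ) : υ → ℝ :=
  (S.Bn x n)ᵀ *ᵥ s + S.Cn x n *ᵥ u + S.T x n *ᵥ (u - uh)

/-- The two local equations on the element `K`, for the volume unknowns `(s, u)`, the trace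
unknown `uh` and the forcing `f`. -/
def IsLocalSolution (S : TwoFieldSystem d ι υ) (𝓣 : Mesh Ω) (p : Fin 𝓣.N → ℕ)
    (f : E d → ι ⊕ υ → ℝ) (uh : TraceSpace 𝓣 p υ) (K : Fin 𝓣.N)
    (s : ι → Poly d (p K)) (u : υ → Poly d (p K)) : Prop :=
  (∀ t : ι → Poly d (p K),
    -(∑ k, ∫ x in (𝓣.elem K).carrier, (S.B k x *ᵥ vec (coes u) x) ⬝ᵥ vec (dcoes k t) x)
    + (∫ x in (𝓣.elem K).carrier,
        ((S.G x).toBlocks₁₁ *ᵥ vec (coes s) x + (S.G x).toBlocks₁₂ *ᵥ vec (coes u) x)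
          ⬝ᵥ vec (coes t) x)
    + 𝓣.boundaryIntegral K (fun F e x =>
        (S.Bn x (𝓣.normal F) *ᵥ tvec (uh e) x) ⬝ᵥ vec (coes t) x)
    = ∫ x in (𝓣.elem K).carrier, (fun i => f x (.inl i)) ⬝ᵥ vec (coes t) x) ∧
  (∀ v : υ → Poly d (p K),
    -(∑ k, ∫ x in (𝓣.elem K).carrier,
        ((S.B k x)ᵀ *ᵥ vec (coes s) x + S.C k x *ᵥ vec (coes u) x) ⬝ᵥ vec (dcoes k v) x)
    + (∫ x in (𝓣.elem K).carrier,
        ((S.G x).toBlocks₂₁ *ᵥ vec (coes s) x + (S.G x).toBlocks₂₂ *ᵥ vec (coes u) x)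
          ⬝ᵥ vec (coes v) x)
    + 𝓣.boundaryIntegral K (fun F e x =>
        flux S x (𝓣.normal F) (vec (coes s) x) (vec (coes u) x) (tvec (uh e) x)
          ⬝ᵥ vec (coes v) x)
    = ∫ x in (𝓣.elem K).carrier, (fun j => f x (.inr j)) ⬝ᵥ vec (coes v) x)

/-- The integral `⟨⟦Bᵀ σ + C u + T (u - û)⟧, v̂⟩_e` over a mortar `e`; the jump is the sum of the
one-sided values on an interior mortar, and the value itself on a boundary mortar. -/
def jumpIntegral (S : TwoFieldSystem d ι υ) (𝓣 : Mesh Ω) (p : Fin 𝓣.N → ℕ)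
    (s : VolSpace 𝓣 p ι) (u : VolSpace 𝓣 p υ) (uh : TraceSpace 𝓣 p υ) (e : 𝓣.Mortar)
    (vh : υ → polyOn (𝓣.mortarDegree p e) (𝓣.mortarSet e)) : ℝ :=
  ∫ x, (∑ F ∈ 𝓣.sides e,
      flux S x (𝓣.normal F) (vec (coes (s F.1)) x) (vec (coes (u F.1)) x) (tvec (uh e) x))
        ⬝ᵥ tvec vh x ∂𝓣.mortarMeasure e

/-- The complete `hp`-HDG formulation with forcing `f` and boundary data `g`: the local equations
on all elements, the conservation condition on the interior mortars, and on the boundary mortars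
`û = g` (Dirichlet) or `-(Bᵀ σ + C u + T (u - û)) + (ρ I + C) û = g` (Neumann, Robin), weakly. -/
def IsHDGSolution (S : TwoFieldSystem d ι υ) (𝓣 : Mesh Ω) (p : Fin 𝓣.N → ℕ)
    (Γ : BoundaryParts Ω) (ρ : E d → ℝ) (f : E d → ι ⊕ υ → ℝ) (g : E d → υ → ℝ)
    (s : VolSpace 𝓣 p ι) (u : VolSpace 𝓣 p υ) (uh : TraceSpace 𝓣 p υ) : Prop :=
  (∀ K, IsLocalSolution S 𝓣 p f uh K (s K) (u K)) ∧
  (∀ q, ∀ vh : υ → polyOn (𝓣.mortarDegree p (.inl q)) (𝓣.mortarSet (.inl q)),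
    jumpIntegral S 𝓣 p s u uh (.inl q) vh = 0) ∧
  (∀ F, 𝓣.LiesOn (.inr F) Γ.N ∨ 𝓣.LiesOn (.inr F) Γ.R →
    ∀ vh : υ → polyOn (𝓣.mortarDegree p (.inr F)) (𝓣.mortarSet (.inr F)),
    jumpIntegral S 𝓣 p s u uh (.inr F) vh =
      ∫ x, ((ρ x • (1 : Matrix υ υ ℝ) + S.Cn x (𝓣.normal F.1)) *ᵥ tvec (uh (.inr F)) x - g x)
        ⬝ᵥ tvec vh x ∂𝓣.mortarMeasure (.inr F)) ∧
  (∀ F, 𝓣.LiesOn (.inr F) Γ.D →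
    ∀ vh : υ → polyOn (𝓣.mortarDegree p (.inr F)) (𝓣.mortarSet (.inr F)),
    ∫ x, tvec (uh (.inr F)) x ⬝ᵥ tvec vh x ∂𝓣.mortarMeasure (.inr F) =
      ∫ x, g x ⬝ᵥ tvec vh x ∂𝓣.mortarMeasure (.inr F))

/-- Local well-posedness: for every square integrable forcing and every trace field, the local
equations on each element have exactly one solution. -/
def LocallyWellPosed (S : TwoFieldSystem d ι υ) (𝓣 : Mesh Ω) (p : Fin 𝓣.N → ℕ) : Prop :=
  ∀ f : E d → ι ⊕ υ → ℝ, (∀ i, MemLp (fun x => f x i) 2 (volume.restrict Ω)) →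
    ∀ (uh : TraceSpace 𝓣 p υ) (K : Fin 𝓣.N),
      ∃! su : (ι → Poly d (p K)) × (υ → Poly d (p K)), IsLocalSolution S 𝓣 p f uh K su.1 su.2

/-- Global well-posedness: for all square integrable forcing and boundary data, the complete
`hp`-HDG formulation has exactly one solution. -/
def GloballyWellPosed (S : TwoFieldSystem d ι υ) (𝓣 : Mesh Ω) (p : Fin 𝓣.N → ℕ)
    (Γ : BoundaryParts Ω) (ρ : E d → ℝ) : Prop :=
  ∀ f : E d → ι ⊕ υ → ℝ, (∀ i, MemLp (fun x => f x i) 2 (volume.restrict Ω)) →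
    ∀ g : E d → υ → ℝ, (∀ j, MemLp (fun x => g x j) 2 ((surf d).restrict (frontier Ω))) →
      ∃! w : VolSpace 𝓣 p ι × VolSpace 𝓣 p υ × TraceSpace 𝓣 p υ,
        IsHDGSolution S 𝓣 p Γ ρ f g w.1 w.2.1 w.2.2

end Scheme

/-! ## Anisotropic diffusion -/

/-- A diffusivity coefficient: essentially bounded, symmetric and uniformly positive definite. -/
structure IsDiffusivity {d : ℕ} (Ω : Set (E d)) (κ : E d → Matrix (Fin d) (Fin d) ℝ) : Prop where
  bounded : ∀ i j, MemLp (fun x => κ x i j) ⊤ (volume.restrict Ω)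
  symm : ∀ᵐ x ∂volume.restrict Ω, (κ x)ᵀ = κ x
  coercive : ∃ κ₀ : ℝ, 0 < κ₀ ∧
    ∀ᵐ x ∂volume.restrict Ω, NonnegForm (κ x - κ₀ • (1 : Matrix (Fin d) (Fin d) ℝ))

/-- The two-field system of the mixed form `∇u + κ⁻¹ σ = 0`, `∇·σ = f` of `-∇·(κ∇u) = f`. -/
def diffusionSystem {d : ℕ} (κ : E d → Matrix (Fin d) (Fin d) ℝ) :
    TwoFieldSystem d (Fin d) (Fin 1) where
  A := fun k _ => fromBlocks 0 (Matrix.of fun i _ => if i = k then 1 else 0)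
    (Matrix.of fun _ i => if i = k then 1 else 0) 0
  G := fun x => fromBlocks (κ x)⁻¹ 0 0 0

/-- The pair `(σ, u)`, for a scalar `u`. -/
def pair {d : ℕ} (s : Fin d → ℝ) (u : ℝ) : Fin d ⊕ Fin 1 → ℝ := Sum.elim s fun _ => u

end HDG

end

noncomputable section

namespace HDG

open Filter Topology

/-! ## Matrix absolute value -/

/-! The algebra rests on one identity. For a unit normal, A = [0, n; nᵀ, 0] satisfies A³ = A, so its
eigenvalues lie in {-1, 0, 1} and |A| = A² = diag(n nᵀ, 1). This gives the flux case (F2) and T = 1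
at once. The Aₖ are constant, so their distributional divergence is 0, and partial coercivity
reduces to boundedness and uniform positivity of κ⁻¹, which follow from the bounds on κ
(`abs_inv_apply_le`, `inv_coercive`).

For well-posedness, both the local equations and the complete formulation are square linear systems:
the equations are indexed by the same finite-dimensional spaces as the unknowns. Existence and
uniqueness therefore follow once the homogeneous problem has only the zero solution
(`existsUnique_of_finrank_eq`).

For the homogeneous problem, test the local equations with the solution itself. Integration by parts
cancels the volume terms that couple σ and u, leaving on each element (κ⁻¹σ, σ) + ⟨σ·n + (u - û), û⟩
+ ‖u - û‖² = 0, with the last two terms taken on the boundary of the element (`form₁_add_form₂`).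
Summed over the mesh and regrouped mortar by mortar, the middle terms become the jump of the flux
tested with û. That is 0 on interior mortars, 0 on Dirichlet mortars since û = 0 there, and ∫ λ û² ≥
0 on the others (`mortar_energy`). All terms are nonnegative, so σ = 0, u = û on every mortar, and û
= 0 on Dirichlet and Robin mortars. The first local equation now says (∇u, t) = 0 for all admissible
t, and t = ∇u is admissible, so u is constant on each element (`exists_eq_C_of_form₁`). Neighbours
share û, hence share the constant. Ω is connected and some boundary mortar is Dirichlet or Robin, so
all constants vanish (`eq_zero_of_global_homogeneous`). The unknowns are tested only with themselves
and with ∇u, which is why the degrees may be arbitrary.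

Two geometric facts support this on nonconforming meshes. One is the divergence theorem on a convex
polytope whose boundary integral is split over mortars. It is proved by smoothing the indicator
function with ramps (`Element.integral_fderiv_eq_sum_faces`), and by showing that the mortars of a
face cover it with null overlaps (`Mesh.surf_restrict_faceSet`). The other is that interior mortars
connect all elements (`Mesh.eq_of_forall_interior_mortar`): a set of zero surface measure cannot
separate a ball, because a segment can be translated off it. -/

theorem symAbs_eq_mul_self {m : Type} [Fintype m] [DecidableEq m] {A : Matrix m m ℝ}
    (hA : A.IsHermitian) (h3 : A * A * A = A) : symAbs A = A * A := by
  classical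
  have hdec : ∀ i : DecidableEq m, i = Classical.decEq m := fun i => Subsingleton.elim _ _
  rw [symAbs, dif_pos hA]
  set U : Matrix m m ℝ := (hA.eigenvectorUnitary : Matrix m m ℝ) with hU
  have hUU : star U * U = 1 := Unitary.coe_star_mul_self hA.eigenvectorUnitary
  have hUU' : U * star U = 1 := Unitary.coe_mul_star_self hA.eigenvectorUnitary
  have hinv : U⁻¹ = star U := Matrix.inv_eq_right_inv hUU'
  have hs : A = U * diagonal hA.eigenvalues * star U := by
    conv_lhs => rw [hA.spectral_theorem]
    rw [Unitary.conjStarAlgAut_apply]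
    rfl
  have hmul : ∀ D D' : Matrix m m ℝ, (U * D * star U) * (U * D' * star U) = U * (D * D') * star U := by
    intro D D'
    calc (U * D * star U) * (U * D' * star U) = U * D * (star U * U) * D' * star U := by
          simp only [Matrix.mul_assoc]
      _ = _ := by rw [hUU]; simp only [Matrix.mul_assoc, Matrix.one_mul]
  have hD : ∀ D : Matrix m m ℝ, star U * (U * D * star U) * U = D := by
    intro D
    calc star U * (U * D * star U) * U = (star U * U) * D * (star U * U) := by
          simp only [Matrix.mul_assoc]
      _ = D := by rw [hUU]; simp
  have h3' : diagonal (fun i => hA.eigenvalues i * hA.eigenvalues i * hA.eigenvalues i) =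
      diagonal hA.eigenvalues := by
    have : U * (diagonal hA.eigenvalues * diagonal hA.eigenvalues * diagonal hA.eigenvalues) *
        star U = U * diagonal hA.eigenvalues * star U := by
      rw [← hmul, ← hmul, ← hs, h3]
    have h := congrArg (fun X => star U * X * U) this
    simp only [hD, diagonal_mul_diagonal] at h
    exact h
  -- A³ = A gives l³ = l for every eigenvalue, so l is 0, 1 or -1, and there |l| = l².
  have habs : ∀ i, |hA.eigenvalues i| = hA.eigenvalues i * hA.eigenvalues i := by
    intro i
    have h := diagonal_injective h3'
    have h := congrFun h i
    set l := hA.eigenvalues i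
    have : l * (l - 1) * (l + 1) = 0 := by linear_combination h
    rcases mul_eq_zero.1 this with h | h
    · rcases mul_eq_zero.1 h with h | h
      · simp [h]
      · rw [sub_eq_zero.1 h]; simp
    · rw [eq_neg_of_add_eq_zero_left h]; simp
  rw [hinv]
  simp_rw [habs]
  rw [← diagonal_mul_diagonal, ← hmul, ← hs]

/-! ## Coefficients of the diffusion system -/

section Coefficients

variable {d : ℕ} (κ : E d → Matrix (Fin d) (Fin d) ℝ) (x n : E d)

theorem sum_mul_self_eq_one {n : E d} (hn : ‖n‖ = 1) : ∑ i, n i * n i = 1 := by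
  have := EuclideanSpace.real_norm_sq_eq n
  rw [hn] at this
  simp only [one_pow] at this
  rw [this]
  exact Finset.sum_congr rfl fun i _ => by ring

@[simp] theorem diffusionSystem_B (k : Fin d) :
    (diffusionSystem κ).B k x = Matrix.of fun i _ => if i = k then 1 else 0 := by
  simp [TwoFieldSystem.B, diffusionSystem]

@[simp] theorem diffusionSystem_C (k : Fin d) : (diffusionSystem κ).C k x = 0 := by
  simp [TwoFieldSystem.C, diffusionSystem]

@[simp] theorem diffusionSystem_Bn : (diffusionSystem κ).Bn x n = Matrix.of fun i _ => n i := by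
  ext i j
  simp [TwoFieldSystem.Bn, Matrix.sum_apply]

@[simp] theorem diffusionSystem_Cn : (diffusionSystem κ).Cn x n = 0 := by
  simp [TwoFieldSystem.Cn]

theorem diffusionSystem_An : (diffusionSystem κ).An x n =
    fromBlocks 0 (Matrix.of fun i _ => n i) (Matrix.of fun _ i => n i) 0 := by
  ext i j
  rcases i with i | i <;> rcases j with j | j <;>
    simp [TwoFieldSystem.An, diffusionSystem, Matrix.sum_apply]

theorem isHermitian_An : ((diffusionSystem κ).An x n).IsHermitian := by
  rw [diffusionSystem_An, IsHermitian]
  ext i j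
  rcases i with i | i <;> rcases j with j | j <;> simp [conjTranspose_apply]

theorem An_mul_An {n : E d} (hn : ‖n‖ = 1) : (diffusionSystem κ).An x n * (diffusionSystem κ).An x n =
    fromBlocks (Matrix.of fun i j => n i * n j) 0 0 1 := by
  rw [diffusionSystem_An, fromBlocks_multiply]
  congr 1
  · ext i j; simp [Matrix.mul_apply]
  · simp
  · simp
  · ext i j
    obtain rfl : i = j := Subsingleton.elim _ _
    simp [Matrix.mul_apply, sum_mul_self_eq_one hn]

/-- A maps (σ, u) to (u n, σ·n): it swaps the unit vectors (n, 0) and (0, 1) and kills their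
orthogonal complement. -/
theorem An_cube {n : E d} (hn : ‖n‖ = 1) : (diffusionSystem κ).An x n * (diffusionSystem κ).An x n *
    (diffusionSystem κ).An x n = (diffusionSystem κ).An x n := by
  rw [An_mul_An κ x hn, diffusionSystem_An, fromBlocks_multiply]
  congr 1
  · simp
  · ext i j
    simp [Matrix.mul_apply, mul_assoc, ← Finset.mul_sum, sum_mul_self_eq_one hn]
  · simp
  · simp

theorem symAbs_An {n : E d} (hn : ‖n‖ = 1) : symAbs ((diffusionSystem κ).An x n) =
    fromBlocks (Matrix.of fun i j => n i * n j) 0 0 1 := by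
  rw [symAbs_eq_mul_self (isHermitian_An κ x n) (An_cube κ x hn), An_mul_An κ x hn]

theorem diffusionSystem_T {n : E d} (hn : ‖n‖ = 1) : (diffusionSystem κ).T x n = 1 := by
  have h := symAbs_An κ x hn
  have h2 : (diffusionSystem κ).T x n = (symAbs ((diffusionSystem κ).An x n)).toBlocks₂₂ := by
    unfold TwoFieldSystem.T
    congr!
  rw [h2, h, toBlocks_fromBlocks₂₂]

theorem fluxCaseF2 (Ω : Set (E d)) : (diffusionSystem κ).FluxCaseF2 Ω := by
  intro x _ n hn
  have h := symAbs_An κ x hn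
  have h2 : (symAbs ((diffusionSystem κ).An x n)).toBlocks₁₂ = 0 := by
    rw [h, toBlocks_fromBlocks₁₂]
  convert h2

theorem posForm_T {n : E d} (hn : ‖n‖ = 1) :
    PosForm ((1 / 2 : ℝ) • (diffusionSystem κ).Cn x n + (diffusionSystem κ).T x n) := by
  intro z hz
  rw [diffusionSystem_T κ x hn]
  have : z 0 ≠ 0 := fun h => hz (by ext i; rw [Subsingleton.elim i 0]; simpa using h)
  simpa [dotProduct] using mul_self_pos.2 this

/-- The range of Bₖ is the k-th coordinate axis. Two distinct axes exist because d ≥ 2, and they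
meet only at the origin. -/
theorem iInf_range_B (hd : 2 ≤ d) :
    ⨅ k, LinearMap.range ((diffusionSystem κ).B k x).mulVecLin = ⊥ := by
  rw [eq_bot_iff]
  intro v hv
  rw [Submodule.mem_iInf] at hv
  have key : ∀ k i, i ≠ k → v i = 0 := by
    intro k i hik
    obtain ⟨w, rfl⟩ := hv k
    simp [mulVec, dotProduct, hik]
  rw [Submodule.mem_bot]
  ext i
  by_cases h : i = ⟨0, by lia⟩
  · exact key ⟨1, by lia⟩ i (by rw [h]; simp [Fin.ext_iff])
  · exact key _ i h

theorem ker_B (k : Fin d) : LinearMap.ker ((diffusionSystem κ).B k x).mulVecLin = ⊥ := by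
  rw [LinearMap.ker_eq_bot']
  intro w hw
  have := congrFun hw k
  ext j
  rw [Subsingleton.elim j 0]
  simpa [mulVec, dotProduct] using this

end Coefficients

/-! ## Boundary operators -/

section Boundary

variable {d : ℕ} (κ : E d → Matrix (Fin d) (Fin d) ℝ) (x : E d) {n : E d}

theorem eq_pair (z : Fin d ⊕ Fin 1 → ℝ) : z = pair (fun i => z (.inl i)) (z (.inr 0)) := by
  ext i
  rcases i with i | i
  · rfl
  · rw [Subsingleton.elim i 0]; rfl

theorem boundaryOp_mulVec (α ρ : ℝ) (s : Fin d → ℝ) (u : ℝ) :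
    (diffusionSystem κ).boundaryOp α ρ x n *ᵥ pair s u =
      pair (fun i => -(α * n i * u)) (α * ∑ i, s i * n i + 2 * ρ * u) := by
  ext i
  rcases i with i | i
  · simp [TwoFieldSystem.boundaryOp, mulVec, dotProduct, pair]
  · rw [Subsingleton.elim i 0]
    simp only [TwoFieldSystem.boundaryOp, mulVec, dotProduct, pair, Finset.mul_sum,
      Fintype.sum_sum_type]
    simp
    exact Finset.sum_congr rfl fun i _ => by ring

theorem An_mulVec (s : Fin d → ℝ) (u : ℝ) : (diffusionSystem κ).An x n *ᵥ pair s u =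
    pair (fun i => n i * u) (∑ i, s i * n i) := by
  ext i
  rcases i with i | i
  · simp [diffusionSystem_An, mulVec, dotProduct, pair]
  · simp [diffusionSystem_An, mulVec, dotProduct, pair]
    exact Finset.sum_congr rfl fun i _ => by ring

theorem An_sub_boundaryOp_mulVec (α ρ : ℝ) (s : Fin d → ℝ) (u : ℝ) :
    ((diffusionSystem κ).An x n - (diffusionSystem κ).boundaryOp α ρ x n) *ᵥ pair s u =
      pair (fun i => (1 + α) * u * n i) ((1 - α) * ∑ i, s i * n i - 2 * ρ * u) := by
  rw [sub_mulVec, An_mulVec, boundaryOp_mulVec]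
  ext i
  rcases i with i | i <;> simp [pair] <;> ring

theorem An_add_boundaryOp_mulVec (α ρ : ℝ) (s : Fin d → ℝ) (u : ℝ) :
    ((diffusionSystem κ).An x n + (diffusionSystem κ).boundaryOp α ρ x n) *ᵥ pair s u =
      pair (fun i => (1 - α) * u * n i) ((1 + α) * ∑ i, s i * n i + 2 * ρ * u) := by
  rw [add_mulVec, An_mulVec, boundaryOp_mulVec]
  ext i
  rcases i with i | i <;> simp [pair] <;> ring

theorem pair_injective {s s' : Fin d → ℝ} {u u' : ℝ} : pair s u = pair s' u' ↔ s = s' ∧ u = u' := by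
  constructor
  · intro h
    exact ⟨funext fun i => congrFun h (.inl i), congrFun h (.inr 0)⟩
  · rintro ⟨rfl, rfl⟩; rfl

theorem pair_add (s s' : Fin d → ℝ) (u u' : ℝ) : pair s u + pair s' u' = pair (s + s') (u + u') := by
  ext i
  rcases i with i | i <;> rfl

theorem pair_eq_zero {s : Fin d → ℝ} {u : ℝ} : pair s u = 0 ↔ s = 0 ∧ u = 0 := by
  rw [← pair_injective]
  have : (0 : Fin d ⊕ Fin 1 → ℝ) = pair 0 0 := by ext i; rcases i with i | i <;> rfl
  rw [this]

/-- The off-diagonal blocks of M are skew and cancel in the quadratic form, which leaves 2ρu². -/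
theorem nonnegForm_boundaryOp {α ρ : ℝ} (hρ : 0 ≤ ρ) :
    NonnegForm ((diffusionSystem κ).boundaryOp α ρ x n) := by
  intro z
  rw [eq_pair z, boundaryOp_mulVec]
  have : ∀ (s s' : Fin d → ℝ) (u u' : ℝ), pair s u ⬝ᵥ pair s' u' = ∑ i, s i * s' i + u * u' := by
    intros; simp [dotProduct, pair]
  rw [this, mul_add, ← add_assoc]
  have h0 : ∑ i, z (.inl i) * -(α * n i * z (.inr 0)) +
      z (.inr 0) * (α * ∑ i, z (.inl i) * n i) = 0 := by
    rw [Finset.mul_sum, Finset.mul_sum, ← Finset.sum_add_distrib]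
    exact Finset.sum_eq_zero fun i _ => by ring
  rw [h0]
  nlinarith [mul_nonneg hρ (mul_self_nonneg (z (.inr 0)))]

theorem admissible_boundaryOp_dirichlet (hn : ‖n‖ = 1) :
    TwoFieldSystem.AdmissibleBoundaryOp ((diffusionSystem κ).An x n)
      ((diffusionSystem κ).boundaryOp 1 (1 / 2) x n) := by
  refine ⟨nonnegForm_boundaryOp κ x (by norm_num), eq_top_iff.2 fun z _ => ?_⟩
  rw [eq_pair z]
  set s : Fin d → ℝ := fun i => z (.inl i)
  set u := z (.inr 0)
  -- Null(A - M) is u = 0 and Null(A + M) is 2 σ·n + u = 0. So the second summand has to carry u,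
  -- together with the flux -(u/2) n.
  refine Submodule.mem_sup.2 ⟨pair (fun i => s i + u / 2 * n i) 0, ?_,
    pair (fun i => -(u / 2 * n i)) u, ?_, ?_⟩
  · rw [LinearMap.mem_ker, mulVecLin_apply, An_sub_boundaryOp_mulVec, pair_eq_zero]
    constructor
    · ext; simp
    · simp
  · rw [LinearMap.mem_ker, mulVecLin_apply, An_add_boundaryOp_mulVec, pair_eq_zero]
    constructor
    · ext; simp
    · have : ∑ i, -(u / 2 * n i) * n i = -(u / 2) * ∑ i, n i * n i := by
        rw [Finset.mul_sum]; exact Finset.sum_congr rfl fun i _ => by ring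
      rw [this, sum_mul_self_eq_one hn]; ring
  · rw [pair_add, pair_injective]
    constructor
    · ext; simp
    · simp

theorem admissible_boundaryOp_robin (hn : ‖n‖ = 1) {ρ : ℝ} (hρ : 0 ≤ ρ) :
    TwoFieldSystem.AdmissibleBoundaryOp ((diffusionSystem κ).An x n)
      ((diffusionSystem κ).boundaryOp (-1) ρ x n) := by
  refine ⟨nonnegForm_boundaryOp κ x hρ, eq_top_iff.2 fun z _ => ?_⟩
  rw [eq_pair z]
  set s : Fin d → ℝ := fun i => z (.inl i)
  set u := z (.inr 0)
  -- Null(A - M) is now σ·n = ρu and Null(A + M) contains every vector with u = 0. So the first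
  -- summand carries u, together with the flux ρu n.
  refine Submodule.mem_sup.2 ⟨pair (fun i => ρ * u * n i) u, ?_,
    pair (fun i => s i - ρ * u * n i) 0, ?_, ?_⟩
  · rw [LinearMap.mem_ker, mulVecLin_apply, An_sub_boundaryOp_mulVec, pair_eq_zero]
    constructor
    · ext; simp
    · have : ∑ i, ρ * u * n i * n i = ρ * u * ∑ i, n i * n i := by
        rw [Finset.mul_sum]; exact Finset.sum_congr rfl fun i _ => by ring
      rw [this, sum_mul_self_eq_one hn]; ring
  · rw [LinearMap.mem_ker, mulVecLin_apply, An_add_boundaryOp_mulVec, pair_eq_zero]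
    constructor
    · ext; simp
    · simp
  · rw [pair_add, pair_injective]
    constructor
    · ext; simp
    · simp

theorem dirichlet_condition_iff (s s' : Fin d → ℝ) (u u' : ℝ) :
    (((diffusionSystem κ).An x n - (diffusionSystem κ).boundaryOp 1 (1 / 2) x n) *ᵥ pair s u =
      ((diffusionSystem κ).An x n - (diffusionSystem κ).boundaryOp 1 (1 / 2) x n) *ᵥ pair s' u') ↔
      u = u' := by
  rw [An_sub_boundaryOp_mulVec, An_sub_boundaryOp_mulVec, pair_injective]
  constructor
  · rintro ⟨-, h⟩
    linarith
  · rintro rfl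
    simp

theorem robin_condition_iff (ρ : ℝ) (s s' : Fin d → ℝ) (u u' : ℝ) :
    (((diffusionSystem κ).An x n - (diffusionSystem κ).boundaryOp (-1) ρ x n) *ᵥ pair s u =
      ((diffusionSystem κ).An x n - (diffusionSystem κ).boundaryOp (-1) ρ x n) *ᵥ pair s' u') ↔
      -(∑ k, s k * n k) + ρ * u = -(∑ k, s' k * n k) + ρ * u' := by
  rw [An_sub_boundaryOp_mulVec, An_sub_boundaryOp_mulVec, pair_injective]
  constructor
  · rintro ⟨-, h⟩
    linarith
  · intro h
    constructor
    · ext; simp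
    · linarith

end Boundary

/-! ## Strong form -/

/-- Aₖ z = (u eₖ, σₖ), so summing the ∂ₖ produces (∇u, ∇·σ). -/
theorem strongForm_diffusionSystem {d : ℕ} (κ : E d → Matrix (Fin d) (Fin d) ℝ) (x : E d)
    (s : E d → Fin d → ℝ) (u : E d → ℝ) (hs : DifferentiableAt ℝ s x)
    (hu : DifferentiableAt ℝ u x) :
    (diffusionSystem κ).strongForm (fun y => pair (s y) (u y)) x =
      pair ((fun k => fderiv ℝ u x (basisVec k)) + (κ x)⁻¹ *ᵥ s x)
        (∑ k, fderiv ℝ s x (basisVec k) k) := by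
  have hA : ∀ k y, (diffusionSystem κ).A k y *ᵥ pair (s y) (u y) =
      pair (fun i => if i = k then u y else 0) (s y k) := by
    intro k y
    ext i
    rcases i with i | i <;> simp [diffusionSystem, mulVec, dotProduct, pair]
  have hd : ∀ k, HasFDerivAt (fun y => (diffusionSystem κ).A k y *ᵥ pair (s y) (u y))
      (ContinuousLinearMap.pi fun j : Fin d ⊕ Fin 1 => Sum.elim
        (fun i : Fin d => if i = k then fderiv ℝ u x else 0)
        (fun _ => (ContinuousLinearMap.proj k).comp (fderiv ℝ s x)) j) x := by
    intro k
    simp_rw [hA]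
    rw [hasFDerivAt_pi]
    rintro (i | i)
    · by_cases h : i = k
      · simpa [pair, h] using hu.hasFDerivAt
      · simpa [pair, h] using hasFDerivAt_const (0 : ℝ) x
    · exact (hasFDerivAt_pi'.1 hs.hasFDerivAt) k
  unfold TwoFieldSystem.strongForm
  simp_rw [fun k => (hd k).fderiv]
  ext i
  rcases i with i | i
  · simp [pair, diffusionSystem, mulVec, dotProduct]
    exact Finset.sum_eq_single i (by intro b _ hb; simp [hb.symm]) (by simp) |>.trans (by simp)
  · simp [pair, diffusionSystem, mulVec, dotProduct]

theorem strongForm_diffusionSystem_iff {d : ℕ} (κ : E d → Matrix (Fin d) (Fin d) ℝ) (x : E d)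
    (s : E d → Fin d → ℝ) (u : E d → ℝ) (f : ℝ) (hs : DifferentiableAt ℝ s x)
    (hu : DifferentiableAt ℝ u x) :
    (diffusionSystem κ).strongForm (fun y => pair (s y) (u y)) x = pair 0 f ↔
      (fun k => fderiv ℝ u x (basisVec k)) + (κ x)⁻¹ *ᵥ s x = 0 ∧
        ∑ k, fderiv ℝ s x (basisVec k) k = f := by
  rw [strongForm_diffusionSystem κ x s u hs hu, pair_injective]

/-! ## The inverse of a diffusivity -/

section Inverse

variable {d : ℕ} {M : Matrix (Fin d) (Fin d) ℝ} {κ₀ : ℝ}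

theorem dotProduct_self_nonneg (z : Fin d → ℝ) : 0 ≤ z ⬝ᵥ z :=
  Finset.sum_nonneg fun _ _ => mul_self_nonneg _

theorem NonnegForm.le_of_sub_smul_one (hM : NonnegForm (M - κ₀ • (1 : Matrix (Fin d) (Fin d) ℝ)))
    (z : Fin d → ℝ) : κ₀ * (z ⬝ᵥ z) ≤ z ⬝ᵥ (M *ᵥ z) := by
  have := hM z
  rw [sub_mulVec, dotProduct_sub, smul_mulVec, one_mulVec, dotProduct_smul, smul_eq_mul] at this
  linarith

theorem isUnit_of_coercive (hκ₀ : 0 < κ₀)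
    (hM : NonnegForm (M - κ₀ • (1 : Matrix (Fin d) (Fin d) ℝ))) : IsUnit M := by
  rw [← mulVec_injective_iff_isUnit]
  refine (injective_iff_map_eq_zero M.mulVecLin).2 fun z hz => ?_
  have h := hM.le_of_sub_smul_one z
  rw [← mulVecLin_apply, hz, dotProduct_zero] at h
  have h0 : 0 ≤ z ⬝ᵥ z := dotProduct_self_nonneg z
  exact dotProduct_self_eq_zero.1 (by nlinarith)

theorem mulVec_inv_mulVec (hM : IsUnit M) (z : Fin d → ℝ) : M *ᵥ (M⁻¹ *ᵥ z) = z := by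
  rw [mulVec_mulVec, mul_nonsing_inv _ ((isUnit_iff_isUnit_det M).1 hM), one_mulVec]

theorem inv_mulVec_mulVec (hM : IsUnit M) (z : Fin d → ℝ) : M⁻¹ *ᵥ (M *ᵥ z) = z := by
  rw [mulVec_mulVec, nonsing_inv_mul _ ((isUnit_iff_isUnit_det M).1 hM), one_mulVec]

theorem sq_le_dotProduct_self (z : Fin d → ℝ) (i : Fin d) : z i ^ 2 ≤ z ⬝ᵥ z := by
  rw [pow_two]
  exact Finset.single_le_sum (f := fun i => z i * z i) (fun i _ => mul_self_nonneg _)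
    (Finset.mem_univ i)

/-- With y = M⁻¹eⱼ, coercivity reads κ₀|y|² ≤ yⱼ. Since yⱼ² ≤ |y|², this gives yⱼ ≤ κ₀⁻¹ and then
|y|² ≤ κ₀⁻², which bounds every entry of the column. -/
theorem abs_inv_apply_le (hκ₀ : 0 < κ₀)
    (hM : NonnegForm (M - κ₀ • (1 : Matrix (Fin d) (Fin d) ℝ))) (i j : Fin d) :
    |M⁻¹ i j| ≤ κ₀⁻¹ := by
  have hu := isUnit_of_coercive hκ₀ hM
  set y : Fin d → ℝ := M⁻¹ *ᵥ Pi.single j 1 with hy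
  have hyi : ∀ i, y i = M⁻¹ i j := fun i => by simp [hy]
  have h := hM.le_of_sub_smul_one y
  rw [hy, mulVec_inv_mulVec hu, ← hy, dotProduct_single_one] at h
  have hi := sq_le_dotProduct_self y i
  have hj := sq_le_dotProduct_self y j
  have h1 : y ⬝ᵥ y ≤ κ₀⁻¹ * y j := by
    rw [inv_mul_eq_div, le_div_iff₀ hκ₀]; linarith
  have hk : 0 < κ₀⁻¹ := inv_pos.2 hκ₀
  have h2 : y j ≤ κ₀⁻¹ := by
    by_contra! hlt
    nlinarith
  rw [← hyi]
  refine abs_le_of_sq_le_sq ?_ hk.le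
  nlinarith

/-- Cauchy–Schwarz in each row: a row has squared length at most d C², and there are d rows. -/
theorem dotProduct_self_mulVec_le {C : ℝ} (hC : ∀ i j, |M i j| ≤ C) (y : Fin d → ℝ) :
    (M *ᵥ y) ⬝ᵥ (M *ᵥ y) ≤ d * (d * C ^ 2) * (y ⬝ᵥ y) := by
  have hrow : ∀ i, (M *ᵥ y) i * (M *ᵥ y) i ≤ d * C ^ 2 * (y ⬝ᵥ y) := by
    intro i
    have h := Finset.sum_mul_sq_le_sq_mul_sq Finset.univ (fun j => M i j) y
    have h1 : ∑ j, M i j ^ 2 ≤ d * C ^ 2 := by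
      calc ∑ j, M i j ^ 2 ≤ ∑ _j : Fin d, C ^ 2 :=
            Finset.sum_le_sum fun j _ => sq_le_sq' (abs_le.1 (hC i j)).1 (abs_le.1 (hC i j)).2
        _ = d * C ^ 2 := by simp
    have h2 : ∑ j, y j ^ 2 = y ⬝ᵥ y := Finset.sum_congr rfl fun j _ => pow_two _
    rw [h2] at h
    calc (M *ᵥ y) i * (M *ᵥ y) i = (∑ j, M i j * y j) ^ 2 := by
          rw [pow_two]; rfl
      _ ≤ _ := h
      _ ≤ _ := mul_le_mul_of_nonneg_right h1 (dotProduct_self_nonneg y)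
  calc (M *ᵥ y) ⬝ᵥ (M *ᵥ y) ≤ ∑ _i : Fin d, d * C ^ 2 * (y ⬝ᵥ y) :=
        Finset.sum_le_sum fun i _ => hrow i
    _ = _ := by simp; ring

/-- With y = M⁻¹w, the form w·M⁻¹w equals y·My ≥ κ₀|y|², while |w|² = |My|² ≤ d²C²|y|². The `+ 1`
only keeps the denominator positive. -/
theorem inv_coercive {C : ℝ} (hκ₀ : 0 < κ₀)
    (hM : NonnegForm (M - κ₀ • (1 : Matrix (Fin d) (Fin d) ℝ))) (hC : ∀ i j, |M i j| ≤ C)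
    (w : Fin d → ℝ) : κ₀ / (d * (d * C ^ 2) + 1) * (w ⬝ᵥ w) ≤ w ⬝ᵥ (M⁻¹ *ᵥ w) := by
  have hu := isUnit_of_coercive hκ₀ hM
  set y := M⁻¹ *ᵥ w with hy
  have hw : w = M *ᵥ y := (mulVec_inv_mulVec hu w).symm
  have h1 := hM.le_of_sub_smul_one y
  have h2 := dotProduct_self_mulVec_le hC y
  have h0 : 0 ≤ y ⬝ᵥ y := dotProduct_self_nonneg y
  rw [← hw] at h1 h2
  rw [dotProduct_comm w y]
  have hp : (0 : ℝ) < d * (d * C ^ 2) + 1 := by positivity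
  calc κ₀ / (d * (d * C ^ 2) + 1) * (w ⬝ᵥ w) ≤
        κ₀ / (d * (d * C ^ 2) + 1) * ((d * (d * C ^ 2) + 1) * (y ⬝ᵥ y)) := by
        gcongr; nlinarith
    _ = κ₀ * (y ⬝ᵥ y) := by field_simp
    _ ≤ _ := h1

end Inverse

theorem MemLp.exists_ae_abs_le {α : Type*} [MeasurableSpace α] {μ : Measure α} {f : α → ℝ}
    (hf : MemLp f ⊤ μ) : ∃ C : ℝ, ∀ᵐ x ∂μ, |f x| ≤ C := by
  refine ⟨(eLpNormEssSup f μ).toReal, ?_⟩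
  have hfin : eLpNormEssSup f μ ≠ ⊤ := by
    have := hf.2
    rw [eLpNorm_exponent_top] at this
    exact this.ne
  filter_upwards [enorm_ae_le_eLpNormEssSup f μ] with x hx
  rw [← Real.norm_eq_abs, ← toReal_enorm]
  exact ENNReal.toReal_mono hfin hx

/-- The entries of the inverse are adjugate entries over the determinant. The formula also holds for
singular matrices, where both sides are 0 by convention. -/
theorem aemeasurable_matrix_inv {α : Type*} [MeasurableSpace α] {μ : Measure α} {d : ℕ}
    {κ : α → Matrix (Fin d) (Fin d) ℝ} (hκ : ∀ i j, AEMeasurable (fun x => κ x i j) μ)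
    (i j : Fin d) : AEMeasurable (fun x => (κ x)⁻¹ i j) μ := by
  have hm : AEMeasurable (fun x => (fun i j => κ x i j : Fin d → Fin d → ℝ)) μ :=
    aemeasurable_pi_lambda _ fun i => aemeasurable_pi_lambda _ fun j => hκ i j
  have hdet : Continuous fun N : Fin d → Fin d → ℝ => (Matrix.of N).det :=
    Continuous.matrix_det continuous_id
  have hadj : Continuous fun N : Fin d → Fin d → ℝ => (Matrix.of N).adjugate i j :=
    (Continuous.matrix_adjugate continuous_id).matrix_elem i j
  have h : (fun x => (κ x)⁻¹ i j) = fun x => ((κ x).det)⁻¹ * (κ x).adjugate i j := by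
    ext x
    rw [Matrix.inv_def, Ring.inverse_eq_inv', Matrix.smul_apply, smul_eq_mul]
  rw [h]
  exact (hdet.measurable.comp_aemeasurable hm).inv.mul (hadj.measurable.comp_aemeasurable hm)

namespace IsDiffusivity

variable {d : ℕ} {Ω : Set (E d)} {κ : E d → Matrix (Fin d) (Fin d) ℝ}

theorem memLp_inv (hκ : IsDiffusivity Ω κ) (i j : Fin d) :
    MemLp (fun x => (κ x)⁻¹ i j) ⊤ (volume.restrict Ω) := by
  obtain ⟨κ₀, hκ₀, hc⟩ := hκ.coercive
  refine memLp_top_of_bound (aemeasurable_matrix_inv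
    (fun i j => (hκ.bounded i j).1.aemeasurable) i j).aestronglyMeasurable κ₀⁻¹ ?_
  filter_upwards [hc] with x hx
  exact abs_inv_apply_le hκ₀ hx i j

theorem exists_inv_coercive (hκ : IsDiffusivity Ω κ) : ∃ k₀ : ℝ, 0 < k₀ ∧
    ∀ᵐ x ∂volume.restrict Ω, ∀ w : Fin d → ℝ, k₀ * (w ⬝ᵥ w) ≤ w ⬝ᵥ ((κ x)⁻¹ *ᵥ w) := by
  obtain ⟨κ₀, hκ₀, hc⟩ := hκ.coercive
  choose C hC using fun i j => MemLp.exists_ae_abs_le (hκ.bounded i j)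
  set B : ℝ := ∑ i, ∑ j, |C i j|
  have hB : ∀ i j, C i j ≤ B := fun i j =>
    (le_abs_self _).trans <| (Finset.single_le_sum (f := fun j => |C i j|)
      (fun _ _ => abs_nonneg _) (Finset.mem_univ j)).trans <|
      Finset.single_le_sum (f := fun i => ∑ j, |C i j|)
        (fun _ _ => Finset.sum_nonneg fun _ _ => abs_nonneg _) (Finset.mem_univ i)
  refine ⟨κ₀ / (d * (d * B ^ 2) + 1), by positivity, ?_⟩
  filter_upwards [hc, ae_all_iff.2 fun i => ae_all_iff.2 fun j => hC i j] with x hx hCx w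
  exact inv_coercive hκ₀ hx (fun i j => (hCx i j).trans (hB i j)) w

theorem flux_iff (hκ : IsDiffusivity Ω κ) : ∀ᵐ x ∂volume.restrict Ω, ∀ s v : Fin d → ℝ,
    v + (κ x)⁻¹ *ᵥ s = 0 ↔ s = -(κ x *ᵥ v) := by
  obtain ⟨κ₀, hκ₀, hc⟩ := hκ.coercive
  filter_upwards [hc] with x hx s v
  have hu := isUnit_of_coercive hκ₀ hx
  constructor
  · intro h
    rw [eq_neg_of_add_eq_zero_left h, mulVec_neg, mulVec_inv_mulVec hu, neg_neg]
  · rintro rfl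
    rw [mulVec_neg, inv_mulVec_mulVec hu, add_neg_cancel]

end IsDiffusivity

/-- Integration by parts against the constant function 1. -/
theorem integral_fderiv_eq_zero_of_hasCompactSupport {d : ℕ} {φ : E d → ℝ} (hφ : ContDiff ℝ 1 φ)
    (hc : HasCompactSupport φ) (v : E d) : ∫ x, fderiv ℝ φ x v = 0 := by
  have hd : Continuous fun x => fderiv ℝ φ x v := by
    have := hφ.continuous_fderiv one_ne_zero
    fun_prop
  have hdc : HasCompactSupport fun x => fderiv ℝ φ x v :=
    (hc.fderiv ℝ).comp_left (g := fun L : E d →L[ℝ] ℝ => L v) rfl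
  have h := integral_mul_fderiv_eq_neg_fderiv_mul_of_integrable (μ := (volume : Measure (E d)))
    (f := fun _ => (1 : ℝ)) (g := φ) (v := v) (by simp)
    (by simpa using hd.integrable_of_hasCompactSupport hdc)
    (by simpa using hφ.continuous.integrable_of_hasCompactSupport hc) (by simp)
    (fun x _ => hφ.differentiable one_ne_zero x)
  simpa using h

/-! ### Verification of the two-field assumptions -/

theorem isPartiallyCoercive_diffusionSystem {d : ℕ} {Ω : Set (E d)}
    {κ : E d → Matrix (Fin d) (Fin d) ℝ} (hκ : IsDiffusivity Ω κ) :
    (diffusionSystem κ).IsPartiallyCoercive Ω := by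
  -- The Aₖ do not depend on x, so their divergence is 0: each term is a constant times ∫ ∂ₖφ = 0.
  have hdiv : TwoFieldSystem.HasBoundedDiv Ω (diffusionSystem κ) fun _ => 0 := by
    refine ⟨fun i j => by simp, fun φ hφ hφc hφΩ i j => ?_⟩
    have hφ1 : ContDiff ℝ 1 φ := hφ.of_le (by exact_mod_cast le_top)
    have hA : ∀ k x, (diffusionSystem κ).A k x i j = (diffusionSystem κ).A k 0 i j := fun _ _ => rfl
    have hd : ∀ k : Fin d, Integrable (fun x => fderiv ℝ φ x (basisVec k)) := fun k => by
      have := hφ1.continuous_fderiv one_ne_zero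
      exact Continuous.integrable_of_hasCompactSupport (by fun_prop)
        ((hφc.fderiv ℝ).comp_left (g := fun L : E d →L[ℝ] ℝ => L (basisVec k)) rfl)
    have hz : ∀ k : Fin d, ∫ x in Ω, fderiv ℝ φ x (basisVec k) = 0 := fun k => by
      rw [setIntegral_eq_integral_of_forall_compl_eq_zero,
        integral_fderiv_eq_zero_of_hasCompactSupport hφ1 hφc]
      intro x hx
      rw [fderiv_of_notMem_tsupport ℝ fun h => hx (hφΩ h)]
      rfl
    simp_rw [hA]
    rw [integral_finsetSum _ fun k _ => ((hd k).const_mul _).integrableOn]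
    simp_rw [integral_const_mul, hz]
    simp
  obtain ⟨k₀, hk₀, hc⟩ := hκ.exists_inv_coercive
  have hblock : ∀ x, (diffusionSystem κ).G x = fromBlocks (κ x)⁻¹ 0 0 0 := fun _ => rfl
  -- The coercivity constant of κ⁻¹ serves both as μ₀ and as k₀, because the form of G + Gᵀ is 2 κ⁻¹
  -- on the flux component.
  refine ⟨?_, ⟨?_, _, hdiv⟩, ?_, ⟨k₀, hk₀, _, hdiv, ?_⟩, ⟨?_, ?_⟩, ?_, ⟨k₀, hk₀, ?_⟩⟩
  · rintro (i | i) (j | j)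
    · exact hκ.memLp_inv i j
    all_goals simp [diffusionSystem]
  · intro k i j
    exact memLp_top_const _
  · refine fun k => ae_of_all _ fun x => ?_
    ext i j
    rcases i with i | i <;> rcases j with j | j <;> simp [diffusionSystem]
  · filter_upwards [hc] with x hx z
    have h := hx fun i => z (.inl i)
    set w : Fin d → ℝ := fun i => z (.inl i)
    have h1 : ∀ N : Matrix (Fin d) (Fin d) ℝ, z ⬝ᵥ (fromBlocks N 0 0 (0 : Matrix (Fin 1) (Fin 1) ℝ) *ᵥ z) =
        w ⬝ᵥ (N *ᵥ w) := by
      intro N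
      simp [dotProduct, mulVec, w]
    have h2 : w ⬝ᵥ ((κ x)⁻¹ᵀ *ᵥ w) = w ⬝ᵥ ((κ x)⁻¹ *ᵥ w) := by
      rw [mulVec_transpose, dotProduct_comm, dotProduct_mulVec]
    rw [hblock, fromBlocks_transpose, add_zero, fromBlocks_add, fromBlocks_smul, sub_eq_add_neg,
      fromBlocks_neg, fromBlocks_add]
    simp only [transpose_zero, add_zero, smul_zero, neg_zero]
    rw [h1, add_mulVec, add_mulVec, neg_mulVec, smul_mulVec, one_mulVec]
    simp only [dotProduct_add, dotProduct_neg, dotProduct_smul, h2, smul_eq_mul]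
    linarith
  · refine ae_of_all _ fun x => ?_
    simp [hblock]
  · exact fun k => ⟨_, ae_of_all _ fun x => diffusionSystem_B κ x k⟩
  · refine fun k => ae_of_all _ fun x => ?_
    simp [diffusionSystem]
  · filter_upwards [hc] with x hx w
    rw [hblock, toBlocks_fromBlocks₁₁, sub_mulVec, smul_mulVec, one_mulVec, dotProduct_sub,
      dotProduct_smul, smul_eq_mul]
    linarith [hx w]

/-! ## Hyperplanes and surface measure -/

/-- Euclidean coordinates adapted to the hyperplanes with unit normal `n`. -/
structure HyperplaneChart {d : ℕ} (n : E d) where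
  L : E (d - 1) →ₗᵢ[ℝ] E d
  inner_eq_zero : ∀ y, inner ℝ n (L y) = 0
  exists_eq : ∀ x, inner ℝ n x = 0 → ∃ y, L y = x
  measurePreserving : MeasurePreserving (fun p : ℝ × E (d - 1) => p.1 • n + L p.2) volume volume

/-- Extend n to an orthonormal basis with n as vector number 0. The chart inserts 0 as the first
coordinate, and the measure statement is the splitting ℝ × ℝ^(d-1) ≅ ℝ^d followed by an isometry. -/
theorem nonempty_hyperplaneChart {d : ℕ} (hd : 0 < d) {n : E d} (hn : ‖n‖ = 1) :
    Nonempty (HyperplaneChart n) := by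
  obtain ⟨m, rfl⟩ : ∃ m, d = m + 1 := ⟨d - 1, by lia⟩
  obtain ⟨b, hb⟩ := Orthonormal.exists_orthonormalBasis_extension_of_card_eq
    (𝕜 := ℝ) (E := E (m + 1)) (ι := Fin (m + 1)) (by simp) (v := fun _ => n) (s := {0}) (by
      rw [orthonormal_iff_ite]
      rintro ⟨i, hi⟩ ⟨j, hj⟩
      obtain rfl : i = 0 := hi
      obtain rfl : j = 0 := hj
      simp [hn])
  have hb0 : b 0 = n := hb 0 rfl
  let C : E m →ₗ[ℝ] E (m + 1) :=
    { toFun := fun y => WithLp.toLp 2 (Fin.cons 0 y.ofLp : Fin (m + 1) → ℝ)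
      map_add' := fun y z => by
        ext i
        refine Fin.cases ?_ (fun i => ?_) i <;> simp
      map_smul' := fun c y => by
        ext i
        refine Fin.cases ?_ (fun i => ?_) i <;> simp }
  have hC : ∀ y, ‖C y‖ = ‖y‖ := fun y => by
    rw [EuclideanSpace.norm_eq, EuclideanSpace.norm_eq, Fin.sum_univ_succ]
    simp [C]
  let L : E m →ₗᵢ[ℝ] E (m + 1) := b.repr.symm.toLinearIsometry.comp ⟨C, hC⟩
  have hL : ∀ y, L y = b.repr.symm (C y) := fun _ => rfl
  have hinner : ∀ x, inner ℝ n x = b.repr x 0 := fun x => by rw [b.repr_apply_apply, hb0]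
  refine ⟨⟨L, fun y => ?_, fun x hx => ⟨WithLp.toLp 2 fun i => b.repr x i.succ, ?_⟩, ?_⟩⟩
  · rw [hinner, hL, LinearIsometryEquiv.apply_symm_apply]
    simp [C]
  · rw [hL]
    apply b.repr.injective
    rw [LinearIsometryEquiv.apply_symm_apply]
    ext i
    refine Fin.cases ?_ (fun i => ?_) i
    · rw [← hinner, hx]; simp [C]
    · simp [C]
  · have h1 : MeasurePreserving (Prod.map id WithLp.ofLp : ℝ × E m → ℝ × (Fin m → ℝ)) volume volume :=
      (MeasurePreserving.id _).prod (PiLp.volume_preserving_ofLp (Fin m))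
    have h2 := (volume_preserving_piFinSuccAbove (fun _ : Fin (m + 1) => ℝ) 0).symm
    have h3 := PiLp.volume_preserving_toLp (Fin (m + 1))
    have h := b.measurePreserving_repr_symm.comp (h3.comp (h2.comp h1))
    suffices hfun : (fun p : ℝ × E m => p.1 • n + L p.2) = _ from
      (congrArg (fun f => MeasurePreserving f volume volume) hfun).mpr h
    funext ⟨t, y⟩
    simp only [Function.comp_apply]
    apply b.repr.injective
    rw [map_add, map_smul, hL, LinearIsometryEquiv.apply_symm_apply,
      LinearIsometryEquiv.apply_symm_apply, ← hb0, b.repr_self]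
    ext i
    refine Fin.cases ?_ (fun i => ?_) i <;> simp [C, MeasurableEquiv.piFinSuccAbove, Fin.insertNthEquiv]

namespace HyperplaneChart

variable {d : ℕ} {n : E d} (c : HyperplaneChart n)

/-- The parametrisation of the hyperplane `⟪n, x⟫ = b`. -/
def ψ (b : ℝ) (y : E (d - 1)) : E d := b • n + c.L y

theorem isometry_ψ (b : ℝ) : Isometry (c.ψ b) :=
  (IsometryEquiv.addLeft (b • n)).isometry.comp c.L.isometry

theorem continuous_ψ (b : ℝ) : Continuous (c.ψ b) := (c.isometry_ψ b).continuous

theorem inner_ψ (hn : ‖n‖ = 1) (b : ℝ) (y : E (d - 1)) : inner ℝ n (c.ψ b y) = b := by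
  rw [ψ, inner_add_right, inner_smul_right, c.inner_eq_zero, real_inner_self_eq_norm_sq, hn]
  simp

theorem range_ψ (hn : ‖n‖ = 1) (b : ℝ) : Set.range (c.ψ b) = {x | inner ℝ n x = b} := by
  ext x
  constructor
  · rintro ⟨y, rfl⟩
    exact c.inner_ψ hn b y
  · intro hx
    obtain ⟨y, hy⟩ := c.exists_eq (x - b • n) (by
      rw [inner_sub_right, inner_smul_right, real_inner_self_eq_norm_sq, hn, hx]; simp)
    exact ⟨y, by rw [ψ, hy]; simp⟩

theorem measurableEmbedding_ψ (b : ℝ) : MeasurableEmbedding (c.ψ b) :=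
  (c.isometry_ψ b).isClosedEmbedding.measurableEmbedding

/-- Isometries preserve normalised Hausdorff measure, which is Lebesgue measure on ℝ^(d-1). This
turns surface integrals on a hyperplane into Lebesgue integrals. -/
theorem map_ψ (hn : ‖n‖ = 1) (b : ℝ) :
    Measure.map (c.ψ b) volume = (surf d).restrict {x | inner ℝ n x = b} := by
  rw [← c.range_ψ hn, ← (c.isometry_ψ b).map_euclideanHausdorffMeasure,
    EuclideanSpace.euclideanHausdorffMeasure_eq_volume]

theorem surf_eq (hn : ‖n‖ = 1) {b : ℝ} {A : Set (E d)} (hA : A ⊆ {x | inner ℝ n x = b}) :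
    surf d A = volume (c.ψ b ⁻¹' A) := by
  rw [← EuclideanSpace.euclideanHausdorffMeasure_eq_volume,
    (c.isometry_ψ b).euclideanHausdorffMeasure_preimage, c.range_ψ hn,
    Set.inter_eq_self_of_subset_left hA]

theorem setIntegral_surf (hn : ‖n‖ = 1) {b : ℝ} {A : Set (E d)} (hAm : MeasurableSet A)
    (hA : A ⊆ {x | inner ℝ n x = b}) (f : E d → ℝ) :
    ∫ x in A, f x ∂surf d = ∫ y in c.ψ b ⁻¹' A, f (c.ψ b y) := by
  rw [← (c.measurableEmbedding_ψ b).setIntegral_map, c.map_ψ hn, Measure.restrict_restrict hAm,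
    Set.inter_eq_self_of_subset_left hA]

end HyperplaneChart

theorem volume_hyperplane_eq_zero {m : ℕ} {v : E m} (hv : v ≠ 0) (a : ℝ) :
    volume {y : E m | inner ℝ v y = a} = 0 := by
  let s : AffineSubspace ℝ (E m) :=
    { carrier := {y | inner ℝ v y = a}
      smul_vsub_vadd_mem' := by
        intro c p₁ p₂ p₃ h₁ h₂ h₃
        simp only [Set.mem_ofPred_eq, vsub_eq_sub, vadd_eq_add] at *
        rw [inner_add_right, inner_smul_right, inner_sub_right, h₁, h₂, h₃]; simp }
  refine Measure.addHaar_affineSubspace volume s fun h => hv ?_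
  have hmem : ∀ y : E m, inner ℝ v y = a := fun y => by
    have : y ∈ s := by rw [h]; trivial
    exact this
  have h0 := hmem 0
  have h1 := hmem v
  rw [inner_zero_right] at h0
  rw [← h0] at h1
  exact inner_self_eq_zero.1 h1

/-- In a chart of one hyperplane, another hyperplane is null unless they are parallel. -/
theorem HyperplaneChart.volume_preimage_hyperplane {d : ℕ} {n n' : E d} (c : HyperplaneChart n)
    (hn : ‖n‖ = 1) (hn' : ‖n'‖ = 1) (b b' : ℝ) (h1 : ¬(n' = n ∧ b' = b))
    (h2 : ¬(n' = -n ∧ b' = -b)) : volume {y | inner ℝ n' (c.ψ b y) = b'} = 0 := by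
  set v : E (d - 1) := ContinuousLinearMap.adjoint c.L.toContinuousLinearMap n' with hv
  have hadj : ∀ y, inner ℝ v y = inner ℝ n' (c.L y) := fun y => by
    rw [hv, ContinuousLinearMap.adjoint_inner_left]; rfl
  have hset : {y | inner ℝ n' (c.ψ b y) = b'} = {y | inner ℝ v y = b' - b * inner ℝ n' n} := by
    ext y
    simp only [Set.mem_ofPred_eq, HyperplaneChart.ψ, inner_add_right, inner_smul_right, hadj]
    constructor <;> intro h <;> linarith
  rw [hset]
  -- The vector v is the tangential part of n' in the chart. If v = 0 then n' = ±n, and since the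
  -- two coincidences of hyperplanes are excluded, the set is empty. Otherwise it is a genuine
  -- hyperplane in ℝ^(d-1).
  by_cases hv0 : v = 0
  · have hpar : n' = (inner ℝ n n') • n := by
      obtain ⟨y, hy⟩ := c.exists_eq (n' - (inner ℝ n n') • n) (by
        rw [inner_sub_right, inner_smul_right, real_inner_self_eq_norm_sq, hn]; simp)
      have h0 : inner ℝ n' (c.L y) = 0 := by rw [← hadj, hv0, inner_zero_left]
      have h3 : inner ℝ (c.L y) (c.L y) = (0 : ℝ) := by
        conv_lhs => rw [hy]
        rw [inner_sub_left, inner_smul_left, ← hy, h0, c.inner_eq_zero]; simp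
      have h4 : c.L y = 0 := inner_self_eq_zero.1 h3
      rw [hy] at h4
      exact sub_eq_zero.1 h4
    set a : ℝ := inner ℝ n n' with ha
    have ha1 : |a| = 1 := by
      have := congrArg norm hpar
      rw [norm_smul, hn, hn', mul_one, Real.norm_eq_abs] at this
      exact this.symm
    rw [hv0]
    rw [real_inner_comm, ← ha]
    have hempty : {y : E (d - 1) | inner ℝ (0 : E (d - 1)) y = b' - b * a} = ∅ := by
      rw [Set.eq_empty_iff_forall_notMem]
      intro y hy
      simp only [Set.mem_ofPred_eq, inner_zero_left] at hy
      rcases (abs_eq zero_le_one).1 ha1 with h | h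
      · exact h1 ⟨by rw [hpar, h, one_smul], by rw [h] at hy; linarith⟩
      · exact h2 ⟨by rw [hpar, h, neg_one_smul], by rw [h] at hy; linarith⟩
    rw [hempty, measure_empty]
  · exact volume_hyperplane_eq_zero hv0 _

theorem surf_inter_hyperplanes {d : ℕ} (hd : 0 < d) {n n' : E d} (hn : ‖n‖ = 1) (hn' : ‖n'‖ = 1)
    (b b' : ℝ) (h1 : ¬(n' = n ∧ b' = b)) (h2 : ¬(n' = -n ∧ b' = -b)) :
    surf d {x | inner ℝ n x = b ∧ inner ℝ n' x = b'} = 0 := by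
  obtain ⟨c⟩ := nonempty_hyperplaneChart hd hn
  rw [c.surf_eq hn (b := b) fun x hx => hx.1]
  refine measure_mono_null (fun y hy => ?_) (c.volume_preimage_hyperplane hn hn' b b' h1 h2)
  exact hy.2

theorem surf_lt_top_of_isBounded {d : ℕ} (hd : 0 < d) {n : E d} (hn : ‖n‖ = 1) {b : ℝ}
    {A : Set (E d)} (hA : A ⊆ {x | inner ℝ n x = b}) (hb : Bornology.IsBounded A) :
    surf d A < ⊤ := by
  obtain ⟨c⟩ := nonempty_hyperplaneChart hd hn
  rw [c.surf_eq hn hA]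
  refine Bornology.IsBounded.measure_lt_top ?_
  exact (c.isometry_ψ b).antilipschitz.isBounded_preimage hb

namespace Element

variable {d : ℕ} (K : Element d)

/-! ## Basic geometry of elements -/

theorem isOpen_carrier : IsOpen K.carrier := by
  have : K.carrier = ⋂ i, {x | inner ℝ (K.normal i) x < K.offset i} := by
    ext x; simp [carrier]
  rw [this]
  exact isOpen_iInter_of_finite fun i => isOpen_lt (by fun_prop) continuous_const

/-- A point satisfying the weak inequalities satisfies the strict ones after any small move towards
a fixed interior point. -/
theorem closure_carrier : closure K.carrier = {x | ∀ i, inner ℝ (K.normal i) x ≤ K.offset i} := by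
  apply Set.Subset.antisymm
  · have hcl : IsClosed {x | ∀ i, inner ℝ (K.normal i) x ≤ K.offset i} := by
      have : {x | ∀ i, inner ℝ (K.normal i) x ≤ K.offset i} =
          ⋂ i, {x | inner ℝ (K.normal i) x ≤ K.offset i} := by ext x; simp
      rw [this]
      exact isClosed_iInter fun i => isClosed_le (by fun_prop) continuous_const
    exact closure_minimal (fun x hx i => (hx i).le) hcl
  · intro x hx
    obtain ⟨x₀, hx₀⟩ := K.nonempty
    have hlim : Tendsto (fun t : ℝ => x + t • (x₀ - x)) (𝓝[>] 0) (𝓝 x) := by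
      have : Continuous fun t : ℝ => x + t • (x₀ - x) := by fun_prop
      have h := this.tendsto 0
      simp only [zero_smul, add_zero] at h
      exact h.mono_left nhdsWithin_le_nhds
    refine mem_closure_of_tendsto hlim ?_
    have h1 : ∀ᶠ t : ℝ in 𝓝[>] 0, t < 1 := nhdsWithin_le_nhds (eventually_lt_nhds one_pos)
    filter_upwards [h1, self_mem_nhdsWithin] with t ht1 ht0 i
    have ht0 : 0 < t := ht0
    have hi := hx i
    have hi₀ := hx₀ i
    rw [inner_add_right, inner_smul_right, inner_sub_right]
    nlinarith

theorem isBounded_carrier : Bornology.IsBounded K.carrier := K.isBounded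

theorem isCompact_closure : IsCompact (closure K.carrier) :=
  Metric.isCompact_of_isClosed_isBounded isClosed_closure K.isBounded_carrier.closure

theorem mem_closure_iff {x : E d} :
    x ∈ closure K.carrier ↔ ∀ i, inner ℝ (K.normal i) x ≤ K.offset i := by
  rw [closure_carrier]; rfl

theorem face_subset_hyperplane (i : Fin K.numFaces) :
    K.face i ⊆ {x | inner ℝ (K.normal i) x = K.offset i} := fun _ hx => hx.2

theorem face_subset_closure (i : Fin K.numFaces) : K.face i ⊆ closure K.carrier :=
  fun _ hx => K.mem_closure_iff.2 hx.1

theorem isClosed_face (i : Fin K.numFaces) : IsClosed (K.face i) := by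
  have : K.face i = closure K.carrier ∩ {x | inner ℝ (K.normal i) x = K.offset i} := by
    ext x; rw [Set.mem_inter_iff, mem_closure_iff]; rfl
  rw [this]
  exact isClosed_closure.inter (isClosed_eq (by fun_prop) continuous_const)

theorem isBounded_face (i : Fin K.numFaces) : Bornology.IsBounded (K.face i) :=
  K.isBounded_carrier.closure.subset (K.face_subset_closure i)

/-- An element in two opposite half-spaces with a common boundary would be empty. With
`not_parallel`, this makes the face hyperplanes of one element pairwise distinct, so that they meet
in null sets. -/
theorem not_opposite (i j : Fin K.numFaces) :
    ¬(K.normal j = -K.normal i ∧ K.offset j = -K.offset i) := by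
  rintro ⟨h1, h2⟩
  obtain ⟨x, hx⟩ := K.nonempty
  have hi := hx i
  have hj := hx j
  rw [h1, h2, inner_neg_left] at hj
  linarith

theorem not_parallel {i j : Fin K.numFaces} (hij : j ≠ i) :
    ¬(K.normal j = K.normal i ∧ K.offset j = K.offset i) := by
  rintro ⟨h1, h2⟩
  exact hij (K.distinct (Prod.ext h1 h2))

theorem exists_mem_face {x : E d} (hx : x ∈ closure K.carrier) (hx' : x ∉ K.carrier) :
    ∃ i, x ∈ K.face i := by
  rw [K.mem_closure_iff] at hx
  by_contra! h
  exact hx' fun i => lt_of_le_of_ne (hx i) fun hi => h i ⟨hx, hi⟩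

end Element

/-! ## The divergence theorem on an element -/

section SmoothTransition

open Real

theorem deriv_smoothTransition_eq_zero {t : ℝ} (ht : t ∉ Set.Icc (0 : ℝ) 1) :
    deriv smoothTransition t = 0 := by
  rw [Set.mem_Icc, not_and_or, not_le, not_le] at ht
  rcases ht with ht | ht
  · have : smoothTransition =ᶠ[𝓝 t] fun _ => 0 := by
      filter_upwards [eventually_lt_nhds ht] with s hs
      exact smoothTransition.zero_of_nonpos hs.le
    rw [this.deriv_eq, deriv_const]
  · have : smoothTransition =ᶠ[𝓝 t] fun _ => 1 := by
      filter_upwards [eventually_gt_nhds ht] with s hs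
      exact smoothTransition.one_of_one_le hs.le
    rw [this.deriv_eq, deriv_const]

theorem contDiff_one_smoothTransition : ContDiff ℝ 1 smoothTransition :=
  smoothTransition.contDiff (n := 1)

theorem continuous_deriv_smoothTransition : Continuous (deriv smoothTransition) :=
  contDiff_one_smoothTransition.continuous_deriv le_rfl

theorem hasDerivAt_smoothTransition (t : ℝ) :
    HasDerivAt smoothTransition (deriv smoothTransition t) t :=
  (contDiff_one_smoothTransition.differentiable one_ne_zero t).hasDerivAt

theorem integral_deriv_smoothTransition : ∫ t, deriv smoothTransition t = 1 := by
  rw [← setIntegral_eq_integral_of_forall_compl_eq_zero (s := Set.Icc 0 1)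
    fun t ht => deriv_smoothTransition_eq_zero ht, integral_Icc_eq_integral_Ioc,
    ← intervalIntegral.integral_of_le zero_le_one, intervalIntegral.integral_deriv_eq_sub
      (fun t _ => (hasDerivAt_smoothTransition t).differentiableAt)
      (continuous_deriv_smoothTransition.intervalIntegrable _ _),
    smoothTransition.one_of_one_le le_rfl, smoothTransition.zero_of_nonpos le_rfl, sub_zero]

theorem integrable_deriv_smoothTransition : Integrable (deriv smoothTransition) :=
  continuous_deriv_smoothTransition.integrable_of_hasCompactSupport
    (HasCompactSupport.intro isCompact_Icc fun _ ht => deriv_smoothTransition_eq_zero ht)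

end SmoothTransition

namespace Element

open Real

variable {d : ℕ} (K : Element d)

/-- A smooth ramp at the `i`-th half-space. -/
def ramp (ε : ℝ) (i : Fin K.numFaces) (x : E d) : ℝ :=
  smoothTransition ((K.offset i - inner ℝ (K.normal i) x) / ε)

/-- The product of `ρ'` at the `i`-th half-space and the ramps at the other ones. -/
def rampDeriv (ε : ℝ) (i : Fin K.numFaces) (x : E d) : ℝ :=
  deriv smoothTransition ((K.offset i - inner ℝ (K.normal i) x) / ε) *
    ∏ j ∈ Finset.univ.erase i, K.ramp ε j x

theorem ramp_nonneg (ε : ℝ) (i : Fin K.numFaces) (x : E d) : 0 ≤ K.ramp ε i x :=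
  smoothTransition.nonneg _

theorem ramp_le_one (ε : ℝ) (i : Fin K.numFaces) (x : E d) : K.ramp ε i x ≤ 1 :=
  smoothTransition.le_one _

theorem continuous_ramp (ε : ℝ) (i : Fin K.numFaces) : Continuous (K.ramp ε i) :=
  smoothTransition.continuous.comp (by fun_prop)

theorem continuous_rampDeriv (ε : ℝ) (i : Fin K.numFaces) : Continuous (K.rampDeriv ε i) :=
  (continuous_deriv_smoothTransition.comp (by fun_prop)).mul
    (continuous_finsetProd _ fun j _ => K.continuous_ramp ε j)

theorem ramp_eq_zero {ε : ℝ} (hε : 0 < ε) {i : Fin K.numFaces} {x : E d}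
    (h : K.offset i ≤ inner ℝ (K.normal i) x) : K.ramp ε i x = 0 :=
  smoothTransition.zero_of_nonpos (div_nonpos_of_nonpos_of_nonneg (by linarith) hε.le)

theorem prod_ramp_eq_zero {ε : ℝ} (hε : 0 < ε) {x : E d} (hx : x ∉ K.carrier) :
    ∏ i, K.ramp ε i x = 0 := by
  simp only [carrier, Set.mem_ofPred_eq, not_forall, not_lt] at hx
  obtain ⟨i, hi⟩ := hx
  exact Finset.prod_eq_zero (Finset.mem_univ i) (K.ramp_eq_zero hε hi)

theorem rampDeriv_eq_zero {ε : ℝ} (hε : 0 < ε) {i : Fin K.numFaces} {x : E d}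
    (hx : x ∉ closure K.carrier) : K.rampDeriv ε i x = 0 := by
  simp only [mem_closure_iff, not_forall, not_le] at hx
  obtain ⟨j, hj⟩ := hx
  rw [rampDeriv]
  by_cases hji : j = i
  · subst hji
    rw [deriv_smoothTransition_eq_zero, zero_mul]
    rw [Set.mem_Icc, not_and_or, not_le]
    exact Or.inl (div_neg_of_neg_of_pos (by linarith) hε)
  · rw [Finset.prod_eq_zero (Finset.mem_erase.2 ⟨hji, Finset.mem_univ j⟩)
      (K.ramp_eq_zero hε hj.le), mul_zero]

theorem hasFDerivAt_prod_ramp (ε : ℝ) (x : E d) :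
    HasFDerivAt (fun x => ∏ i, K.ramp ε i x)
      (∑ i, (-(ε⁻¹ * K.rampDeriv ε i x)) • innerSL ℝ (K.normal i)) x := by
  have h1 : ∀ i, HasFDerivAt (K.ramp ε i)
      ((-(ε⁻¹ * deriv smoothTransition ((K.offset i - inner ℝ (K.normal i) x) / ε))) •
        innerSL ℝ (K.normal i)) x := by
    intro i
    have h : HasFDerivAt (fun x : E d => (K.offset i - inner ℝ (K.normal i) x) / ε)
        ((-ε⁻¹) • innerSL ℝ (K.normal i)) x := by
      have h2 : HasFDerivAt (fun x : E d => inner ℝ (K.normal i) x) (innerSL ℝ (K.normal i)) x :=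
        (innerSL ℝ (K.normal i)).hasFDerivAt
      have h3 := (h2.const_sub (K.offset i)).mul_const ε⁻¹
      simp only [div_eq_mul_inv]
      exact h3.congr_fderiv (by ext v; simp)
    have h4 := (hasDerivAt_smoothTransition
      ((K.offset i - inner ℝ (K.normal i) x) / ε)).comp_hasFDerivAt x h
    refine h4.congr_fderiv ?_
    rw [smul_smul]; congr 1; ring
  have h := HasFDerivAt.finsetProd (u := Finset.univ) fun i _ => h1 i
  refine h.congr_fderiv (Finset.sum_congr rfl fun i _ => ?_)
  rw [smul_smul, rampDeriv]
  congr 1; ring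

theorem hasCompactSupport_mul_prod_ramp {ε : ℝ} (hε : 0 < ε) (f : E d → ℝ) :
    HasCompactSupport fun x => f x * ∏ i, K.ramp ε i x :=
  HasCompactSupport.intro K.isCompact_closure fun x hx => by
    rw [K.prod_ramp_eq_zero hε fun h => hx (subset_closure h), mul_zero]

theorem hasCompactSupport_mul_rampDeriv {ε : ℝ} (hε : 0 < ε) (f : E d → ℝ) (i : Fin K.numFaces) :
    HasCompactSupport fun x => f x * K.rampDeriv ε i x :=
  HasCompactSupport.intro K.isCompact_closure fun x hx => by
    rw [K.rampDeriv_eq_zero hε hx, mul_zero]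

/-- The product of ramps is a compactly supported substitute for the indicator function of the
element. Its derivative consists of one layer of width ε per half-space, and as ε → 0 these layers
produce the boundary integral. -/
theorem integral_fderiv_mul_prod_ramp {ε : ℝ} (hε : 0 < ε) {f : E d → ℝ} (hf : ContDiff ℝ 1 f)
    (v : E d) : ∫ x, fderiv ℝ f x v * ∏ i, K.ramp ε i x =
      ∑ i, inner ℝ (K.normal i) v * (ε⁻¹ * ∫ x, f x * K.rampDeriv ε i x) := by
  have hcr : Continuous fun x => ∏ i, K.ramp ε i x :=
    continuous_finsetProd _ fun i _ => K.continuous_ramp ε i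
  have hcf : Continuous fun x => fderiv ℝ f x v := by
    have := hf.continuous_fderiv one_ne_zero
    fun_prop
  have hfd : ∀ x, fderiv ℝ (fun x => ∏ i, K.ramp ε i x) x v =
      ∑ i, -(ε⁻¹ * K.rampDeriv ε i x) * inner ℝ (K.normal i) v := by
    intro x
    rw [(K.hasFDerivAt_prod_ramp ε x).fderiv]
    simp
  have hint : ∀ i, Integrable fun x => f x * K.rampDeriv ε i x := fun i =>
    (hf.continuous.mul (K.continuous_rampDeriv ε i)).integrable_of_hasCompactSupport
      (K.hasCompactSupport_mul_rampDeriv hε f i)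
  have hrw : ∀ x, f x * fderiv ℝ (fun x => ∏ i, K.ramp ε i x) x v =
      ∑ i, -(inner ℝ (K.normal i) v * (ε⁻¹ * (f x * K.rampDeriv ε i x))) := by
    intro x
    rw [hfd, Finset.mul_sum]
    exact Finset.sum_congr rfl fun i _ => by ring
  have hint' : ∀ i, Integrable fun x =>
      -(inner ℝ (K.normal i) v * (ε⁻¹ * (f x * K.rampDeriv ε i x))) := fun i =>
    (((hint i).const_mul _).const_mul _).neg
  have h := integral_mul_fderiv_eq_neg_fderiv_mul_of_integrable (μ := (volume : Measure (E d)))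
    (f := f) (g := fun x => ∏ i, K.ramp ε i x) (v := v)
    ((hcf.mul hcr).integrable_of_hasCompactSupport (K.hasCompactSupport_mul_prod_ramp hε _))
    (by
      simp_rw [hrw]
      exact integrable_finsetSum _ fun i _ => hint' i)
    ((hf.continuous.mul hcr).integrable_of_hasCompactSupport (K.hasCompactSupport_mul_prod_ramp hε _))
    (fun x _ => hf.differentiable one_ne_zero x)
    (fun x _ => (K.hasFDerivAt_prod_ramp ε x).differentiableAt)
  rw [eq_neg_iff_add_eq_zero, add_comm, ← eq_neg_iff_add_eq_zero] at h
  rw [h]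
  simp_rw [hrw]
  rw [integral_finsetSum _ fun i _ => hint' i, ← Finset.sum_neg_distrib]
  refine Finset.sum_congr rfl fun i _ => ?_
  rw [integral_neg, neg_neg, integral_const_mul, integral_const_mul]

/-- Dominated convergence. At each point of the open element the product is eventually 1, and off
the element it is 0 for every ε > 0. -/
theorem tendsto_integral_mul_prod_ramp {g : E d → ℝ} (hg : Continuous g) :
    Tendsto (fun ε => ∫ x, g x * ∏ i, K.ramp ε i x) (𝓝[>] 0) (𝓝 (∫ x in K.carrier, g x)) := by
  obtain ⟨M, hM⟩ := K.isCompact_closure.exists_bound_of_continuousOn hg.continuousOn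
  rw [← integral_indicator K.isOpen_carrier.measurableSet]
  refine tendsto_integral_filter_of_dominated_convergence
    ((closure K.carrier).indicator fun _ => M) ?_ ?_ ?_ ?_
  · exact .of_forall fun ε => (hg.mul (continuous_finsetProd _ fun i _ =>
      K.continuous_ramp ε i)).aestronglyMeasurable
  · filter_upwards [self_mem_nhdsWithin] with ε hε
    refine ae_of_all _ fun x => ?_
    by_cases hx : x ∈ closure K.carrier
    · rw [Set.indicator_of_mem hx, norm_mul]
      have h1 : ‖∏ i, K.ramp ε i x‖ ≤ 1 := by
        rw [Real.norm_of_nonneg (Finset.prod_nonneg fun i _ => K.ramp_nonneg ε i x)]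
        exact Finset.prod_le_one (fun i _ => K.ramp_nonneg ε i x) fun i _ => K.ramp_le_one ε i x
      exact (mul_le_of_le_one_right (norm_nonneg _) h1).trans (hM x hx)
    · rw [K.prod_ramp_eq_zero hε fun h => hx (subset_closure h), Set.indicator_of_notMem hx]
      simp
  · exact (integrable_indicator_iff isClosed_closure.measurableSet).2
      (integrableOn_const K.isCompact_closure.measure_lt_top.ne)
  · refine ae_of_all _ fun x => ?_
    by_cases hx : x ∈ K.carrier
    · rw [Set.indicator_of_mem hx]
      refine tendsto_const_nhds.congr' ?_
      have hev : ∀ i, ∀ᶠ ε : ℝ in 𝓝[>] 0, K.ramp ε i x = 1 := by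
        intro i
        have hpos : 0 < K.offset i - inner ℝ (K.normal i) x := sub_pos.2 (hx i)
        filter_upwards [nhdsWithin_le_nhds (eventually_lt_nhds hpos), self_mem_nhdsWithin]
          with ε hε hε0
        exact smoothTransition.one_of_one_le ((one_le_div hε0).2 hε.le)
      filter_upwards [eventually_all.2 hev] with ε hε
      simp [hε]
    · rw [Set.indicator_of_notMem hx]
      refine tendsto_const_nhds.congr' ?_
      filter_upwards [self_mem_nhdsWithin] with ε hε
      rw [K.prod_ramp_eq_zero hε hx, mul_zero]

end Element

theorem HyperplaneChart.integral_eq {d : ℕ} {n : E d} (c : HyperplaneChart n) {F : E d → ℝ}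
    (hF : Integrable F) : ∫ x, F x = ∫ t : ℝ, ∫ y, F (c.ψ t y) := by
  have hc : Integrable (fun p : ℝ × E (d - 1) => F (c.ψ p.1 p.2)) (volume.prod volume) :=
    (c.measurePreserving.integrable_comp hF.1).2 hF
  rw [← integral_prod _ hc]
  conv_lhs => rw [← c.measurePreserving.map_eq]
  rw [integral_map c.measurePreserving.measurable.aemeasurable
    (by rw [c.measurePreserving.map_eq]; exact hF.1)]
  rfl

theorem integral_comp_sub_const_mul {g : ℝ → ℝ} (b : ℝ) {ε : ℝ} (hε : 0 < ε) :
    ε⁻¹ * ∫ t, g t = ∫ s, g (b - ε * s) := by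
  rw [Measure.integral_comp_mul_left (fun s => g (b - s)) ε, integral_sub_left_eq_self g volume b,
    abs_of_pos (inv_pos.2 hε), smul_eq_mul]

theorem HyperplaneChart.norm_le_norm_ψ_add {d : ℕ} {n : E d} (c : HyperplaneChart n) (hn : ‖n‖ = 1)
    (b : ℝ) (y : E (d - 1)) : ‖y‖ ≤ ‖c.ψ b y‖ + |b| := by
  have h : c.L y = c.ψ b y - b • n := by simp [HyperplaneChart.ψ]
  calc ‖y‖ = ‖c.L y‖ := (c.L.norm_map y).symm
    _ ≤ ‖c.ψ b y‖ + ‖b • n‖ := by rw [h]; exact norm_sub_le _ _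
    _ = _ := by rw [norm_smul, hn, mul_one, Real.norm_eq_abs]

namespace Element

open Real

variable {d : ℕ} (K : Element d)

/-- The ramps at all half-spaces except the `i`-th, in coordinates of the hyperplane shifted by
`ε s`. -/
theorem tendsto_prod_ramp_ψ {i : Fin K.numFaces} (c : HyperplaneChart (K.normal i))
    {f : E d → ℝ} (hf : Continuous f) (s : ℝ) {y : E (d - 1)}
    (hy : ∀ j ≠ i, inner ℝ (K.normal j) (c.ψ (K.offset i) y) ≠ K.offset j) :
    Tendsto (fun ε : ℝ => f (c.ψ (K.offset i - ε * s) y) *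
        ∏ j ∈ Finset.univ.erase i, K.ramp ε j (c.ψ (K.offset i - ε * s) y)) (𝓝[>] 0)
      (𝓝 ((c.ψ (K.offset i) ⁻¹' K.face i).indicator (fun y => f (c.ψ (K.offset i) y)) y)) := by
  have hψ : ∀ ε, c.ψ (K.offset i - ε * s) y = c.ψ (K.offset i) y - (ε * s) • K.normal i := by
    intro ε
    simp only [HyperplaneChart.ψ, sub_smul]; abel
  set x := c.ψ (K.offset i) y with hx
  have hlim : Tendsto (fun ε : ℝ => x - (ε * s) • K.normal i) (𝓝[>] 0) (𝓝 x) := by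
    have : Continuous fun ε : ℝ => x - (ε * s) • K.normal i := by fun_prop
    have h := this.tendsto 0
    simp only [zero_mul, zero_smul, sub_zero] at h
    exact h.mono_left nhdsWithin_le_nhds
  -- The additional `- ε` lets eventual positivity say that the numerator of the ramp exceeds ε,
  -- where the transition function is exactly 1.
  have harg : ∀ j, Tendsto (fun ε : ℝ => K.offset j - inner ℝ (K.normal j)
      (x - (ε * s) • K.normal i) - ε) (𝓝[>] 0) (𝓝 (K.offset j - inner ℝ (K.normal j) x)) := by
    intro j
    have : Continuous fun ε : ℝ => K.offset j - inner ℝ (K.normal j)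
      (x - (ε * s) • K.normal i) - ε := by fun_prop
    have h := this.tendsto 0
    simp only [zero_mul, zero_smul, sub_zero] at h
    exact h.mono_left nhdsWithin_le_nhds
  have harg' : ∀ j, Tendsto (fun ε : ℝ => K.offset j - inner ℝ (K.normal j)
      (x - (ε * s) • K.normal i)) (𝓝[>] 0) (𝓝 (K.offset j - inner ℝ (K.normal j) x)) := by
    intro j
    exact tendsto_const_nhds.sub (((innerSL ℝ (K.normal j)).continuous.tendsto x).comp hlim)
  simp_rw [hψ]
  -- If all other inequalities are strict at x, the other ramps are eventually 1. If one is
  -- violated, its ramp is eventually 0. Equality is excluded by `hy`.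
  by_cases hmem : ∀ j ≠ i, inner ℝ (K.normal j) x < K.offset j
  · have hface : y ∈ c.ψ (K.offset i) ⁻¹' K.face i := by
      have hi : inner ℝ (K.normal i) x = K.offset i := c.inner_ψ (K.norm_normal i) _ _
      refine ⟨fun j => ?_, hi⟩
      by_cases hj : j = i
      · rw [hj]; exact hi.le
      · exact (hmem j hj).le
    rw [Set.indicator_of_mem hface]
    refine ((hf.tendsto x).comp hlim).congr' ?_
    have hev : ∀ j, j ≠ i → ∀ᶠ ε : ℝ in 𝓝[>] 0,
        K.ramp ε j (x - (ε * s) • K.normal i) = 1 := by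
      intro j hj
      filter_upwards [(harg j).eventually (eventually_gt_nhds (sub_pos.2 (hmem j hj))),
        self_mem_nhdsWithin] with ε hε hε0
      exact smoothTransition.one_of_one_le ((one_le_div hε0).2 (by linarith))
    have hev' : ∀ᶠ ε : ℝ in 𝓝[>] 0, ∀ j, j ≠ i → K.ramp ε j (x - (ε * s) • K.normal i) = 1 :=
      eventually_all.2 fun j => by
        by_cases hj : j = i
        · exact .of_forall fun _ h => absurd hj h
        · filter_upwards [hev j hj] with ε hε _ using hε
    filter_upwards [hev'] with ε hε
    rw [Finset.prod_eq_one fun j hj => hε j (Finset.ne_of_mem_erase hj), mul_one]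
    rfl
  · push Not at hmem
    obtain ⟨j, hj, hle⟩ := hmem
    have hlt : K.offset j < inner ℝ (K.normal j) x := lt_of_le_of_ne hle (hy j hj).symm
    have hface : y ∉ c.ψ (K.offset i) ⁻¹' K.face i := fun h => (h.1 j).not_gt hlt
    rw [Set.indicator_of_notMem hface]
    refine tendsto_const_nhds.congr' ?_
    filter_upwards [(harg' j).eventually (eventually_lt_nhds (sub_neg.2 hlt)),
        self_mem_nhdsWithin] with ε hε hε0
    rw [Finset.prod_eq_zero (Finset.mem_erase.2 ⟨hj, Finset.mem_univ j⟩)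
      (K.ramp_eq_zero hε0 (by linarith)), mul_zero]

/-- Slice along the normal and substitute t = b - εs. The factor ε⁻¹ disappears and the weight
becomes ρ'(s), which has mass 1 on [0, 1], while each slice integral tends to the integral over the
face. -/
theorem tendsto_integral_mul_rampDeriv (hd : 0 < d) {f : E d → ℝ} (hf : Continuous f)
    (i : Fin K.numFaces) :
    Tendsto (fun ε : ℝ => ε⁻¹ * ∫ x, f x * K.rampDeriv ε i x) (𝓝[>] 0)
      (𝓝 (∫ x in K.face i, f x ∂surf d)) := by
  have hn := K.norm_normal i
  obtain ⟨c⟩ := nonempty_hyperplaneChart hd hn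
  obtain ⟨M, hM⟩ := K.isCompact_closure.exists_bound_of_continuousOn hf.continuousOn
  obtain ⟨R, hR⟩ := K.isBounded_carrier.closure.exists_norm_le
  set b := K.offset i
  set J := ∫ x in K.face i, f x ∂surf d with hJ
  have hJ' : J = ∫ y, (c.ψ b ⁻¹' K.face i).indicator (fun y => f (c.ψ b y)) y := by
    rw [hJ, c.setIntegral_surf hn (K.isClosed_face i).measurableSet (K.face_subset_hyperplane i),
      integral_indicator ((K.isClosed_face i).preimage (c.continuous_ψ b)).measurableSet]
  set H : ℝ → ℝ → E (d - 1) → ℝ := fun ε s y => f (c.ψ (b - ε * s) y) *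
        ∏ j ∈ Finset.univ.erase i, K.ramp ε j (c.ψ (b - ε * s) y) with hH
  have hψc : ∀ ε, Continuous fun p : ℝ × E (d - 1) => c.ψ (b - ε * p.1) p.2 := fun ε => by
    have := c.L.continuous
    unfold HyperplaneChart.ψ
    fun_prop
  have hHc : ∀ ε, Continuous (Function.uncurry (H ε)) := fun ε =>
    (hf.comp (hψc ε)).mul (continuous_finsetProd _ fun j _ => (K.continuous_ramp ε j).comp (hψc ε))
  have hHb : ∀ ε, 0 < ε → ε ≤ 1 → ∀ s ∈ Set.Icc (0 : ℝ) 1, ∀ y,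
      ‖H ε s y‖ ≤ (Metric.closedBall (0 : E (d - 1)) (R + (|b| + 1))).indicator (fun _ => M) y := by
    intro ε hε hε1 s hs y
    by_cases hx : c.ψ (b - ε * s) y ∈ closure K.carrier
    · have hes : 0 ≤ ε * s := mul_nonneg hε.le hs.1
      have hes' : ε * s ≤ 1 := mul_le_one₀ hε1 hs.1 hs.2
      have hb : |b - ε * s| ≤ |b| + 1 :=
        (abs_sub _ _).trans (by rw [abs_of_nonneg hes]; linarith)
      have hyR : y ∈ Metric.closedBall (0 : E (d - 1)) (R + (|b| + 1)) := by
        rw [mem_closedBall_zero_iff]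
        exact (c.norm_le_norm_ψ_add hn _ y).trans (add_le_add (hR _ hx) hb)
      rw [Set.indicator_of_mem hyR, hH, norm_mul]
      refine (mul_le_of_le_one_right (norm_nonneg _) ?_).trans (hM _ hx)
      rw [Real.norm_of_nonneg (Finset.prod_nonneg fun j _ => K.ramp_nonneg ε j _)]
      exact Finset.prod_le_one (fun j _ => K.ramp_nonneg ε j _) fun j _ => K.ramp_le_one ε j _
    · have h0 : H ε s y = 0 := by
        simp only [mem_closure_iff, not_forall, not_le] at hx
        obtain ⟨j, hj⟩ := hx
        -- The slice is shifted inwards since ε s ≥ 0, so the i-th inequality cannot be the violated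
        -- one. Another one is, and its ramp kills the product.
        by_cases hji : j = i
        · subst hji
          rw [c.inner_ψ hn] at hj
          have : 0 ≤ ε * s := mul_nonneg hε.le hs.1
          exact absurd hj (by simp only [b]; linarith)
        · rw [hH]
          simp only
          rw [Finset.prod_eq_zero (Finset.mem_erase.2 ⟨hji, Finset.mem_univ j⟩)
            (K.ramp_eq_zero hε hj.le), mul_zero]
      rw [h0, norm_zero]
      have hM0 : 0 ≤ M := by
        obtain ⟨x, hx⟩ := K.nonempty
        exact (norm_nonneg _).trans (hM x (subset_closure hx))
      exact Set.indicator_nonneg (fun _ _ => hM0) _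
  have hbi : Integrable ((Metric.closedBall (0 : E (d - 1)) (R + (|b| + 1))).indicator
      fun _ => M) := (integrable_indicator_iff measurableSet_closedBall).2
        (integrableOn_const measure_closedBall_lt_top.ne)
  have hsmall : ∀ᶠ ε : ℝ in 𝓝[>] 0, 0 < ε ∧ ε ≤ 1 := by
    filter_upwards [self_mem_nhdsWithin, nhdsWithin_le_nhds (eventually_le_nhds one_pos)]
      with ε h0 h1 using ⟨h0, h1⟩
  have hinner : ∀ s ∈ Set.Icc (0 : ℝ) 1, Tendsto (fun ε => ∫ y, H ε s y) (𝓝[>] 0) (𝓝 J) := by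
    intro s hs
    rw [hJ']
    refine tendsto_integral_filter_of_dominated_convergence _ ?_ ?_ hbi ?_
    · exact .of_forall fun ε =>
        ((hHc ε).comp (Continuous.prodMk_right s)).aestronglyMeasurable
    · filter_upwards [hsmall] with ε hε
      exact ae_of_all _ fun y => hHb ε hε.1 hε.2 s hs y
    · have hae : ∀ j, ∀ᵐ y : E (d - 1), j ≠ i →
          inner ℝ (K.normal j) (c.ψ (K.offset i) y) ≠ K.offset j := by
        intro j
        by_cases hj : j = i
        · exact ae_of_all _ fun _ h => absurd hj h
        · have := c.volume_preimage_hyperplane hn (K.norm_normal j) b (K.offset j)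
            (K.not_parallel hj) (K.not_opposite i j)
          rw [measure_eq_zero_iff_ae_notMem] at this
          filter_upwards [this] with y hy _ using hy
      filter_upwards [ae_all_iff.2 hae] with y hy
      exact K.tendsto_prod_ramp_ψ c hf s hy
  have houter : Tendsto (fun ε => ∫ s, deriv smoothTransition s * ∫ y, H ε s y) (𝓝[>] 0)
      (𝓝 (∫ s, deriv smoothTransition s * J)) := by
    set C := ∫ y, (Metric.closedBall (0 : E (d - 1)) (R + (|b| + 1))).indicator (fun _ => M) y
    refine tendsto_integral_filter_of_dominated_convergence
      (fun s => ‖deriv smoothTransition s‖ * C) ?_ ?_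
      (integrable_deriv_smoothTransition.norm.mul_const C) ?_
    · refine .of_forall fun ε => continuous_deriv_smoothTransition.aestronglyMeasurable.mul ?_
      exact (hHc ε).stronglyMeasurable.integral_prod_right.aestronglyMeasurable
    · filter_upwards [hsmall] with ε hε
      refine ae_of_all _ fun s => ?_
      by_cases hs : s ∈ Set.Icc (0 : ℝ) 1
      · rw [norm_mul]
        gcongr
        exact norm_integral_le_of_norm_le hbi (ae_of_all _ fun y => hHb ε hε.1 hε.2 s hs y)
      · simp [deriv_smoothTransition_eq_zero hs]
    · refine ae_of_all _ fun s => ?_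
      by_cases hs : s ∈ Set.Icc (0 : ℝ) 1
      · exact (hinner s hs).const_mul _
      · simp [deriv_smoothTransition_eq_zero hs]
  rw [integral_mul_const, integral_deriv_smoothTransition, one_mul] at houter
  refine houter.congr' ?_
  filter_upwards [self_mem_nhdsWithin] with ε hε
  have hε : 0 < ε := hε
  have hint : Integrable fun x => f x * K.rampDeriv ε i x :=
    (hf.mul (K.continuous_rampDeriv ε i)).integrable_of_hasCompactSupport
      (K.hasCompactSupport_mul_rampDeriv hε f i)
  rw [c.integral_eq hint, integral_comp_sub_const_mul b hε]
  refine integral_congr_ae (ae_of_all _ fun s => ?_)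
  simp only
  rw [← integral_const_mul]
  refine integral_congr_ae (ae_of_all _ fun y => ?_)
  simp only [hH, rampDeriv, c.inner_ψ hn]
  rw [show (K.offset i - (b - ε * s)) / ε = s by simp only [b]; field_simp; ring]
  ring

/-- The divergence theorem on an element, for one directional derivative. -/
theorem integral_fderiv_eq_sum_faces (hd : 0 < d) {f : E d → ℝ} (hf : ContDiff ℝ 1 f) (v : E d) :
    ∫ x in K.carrier, fderiv ℝ f x v =
      ∑ i, inner ℝ (K.normal i) v * ∫ x in K.face i, f x ∂surf d := by
  have h1 := K.tendsto_integral_mul_prod_ramp (g := fun x => fderiv ℝ f x v) (by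
    have := hf.continuous_fderiv one_ne_zero
    fun_prop)
  have h2 : Tendsto (fun ε : ℝ => ∑ i, inner ℝ (K.normal i) v *
      (ε⁻¹ * ∫ x, f x * K.rampDeriv ε i x)) (𝓝[>] 0)
      (𝓝 (∑ i, inner ℝ (K.normal i) v * ∫ x in K.face i, f x ∂surf d)) :=
    tendsto_finsetSum _ fun i _ => (K.tendsto_integral_mul_rampDeriv hd hf.continuous i).const_mul _
  refine tendsto_nhds_unique h1 (h2.congr' ?_)
  filter_upwards [self_mem_nhdsWithin] with ε hε
  exact (K.integral_fderiv_mul_prod_ramp hε hf v).symm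

end Element

/-! ## Polynomial functions -/

theorem hasFDerivAt_eval {d : ℕ} (q : MvPolynomial (Fin d) ℝ) (x : E d) :
    HasFDerivAt (fun x : E d => MvPolynomial.eval (fun k => x k) q)
      (∑ k, MvPolynomial.eval (fun k => x k) (MvPolynomial.pderiv k q) •
        (EuclideanSpace.proj k : E d →L[ℝ] ℝ)) x := by
  induction q using MvPolynomial.induction_on with
  | C a => simpa using hasFDerivAt_const a x
  | add p q hp hq =>
    simp only [map_add, add_smul, Finset.sum_add_distrib]
    exact hp.add hq
  | mul_X p i hp =>
    have hi : HasFDerivAt (fun x : E d => x i) (EuclideanSpace.proj i : E d →L[ℝ] ℝ) x :=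
      (EuclideanSpace.proj i : E d →L[ℝ] ℝ).hasFDerivAt
    simp only [map_mul, MvPolynomial.eval_X]
    refine (hp.mul hi).congr_fderiv ?_
    ext v
    simp only [_root_.add_apply, _root_.smul_apply,
      _root_.sum_apply, PiLp.proj_apply, smul_eq_mul, Derivation.leibniz, map_add,
      map_mul, MvPolynomial.eval_X, MvPolynomial.pderiv_X, Finset.sum_add_distrib, add_mul]
    congr 1
    · rw [Finset.sum_eq_single i]
      · simp
      · intro k _ hk
        simp [hk.symm]
      · simp
    · rw [Finset.mul_sum]
      exact Finset.sum_congr rfl fun k _ => by ring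

theorem contDiff_eval {d : ℕ} (q : MvPolynomial (Fin d) ℝ) {m : WithTop ℕ∞} :
    ContDiff ℝ m fun x : E d => MvPolynomial.eval (fun k => x k) q := by
  induction q using MvPolynomial.induction_on with
  | C a => simpa using contDiff_const
  | add p q hp hq => simpa only [map_add] using hp.add hq
  | mul_X p i hp =>
    simp only [map_mul, MvPolynomial.eval_X]
    exact hp.mul (by fun_prop)

theorem continuous_eval {d : ℕ} (q : MvPolynomial (Fin d) ℝ) :
    Continuous fun x : E d => MvPolynomial.eval (fun k => x k) q :=
  (contDiff_eval q (m := 0)).continuous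

theorem fderiv_eval_basisVec {d : ℕ} (q : MvPolynomial (Fin d) ℝ) (x : E d) (k : Fin d) :
    fderiv ℝ (fun x : E d => MvPolynomial.eval (fun k => x k) q) x (basisVec k) =
      MvPolynomial.eval (fun k => x k) (MvPolynomial.pderiv k q) := by
  rw [(hasFDerivAt_eval q x).fderiv]
  simp only [_root_.sum_apply, _root_.smul_apply, PiLp.proj_apply,
    smul_eq_mul]
  rw [Finset.sum_eq_single k]
  · simp
  · intro j _ hj
    simp [hj]
  · simp

/-- A monomial m of ∂ₖq comes from the monomial m + eₖ of q. This is what makes ∇u an admissible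
test field. -/
theorem totalDegree_pderiv_le {d : ℕ} (q : MvPolynomial (Fin d) ℝ) (k : Fin d) :
    (MvPolynomial.pderiv k q).totalDegree ≤ q.totalDegree := by
  refine Finset.sup_le fun m hm => ?_
  have hm' : m + Finsupp.single k 1 ∈ q.support := by
    rw [MvPolynomial.mem_support_iff] at hm ⊢
    intro h
    rw [MvPolynomial.coeff_pderiv, h, zero_mul] at hm
    exact hm rfl
  refine le_trans ?_ (MvPolynomial.le_totalDegree hm')
  rw [Finsupp.sum_add_index' (fun _ => rfl) fun _ _ _ => rfl]
  exact Nat.le_add_right _ _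

theorem eq_C_of_pderiv_eq_zero {d : ℕ} {q : MvPolynomial (Fin d) ℝ}
    (hq : ∀ k, MvPolynomial.pderiv k q = 0) : ∃ c, q = MvPolynomial.C c := by
  have hf : ∀ x, fderiv ℝ (fun x : E d => MvPolynomial.eval (fun k => x k) q) x = 0 := by
    intro x
    rw [(hasFDerivAt_eval q x).fderiv]
    simp [hq]
  refine ⟨MvPolynomial.eval (fun _ => 0) q, MvPolynomial.funext fun x => ?_⟩
  have := is_const_of_fderiv_eq_zero (𝕜 := ℝ)
    ((contDiff_eval q (m := 1)).differentiable one_ne_zero) hf (WithLp.toLp 2 x) 0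
  rw [MvPolynomial.eval_C]
  exact this

/-- The zero set of a nonzero polynomial is a null set. -/
theorem volume_zeros_eq_zero_pi : ∀ {m : ℕ} {q : MvPolynomial (Fin m) ℝ}, q ≠ 0 →
    volume {x : Fin m → ℝ | MvPolynomial.eval x q = 0} = 0
  | 0, q, hq => by
    have : {x : Fin 0 → ℝ | MvPolynomial.eval x q = 0} = ∅ := by
      rw [Set.eq_empty_iff_forall_notMem]
      intro x hx
      refine hq (MvPolynomial.funext fun y => ?_)
      rw [Subsingleton.elim y x, map_zero]
      exact hx
    rw [this, measure_empty]
  | m + 1, q, hq => by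
    -- Induction by Fubini: as a polynomial in the first variable, q has a leading coefficient that
    -- is nonzero for almost all values of the other variables, and then the slice of the zero set
    -- is finite.
    set P := MvPolynomial.finSuccEquiv ℝ m q with hP
    have hP0 : P ≠ 0 := fun h => hq ((MvPolynomial.finSuccEquiv ℝ m).injective (by rw [← hP, h, map_zero]))
    have hlead := volume_zeros_eq_zero_pi (Polynomial.leadingCoeff_ne_zero.2 hP0)
    have hcont : Continuous fun x : Fin (m + 1) → ℝ => MvPolynomial.eval x q :=
      MvPolynomial.continuous_eval q
    have hS : MeasurableSet {x : Fin (m + 1) → ℝ | MvPolynomial.eval x q = 0} :=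
      (isClosed_eq hcont continuous_const).measurableSet
    have hmp := (volume_preserving_piFinSuccAbove (fun _ : Fin (m + 1) => ℝ) 0).symm
    rw [← hmp.measure_preimage_equiv]
    change (volume.prod volume) _ = 0
    rw [Measure.prod_apply_symm ((MeasurableEquiv.measurable _) hS), lintegral_eq_zero_iff']
    · rw [measure_eq_zero_iff_ae_notMem] at hlead
      filter_upwards [hlead] with y hy
      have hmap : Polynomial.map (MvPolynomial.eval y) P ≠ 0 := by
        intro h
        apply hy
        have := congrArg (fun R => Polynomial.coeff R P.natDegree) h
        simpa using this
      refine (Set.Finite.subset (Polynomial.map (MvPolynomial.eval y) P).roots.toFinset.finite_toSet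
        fun t ht => ?_).measure_zero _
      have ht' : MvPolynomial.eval (Fin.cons t y : Fin (m + 1) → ℝ) q = 0 := by
        simpa [MeasurableEquiv.piFinSuccAbove, Fin.insertNthEquiv] using ht
      rw [MvPolynomial.eval_eq_eval_mv_eval'] at ht'
      simpa [hmap] using ht'
    · exact (measurable_measure_prodMk_right ((MeasurableEquiv.measurable _) hS)).aemeasurable

theorem volume_zeros_eq_zero {m : ℕ} {q : MvPolynomial (Fin m) ℝ} (hq : q ≠ 0) :
    volume {x : E m | MvPolynomial.eval (fun k => x k) q = 0} = 0 := by
  have h := (PiLp.volume_preserving_ofLp (Fin m)).measure_preimage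
    (s := {x : Fin m → ℝ | MvPolynomial.eval x q = 0})
    (isClosed_eq (MvPolynomial.continuous_eval q) continuous_const).measurableSet.nullMeasurableSet
  rw [volume_zeros_eq_zero_pi hq] at h
  exact h

theorem eq_zero_of_ae_eval_eq_zero {d : ℕ} {q : MvPolynomial (Fin d) ℝ} {A : Set (E d)}
    (hA : volume A ≠ 0)
    (hq : ∀ᵐ x ∂volume.restrict A, MvPolynomial.eval (fun k => x k) q = 0) : q = 0 := by
  by_contra h
  have h0 := volume_zeros_eq_zero h
  rw [measure_eq_zero_iff_ae_notMem] at h0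
  apply hA
  rw [← Measure.restrict_eq_zero, ← ae_eq_bot, ← empty_mem_iff_bot]
  filter_upwards [hq, ae_restrict_of_ae h0] with x hx hx' using hx' hx

/-- A polynomial that vanishes on a subset of a hyperplane, of positive surface measure, vanishes on
the hyperplane. -/
theorem eval_eq_zero_of_ae_surf {d : ℕ} (hd : 0 < d) {q : MvPolynomial (Fin d) ℝ} {n : E d}
    (hn : ‖n‖ = 1) {b : ℝ} {A : Set (E d)} (hAm : MeasurableSet A)
    (hA : A ⊆ {x | inner ℝ n x = b}) (hA0 : surf d A ≠ 0)
    (hq : ∀ᵐ x ∂(surf d).restrict A, MvPolynomial.eval (fun k => x k) q = 0) {x : E d}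
    (hx : inner ℝ n x = b) : MvPolynomial.eval (fun k => x k) q = 0 := by
  obtain ⟨c⟩ := nonempty_hyperplaneChart hd hn
  -- The pullback of q along the affine parametrisation of the hyperplane, again a polynomial.
  let q' : MvPolynomial (Fin (d - 1)) ℝ := MvPolynomial.bind₁ (fun k => MvPolynomial.C (b * n k) +
    ∑ j, MvPolynomial.C (c.L (EuclideanSpace.single j 1) k) * MvPolynomial.X j) q
  have hL : ∀ y k, c.L y k = ∑ j, c.L (EuclideanSpace.single j 1) k * y j := by
    intro y k
    have hy : y = ∑ j, y j • EuclideanSpace.single j (1 : ℝ) := by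
      ext i; simp [Finset.sum_apply, Pi.single_apply]
    conv_lhs => rw [hy, map_sum]
    simp [mul_comm]
  have hq' : ∀ y, MvPolynomial.eval (fun k => y k) q' =
      MvPolynomial.eval (fun k => c.ψ b y k) q := by
    intro y
    rw [MvPolynomial.eval, MvPolynomial.eval₂Hom_bind₁]
    congr 1
    congr 1
    funext k
    simp [HyperplaneChart.ψ, hL y]
  have hzero : q' = 0 := by
    refine eq_zero_of_ae_eval_eq_zero (A := c.ψ b ⁻¹' A) (by rwa [← c.surf_eq hn hA]) ?_
    have h1 : (surf d).restrict A = Measure.map (c.ψ b) (volume.restrict (c.ψ b ⁻¹' A)) := by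
      rw [← (c.measurableEmbedding_ψ b).restrict_map, c.map_ψ hn, Measure.restrict_restrict hAm,
        Set.inter_eq_self_of_subset_left hA]
    rw [h1] at hq
    filter_upwards [ae_of_ae_map (c.continuous_ψ b).measurable.aemeasurable hq] with y hy
    rw [hq']; exact hy
  have hx' : x ∈ Set.range (c.ψ b) := by rw [c.range_ψ hn]; exact hx
  obtain ⟨y, rfl⟩ := hx'
  rw [← hq', hzero, map_zero]

namespace Mesh

variable {d : ℕ} {Ω : Set (E d)} (𝓣 : Mesh Ω)

/-! ## Geometry of the skeleton -/

/-- The hyperplane of a face. -/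
def hyperplane (F : 𝓣.Face) : Set (E d) :=
  {x | inner ℝ (𝓣.normal F) x = (𝓣.elem F.1).offset F.2}

/-- Two faces lie in the same hyperplane. -/
def Coplanar (F G : 𝓣.Face) : Prop :=
  (𝓣.normal G = 𝓣.normal F ∧ (𝓣.elem G.1).offset G.2 = (𝓣.elem F.1).offset F.2) ∨
    (𝓣.normal G = -𝓣.normal F ∧ (𝓣.elem G.1).offset G.2 = -(𝓣.elem F.1).offset F.2)

/-- The intersections of the different hyperplanes of the mesh. -/
def ridges : Set (E d) :=
  ⋃ (F : 𝓣.Face) (G : 𝓣.Face) (_ : ¬𝓣.Coplanar F G), 𝓣.hyperplane F ∩ 𝓣.hyperplane G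

theorem norm_normal (F : 𝓣.Face) : ‖𝓣.normal F‖ = 1 := (𝓣.elem F.1).norm_normal F.2

theorem faceSet_subset_hyperplane (F : 𝓣.Face) : 𝓣.faceSet F ⊆ 𝓣.hyperplane F :=
  (𝓣.elem F.1).face_subset_hyperplane F.2

theorem surf_ridges (hd : 0 < d) : surf d 𝓣.ridges = 0 := by
  simp only [ridges, measure_iUnion_null_iff]
  intro F G h
  rw [Coplanar, not_or] at h
  exact surf_inter_hyperplanes hd (𝓣.norm_normal F) (𝓣.norm_normal G) _ _ h.1 h.2

variable {𝓣}

theorem coplanar_of_notMem_ridges {F G : 𝓣.Face} {x : E d} (hx : x ∉ 𝓣.ridges)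
    (hF : x ∈ 𝓣.faceSet F) (hG : x ∈ 𝓣.faceSet G) : 𝓣.Coplanar F G := by
  by_contra h
  refine hx ?_
  simp only [ridges, Set.mem_iUnion]
  exact ⟨F, G, h, 𝓣.faceSet_subset_hyperplane F hF, 𝓣.faceSet_subset_hyperplane G hG⟩

theorem eq_of_notMem_ridges {F G : 𝓣.Face} {x : E d} (hx : x ∉ 𝓣.ridges)
    (hF : x ∈ 𝓣.faceSet F) (hG : x ∈ 𝓣.faceSet G) (h : F.1 = G.1) : F = G := by
  obtain ⟨K, i⟩ := F
  obtain ⟨K', j⟩ := G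
  obtain rfl : K = K' := h
  by_contra hne
  have hij : j ≠ i := fun h => hne (by rw [h])
  rcases coplanar_of_notMem_ridges hx hF hG with h | h
  · exact (𝓣.elem K).not_parallel hij h
  · exact (𝓣.elem K).not_opposite i j h

/-- Away from the ridges, an element is a half-space near a point of a face. -/
theorem eventually_lt_of_notMem_ridges {F : 𝓣.Face} {x : E d} (hx : x ∉ 𝓣.ridges)
    (hF : x ∈ 𝓣.faceSet F) : ∀ᶠ y in 𝓝 x, ∀ j ≠ F.2,
      inner ℝ ((𝓣.elem F.1).normal j) y < (𝓣.elem F.1).offset j := by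
  refine eventually_all.2 fun j => ?_
  by_cases hj : j = F.2
  · exact .of_forall fun _ h => absurd hj h
  · have hlt : inner ℝ ((𝓣.elem F.1).normal j) x < (𝓣.elem F.1).offset j := by
      refine lt_of_le_of_ne (hF.1 j) fun h => ?_
      have hG : x ∈ 𝓣.faceSet ⟨F.1, j⟩ := ⟨hF.1, h⟩
      obtain ⟨K, i⟩ := F
      have := eq_of_notMem_ridges hx hG hF rfl
      exact hj (by simpa using this)
    have hc : Continuous fun y : E d => inner ℝ ((𝓣.elem F.1).normal j) y := by fun_prop
    filter_upwards [(hc.tendsto x).eventually (eventually_lt_nhds hlt)] with y hy _ using hy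

theorem mem_carrier_of_lt {F : 𝓣.Face} {y : E d} (h : ∀ j ≠ F.2,
      inner ℝ ((𝓣.elem F.1).normal j) y < (𝓣.elem F.1).offset j)
    (hy : inner ℝ (𝓣.normal F) y < (𝓣.elem F.1).offset F.2) : y ∈ (𝓣.elem F.1).carrier := fun j => by
  by_cases hj : j = F.2
  · rw [hj]; exact hy
  · exact h j hj

theorem mem_closure_of_le {F : 𝓣.Face} {y : E d} (h : ∀ j ≠ F.2,
      inner ℝ ((𝓣.elem F.1).normal j) y < (𝓣.elem F.1).offset j)
    (hy : inner ℝ (𝓣.normal F) y ≤ (𝓣.elem F.1).offset F.2) :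
    y ∈ closure (𝓣.elem F.1).carrier := (𝓣.elem F.1).mem_closure_iff.2 fun j => by
  by_cases hj : j = F.2
  · rw [hj]; exact hy
  · exact (h j hj).le

/-- Small steps along the normal in either direction stay where p holds and leave the hyperplane.
They supply test points strictly on each side of a face. -/
theorem frequently_lt_normal (F : 𝓣.Face) {x : E d} (hx : x ∈ 𝓣.faceSet F) {p : E d → Prop}
    (hp : ∀ᶠ y in 𝓝 x, p y) : (∃ y, p y ∧ inner ℝ (𝓣.normal F) y < (𝓣.elem F.1).offset F.2) ∧
      ∃ y, p y ∧ (𝓣.elem F.1).offset F.2 < inner ℝ (𝓣.normal F) y := by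
  have hlim : Tendsto (fun t : ℝ => x + t • 𝓣.normal F) (𝓝 0) (𝓝 x) := by
    have : Continuous fun t : ℝ => x + t • 𝓣.normal F := by fun_prop
    simpa using this.tendsto 0
  have hval : ∀ t : ℝ, inner ℝ (𝓣.normal F) (x + t • 𝓣.normal F) =
      (𝓣.elem F.1).offset F.2 + t := fun t => by
    rw [inner_add_right, inner_smul_right, real_inner_self_eq_norm_sq, 𝓣.norm_normal,
      𝓣.faceSet_subset_hyperplane F hx]
    simp
  have hev := hlim.eventually hp
  constructor
  · obtain ⟨t, ht, ht0⟩ := ((hev.filter_mono nhdsWithin_le_nhds).and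
      (self_mem_nhdsWithin : Set.Iio (0 : ℝ) ∈ 𝓝[<] 0)).exists
    exact ⟨_, ht, by rw [hval]; linarith⟩
  · obtain ⟨t, ht, ht0⟩ := ((hev.filter_mono nhdsWithin_le_nhds).and
      (self_mem_nhdsWithin : Set.Ioi (0 : ℝ) ∈ 𝓝[>] 0)).exists
    exact ⟨_, ht, by rw [hval]; linarith⟩

/-- With equal normals, both elements would fill the same half-ball near x and would not be
disjoint. -/
theorem opposite_of_notMem_ridges {F G : 𝓣.Face} {x : E d} (hx : x ∉ 𝓣.ridges)
    (hF : x ∈ 𝓣.faceSet F) (hG : x ∈ 𝓣.faceSet G) (h : F.1 ≠ G.1) :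
    𝓣.normal G = -𝓣.normal F ∧ (𝓣.elem G.1).offset G.2 = -(𝓣.elem F.1).offset F.2 := by
  refine (coplanar_of_notMem_ridges hx hF hG).resolve_left fun ⟨h1, h2⟩ => ?_
  obtain ⟨y, ⟨hyF, hyG⟩, hy⟩ := (frequently_lt_normal F hF
    ((eventually_lt_of_notMem_ridges hx hF).and (eventually_lt_of_notMem_ridges hx hG))).1
  exact Set.disjoint_left.1 (𝓣.disjoint _ _ h) (mem_carrier_of_lt hyF hy)
    (mem_carrier_of_lt hyG (by rw [h1, h2]; exact hy))

/-- Three faces of three different elements would have pairwise opposite normals, forcing n = -n. -/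
theorem eq_of_three_faces {F G H : 𝓣.Face} {x : E d} (hx : x ∉ 𝓣.ridges)
    (hF : x ∈ 𝓣.faceSet F) (hG : x ∈ 𝓣.faceSet G) (hH : x ∈ 𝓣.faceSet H)
    (hFG : F.1 ≠ G.1) (hFH : F.1 ≠ H.1) : G = H := by
  by_cases hGH : G.1 = H.1
  · exact eq_of_notMem_ridges hx hG hH hGH
  · exfalso
    have h1 := (opposite_of_notMem_ridges hx hF hG hFG).1
    have h2 := (opposite_of_notMem_ridges hx hF hH hFH).1
    have h3 := (opposite_of_notMem_ridges hx hG hH hGH).1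
    rw [h2, h1, neg_neg] at h3
    have h4 : 𝓣.normal F = 0 := by
      have h5 : (2 : ℝ) • 𝓣.normal F = 0 := by
        rw [two_smul]; nth_rewrite 1 [← h3]; exact neg_add_cancel _
      exact (smul_eq_zero.1 h5).resolve_left two_ne_zero
    have := 𝓣.norm_normal F
    rw [h4, norm_zero] at this
    exact zero_ne_one this

theorem closure_carrier_subset (K : Fin 𝓣.N) : closure (𝓣.elem K).carrier ⊆ closure Ω := by
  rw [← 𝓣.cover]
  exact Set.subset_iUnion (fun K => closure (𝓣.elem K).carrier) K

theorem carrier_subset (hΩr : interior (closure Ω) = Ω) (K : Fin 𝓣.N) :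
    (𝓣.elem K).carrier ⊆ Ω := by
  have h := interior_maximal (subset_closure.trans (closure_carrier_subset K))
    (𝓣.elem K).isOpen_carrier
  rwa [hΩr] at h

theorem notMem_carrier_of_mem_closure {K K' : Fin 𝓣.N} (h : K ≠ K') {x : E d}
    (hx : x ∈ closure (𝓣.elem K).carrier) : x ∉ (𝓣.elem K').carrier := by
  intro hx'
  obtain ⟨y, hy', hy⟩ := mem_closure_iff.1 hx _ (𝓣.elem K').isOpen_carrier hx'
  exact Set.disjoint_left.1 (𝓣.disjoint K K' h) hy hy'

/-- The two elements fill opposite half-balls, so a neighbourhood of x lies in the closure of Ω.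
Then Ω = int closure Ω puts x in Ω; without this property, a slit in Ω could carry two faces. -/
theorem mem_of_two_faces (hΩr : interior (closure Ω) = Ω) {F G : 𝓣.Face} {x : E d}
    (hx : x ∉ 𝓣.ridges) (hF : x ∈ 𝓣.faceSet F) (hG : x ∈ 𝓣.faceSet G) (h : F.1 ≠ G.1) :
    x ∈ Ω := by
  rw [← hΩr, mem_interior_iff_mem_nhds]
  obtain ⟨h1, h2⟩ := opposite_of_notMem_ridges hx hF hG h
  filter_upwards [eventually_lt_of_notMem_ridges hx hF, eventually_lt_of_notMem_ridges hx hG]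
    with y hyF hyG
  rcases le_total (inner ℝ (𝓣.normal F) y) ((𝓣.elem F.1).offset F.2) with hy | hy
  · exact closure_carrier_subset _ (mem_closure_of_le hyF hy)
  · refine closure_carrier_subset _ (mem_closure_of_le hyG ?_)
    rw [h1, h2, inner_neg_left]
    exact neg_le_neg hy

/-- If no other element touched x, points of Ω just beyond the face would be left uncovered by the
mesh. -/
theorem exists_mem_face_of_mem {F : 𝓣.Face} {x : E d} (hΩo : IsOpen Ω)
    (hF : x ∈ 𝓣.faceSet F) (hxΩ : x ∈ Ω) : ∃ G : 𝓣.Face, F.1 ≠ G.1 ∧ x ∈ 𝓣.faceSet G := by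
  by_contra! hno
  have hcl : ∀ K, K ≠ F.1 → x ∉ closure (𝓣.elem K).carrier := by
    intro K hK hx
    obtain ⟨i, hi⟩ := (𝓣.elem K).exists_mem_face hx
      (notMem_carrier_of_mem_closure hK.symm ((𝓣.elem F.1).face_subset_closure F.2 hF))
    exact hno ⟨K, i⟩ hK.symm hi
  have hev : ∀ᶠ y in 𝓝 x, ∀ K, K ≠ F.1 → y ∉ closure (𝓣.elem K).carrier := by
    refine eventually_all.2 fun K => ?_
    by_cases hK : K = F.1
    · exact .of_forall fun _ h => absurd hK h
    · filter_upwards [isClosed_closure.isOpen_compl.mem_nhds (hcl K hK)] with y hy _ using hy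
  obtain ⟨y, ⟨hy, hyΩ⟩, hlt⟩ := (frequently_lt_normal F hF (hev.and (hΩo.mem_nhds hxΩ))).2
  have hyc : y ∈ ⋃ K, closure (𝓣.elem K).carrier := by
    rw [𝓣.cover]; exact subset_closure hyΩ
  obtain ⟨K, hK⟩ := Set.mem_iUnion.1 hyc
  by_cases hKF : K = F.1
  · subst hKF
    exact ((𝓣.elem F.1).mem_closure_iff.1 hK F.2).not_gt hlt
  · exact hy K hKF hK

theorem isClosed_mortarSet (e : 𝓣.Mortar) : IsClosed (𝓣.mortarSet e) := by
  rcases e with q | F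
  · exact ((𝓣.elem _).isClosed_face _).inter ((𝓣.elem _).isClosed_face _)
  · exact ((𝓣.elem _).isClosed_face _).inter isClosed_frontier

theorem measurableSet_mortarSet (e : 𝓣.Mortar) : MeasurableSet (𝓣.mortarSet e) :=
  (isClosed_mortarSet e).measurableSet

theorem mortarSet_subset_faceSet {e : 𝓣.Mortar} {F : 𝓣.Face} (h : F ∈ 𝓣.sides e) :
    𝓣.mortarSet e ⊆ 𝓣.faceSet F := by
  rcases e with q | G
  · simp only [sides, Finset.mem_insert, Finset.mem_singleton] at h
    rcases h with rfl | rfl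
    · exact Set.inter_subset_left
    · exact Set.inter_subset_right
  · simp only [sides, Finset.mem_singleton] at h
    subst h
    exact Set.inter_subset_left

theorem surf_mortarSet_ne_zero (e : 𝓣.Mortar) : surf d (𝓣.mortarSet e) ≠ 0 := by
  rcases e with q | F
  · exact q.2.2
  · exact F.2

theorem exists_mem_sides (e : 𝓣.Mortar) : ∃ F, F ∈ 𝓣.sides e := by
  rcases e with q | F
  · exact ⟨q.1.1, by simp [sides]⟩
  · exact ⟨F.1, by simp [sides]⟩

theorem isBounded_mortarSet (e : 𝓣.Mortar) : Bornology.IsBounded (𝓣.mortarSet e) := by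
  obtain ⟨F, hF⟩ := exists_mem_sides e
  exact ((𝓣.elem _).isBounded_face _).subset (mortarSet_subset_faceSet hF)

theorem surf_mortarSet_lt_top (hd : 0 < d) (e : 𝓣.Mortar) : surf d (𝓣.mortarSet e) < ⊤ := by
  obtain ⟨F, hF⟩ := exists_mem_sides e
  exact surf_lt_top_of_isBounded hd (𝓣.norm_normal F)
    ((mortarSet_subset_faceSet hF).trans (𝓣.faceSet_subset_hyperplane F)) (isBounded_mortarSet e)

theorem exists_other_side {q} {F : 𝓣.Face} (h : F ∈ 𝓣.sides (.inl q)) : ∃ G : 𝓣.Face, F.1 ≠ G.1 ∧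
    𝓣.mortarSet (.inl q) ⊆ 𝓣.faceSet G ∧ (q.1 = (F, G) ∨ q.1 = (G, F)) := by
  simp only [sides, Finset.mem_insert, Finset.mem_singleton] at h
  rcases h with rfl | rfl
  · exact ⟨q.1.2, q.2.1.ne, Set.inter_subset_right, .inl rfl⟩
  · exact ⟨q.1.1, q.2.1.ne', Set.inter_subset_left, .inr rfl⟩

/-- Away from the ridges, a point of F lies on at most one face of another element. Moreover, points
of interior mortars are then in Ω, whereas boundary mortars lie on its frontier. -/
theorem mortarSet_inter_subset_ridges (hΩo : IsOpen Ω) (hΩr : interior (closure Ω) = Ω)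
    {e e' : 𝓣.Mortar} (hne : e ≠ e') {F : 𝓣.Face} (he : F ∈ 𝓣.sides e) (he' : F ∈ 𝓣.sides e') :
    𝓣.mortarSet e ∩ 𝓣.mortarSet e' ⊆ 𝓣.ridges := by
  rintro x ⟨hx, hx'⟩
  by_contra hr
  have hF := mortarSet_subset_faceSet he hx
  have hmix : ∀ q, F ∈ 𝓣.sides (.inl q) → x ∈ 𝓣.mortarSet (.inl q) → x ∉ frontier Ω := by
    intro q hq hxq
    obtain ⟨G, hG, hsub, -⟩ := exists_other_side hq
    rw [hΩo.frontier_eq]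
    exact fun h => h.2 (mem_of_two_faces hΩr hr hF (hsub hxq) hG)
  rcases e with q | G <;> rcases e' with q' | G'
  · obtain ⟨G, hG, hsub, hq⟩ := exists_other_side he
    obtain ⟨G', hG', hsub', hq'⟩ := exists_other_side he'
    obtain rfl : G = G' := eq_of_three_faces hr hF (hsub hx) (hsub' hx') hG hG'
    refine hne (congrArg Sum.inl (Subtype.ext ?_))
    have h1 := q.2.1
    have h2 := q'.2.1
    -- Both mortars consist of F and G. The ordering of element indices admits only one of the pairs
    -- (F, G) and (G, F).
    rcases hq with hq | hq <;> rcases hq' with hq' | hq'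
    · rw [hq, hq']
    · rw [hq] at h1; rw [hq'] at h2; exact absurd h1 h2.not_gt
    · rw [hq] at h1; rw [hq'] at h2; exact absurd h1 h2.not_gt
    · rw [hq, hq']
  · exact hmix q he hx hx'.2
  · exact hmix q' he' hx' hx.2
  · simp only [sides, Finset.mem_singleton] at he he'
    exact hne (congrArg Sum.inr (Subtype.ext (he.symm.trans he')))

/-- Up to a null set, the mortars of a face cover the face. -/
theorem surf_faceSet_diff_mortars (hΩo : IsOpen Ω)
    (F : 𝓣.Face) : surf d (𝓣.faceSet F \ ⋃ e : {e : 𝓣.Mortar // F ∈ 𝓣.sides e}, 𝓣.mortarSet e) = 0 := by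
  -- The null intersections of F with other faces or with the frontier, which are not listed as
  -- mortars. Each point of F outside the mortars falls into one of them.
  set Z : Set (E d) := (⋃ (G : 𝓣.Face) (_ : surf d (𝓣.faceSet F ∩ 𝓣.faceSet G) = 0),
      𝓣.faceSet F ∩ 𝓣.faceSet G) ∪
      ⋃ (_ : surf d (𝓣.faceSet F ∩ frontier Ω) = 0), 𝓣.faceSet F ∩ frontier Ω with hZ
  have hZ0 : surf d Z = 0 := by
    rw [hZ, measure_union_null_iff]
    simp only [measure_iUnion_null_iff]
    exact ⟨fun _ h => h, fun h => h⟩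
  refine measure_mono_null ?_ hZ0
  rintro x ⟨hxF, hx⟩
  simp only [Set.mem_iUnion, not_exists] at hx
  by_cases hxΩ : x ∈ Ω
  · obtain ⟨G, hFG, hG⟩ := exists_mem_face_of_mem hΩo hxF hxΩ
    refine Or.inl (Set.mem_iUnion₂.2 ⟨G, ?_, hxF, hG⟩)
    by_contra h0
    rcases lt_or_gt_of_ne hFG with hlt | hlt
    · exact hx ⟨.inl ⟨(F, G), hlt, h0⟩, by simp [sides]⟩ ⟨hxF, hG⟩
    · exact hx ⟨.inl ⟨(G, F), hlt, by rwa [Set.inter_comm]⟩, by simp [sides]⟩ ⟨hG, hxF⟩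
  · have hfr : x ∈ frontier Ω := by
      rw [hΩo.frontier_eq]
      exact ⟨closure_carrier_subset _ ((𝓣.elem F.1).face_subset_closure F.2 hxF), hxΩ⟩
    refine Or.inr (Set.mem_iUnion.2 ⟨?_, hxF, hfr⟩)
    by_contra h0
    exact hx ⟨.inr ⟨F, h0⟩, by simp [sides]⟩ ⟨hxF, hfr⟩

/-- The mortars of a face cover it and overlap in null sets. Hence the boundary pairing, defined
mortar by mortar, is an honest integral over the faces. -/
theorem surf_restrict_faceSet (hd : 0 < d) (hΩo : IsOpen Ω) (hΩr : interior (closure Ω) = Ω)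
    (F : 𝓣.Face) : (surf d).restrict (𝓣.faceSet F) =
      ∑ e : 𝓣.Mortar with F ∈ 𝓣.sides e, (surf d).restrict (𝓣.mortarSet e) := by
  have h1 : (surf d).restrict (𝓣.faceSet F) =
      (surf d).restrict (⋃ e : {e : 𝓣.Mortar // F ∈ 𝓣.sides e}, 𝓣.mortarSet e) := by
    refine Measure.restrict_congr_set ?_
    rw [ae_eq_set]
    refine ⟨surf_faceSet_diff_mortars hΩo F, ?_⟩
    rw [Set.sdiff_eq_empty.2, measure_empty]
    exact Set.iUnion_subset fun e => mortarSet_subset_faceSet e.2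
  rw [h1, Measure.restrict_iUnion_ae, Measure.sum_fintype]
  · exact (Finset.sum_subtype _ (by simp) fun e => (surf d).restrict (𝓣.mortarSet e)).symm
  · intro e e' hne
    exact measure_mono_null (mortarSet_inter_subset_ridges hΩo hΩr
      (fun h => hne (Subtype.ext h)) e.2 e'.2) (𝓣.surf_ridges hd)
  · exact fun e => (measurableSet_mortarSet _).nullMeasurableSet

theorem integrable_mortarSet (hd : 0 < d) (e : 𝓣.Mortar) {f : E d → ℝ} (hf : Continuous f) :
    IntegrableOn f (𝓣.mortarSet e) (surf d) := by
  obtain ⟨M, hM⟩ := (Metric.isCompact_of_isClosed_isBounded (isClosed_mortarSet e)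
    (isBounded_mortarSet e)).exists_bound_of_continuousOn hf.continuousOn
  refine Measure.integrableOn_of_bounded (M := M) (surf_mortarSet_lt_top hd e).ne
    hf.measurable.aestronglyMeasurable ?_
  exact (ae_restrict_mem (measurableSet_mortarSet e)).mono fun x hx => hM x hx

theorem boundaryIntegral_eq_sum_faces (hd : 0 < d) (hΩo : IsOpen Ω)
    (hΩr : interior (closure Ω) = Ω) (K : Fin 𝓣.N) (f : 𝓣.Face → E d → ℝ)
    (hf : ∀ F, Continuous (f F)) :
    𝓣.boundaryIntegral K (fun F _ x => f F x) =
      ∑ i, ∫ x in (𝓣.elem K).face i, f ⟨K, i⟩ x ∂surf d := by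
  refine Finset.sum_congr rfl fun i _ => ?_
  have h := surf_restrict_faceSet (𝓣 := 𝓣) hd hΩo hΩr ⟨K, i⟩
  change _ = ∫ x in 𝓣.faceSet ⟨K, i⟩, f ⟨K, i⟩ x ∂surf d
  rw [h, integral_finsetSum_measure fun e _ => integrable_mortarSet hd e (hf _)]
  exact Finset.sum_congr rfl fun e _ => integral_subtype_comap (measurableSet_mortarSet e) _

/-- The divergence theorem for polynomials on the elements of a mesh. -/
theorem integral_pderiv (hd : 0 < d) (hΩo : IsOpen Ω) (hΩr : interior (closure Ω) = Ω)
    (K : Fin 𝓣.N) (k : Fin d) (q : MvPolynomial (Fin d) ℝ) :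
    ∫ x in (𝓣.elem K).carrier, MvPolynomial.eval (fun k => x k) (MvPolynomial.pderiv k q) =
      𝓣.boundaryIntegral K (fun F _ x =>
        𝓣.normal F k * MvPolynomial.eval (fun k => x.1 k) q) := by
  rw [boundaryIntegral_eq_sum_faces hd hΩo hΩr K
    (fun F x => 𝓣.normal F k * MvPolynomial.eval (fun k => x k) q)
    fun F => continuous_const.mul (continuous_eval q)]
  have h := (𝓣.elem K).integral_fderiv_eq_sum_faces hd (contDiff_eval q) (basisVec k)
  simp_rw [fderiv_eval_basisVec] at h
  rw [h]
  refine Finset.sum_congr rfl fun i _ => ?_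
  rw [integral_const_mul]
  congr 1
  rw [real_inner_comm, EuclideanSpace.inner_single_left]
  simp [normal]

end Mesh

/-! ## Connectivity of the mesh -/

/-- In a ball, a segment can be moved so as to avoid a set of zero surface measure. -/
theorem exists_translate_segment_avoiding {d : ℕ} (hd : 0 < d) {Z : Set (E d)} (hZ : surf d Z = 0)
    {y z : E d} (hyz : y ≠ z) {r : ℝ} (hr : 0 < r) :
    ∃ h : E d, ‖h‖ < r ∧ ∀ x ∈ segment ℝ (y + h) (z + h), x ∉ Z := by
  set n : E d := ‖z - y‖⁻¹ • (z - y) with hn_def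
  have hne : z - y ≠ 0 := sub_ne_zero.2 hyz.symm
  have hn : ‖n‖ = 1 := by
    rw [hn_def, norm_smul, norm_inv, norm_norm, inv_mul_cancel₀ (norm_ne_zero_iff.2 hne)]
  obtain ⟨c⟩ := nonempty_hyperplaneChart hd hn
  -- Orthogonal projection along z - y. It is 1-Lipschitz, so the image of Z is Lebesgue null, and
  -- the whole segment projects to a single point.
  set P : E d →L[ℝ] E (d - 1) := ContinuousLinearMap.adjoint c.L.toContinuousLinearMap with hP
  have hPn : P n = 0 := by
    refine ext_inner_right ℝ fun w => ?_
    rw [hP, ContinuousLinearMap.adjoint_inner_left, inner_zero_left]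
    exact c.inner_eq_zero w
  have hPL : ∀ v, P (c.L v) = v := fun v => by
    refine ext_inner_right ℝ fun w => ?_
    rw [hP, ContinuousLinearMap.adjoint_inner_left]
    exact c.L.inner_map_map v w
  have hPzy : P (z - y) = 0 := by
    have : z - y = ‖z - y‖ • n := by
      rw [hn_def, smul_smul, mul_inv_cancel₀ (norm_ne_zero_iff.2 hne), one_smul]
    rw [this, map_smul, hPn, smul_zero]
  have hlip : LipschitzWith 1 P := by
    refine P.lipschitz.weaken ?_
    rw [← NNReal.coe_le_coe, coe_nnnorm, hP, LinearIsometryEquiv.norm_map]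
    exact c.L.norm_toContinuousLinearMap_le
  have hnull : volume (P '' Z) = 0 := by
    rw [← EuclideanSpace.euclideanHausdorffMeasure_eq_volume]
    rw [surf, Measure.euclideanHausdorffMeasure_def, Measure.smul_apply] at hZ
    rw [Measure.euclideanHausdorffMeasure_def, Measure.smul_apply]
    have hZ' : Measure.hausdorffMeasure ((d - 1 : ℕ) : ℝ) Z = 0 := by
      rcases smul_eq_zero.1 hZ with h | h
      · exact absurd h (Measure.addHaarScalarFactor_volume_hausdorffMeasure_ne_zero _)
      · exact h
    have h1 := hlip.hausdorffMeasure_image_le (d := ((d - 1 : ℕ) : ℝ)) (Nat.cast_nonneg _) Z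
    rw [hZ', mul_zero, nonpos_iff_eq_zero] at h1
    rw [h1, smul_zero]
  -- A ball is not null, so the projected point can be moved by less than r off the image of Z.
  -- Lifting this move tangentially carries the whole segment off Z.
  obtain ⟨w, hw, hwZ⟩ : ∃ w ∈ Metric.ball (P y) r, w ∉ P '' Z := by
    by_contra! hall
    exact (Metric.measure_ball_pos volume (P y) hr).ne' (measure_mono_null hall hnull)
  refine ⟨c.L (w - P y), ?_, fun x hx hxZ => hwZ ⟨x, hxZ, ?_⟩⟩
  · rw [c.L.norm_map, ← dist_eq_norm]; exact hw
  · rw [segment_eq_image'] at hx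
    obtain ⟨t, -, rfl⟩ := hx
    simp only [map_add, map_smul, hPL, add_sub_add_right_eq_sub, hPzy, smul_zero, add_zero]
    abel

namespace Mesh

variable {d : ℕ} {Ω : Set (E d)} {𝓣 : Mesh Ω}

/-- A quantity that does not jump across interior mortars is the same on all elements. -/
theorem eq_of_forall_interior_mortar {α : Type*} (hd : 0 < d) (hΩo : IsOpen Ω)
    (hΩc : IsConnected Ω) (hΩr : interior (closure Ω) = Ω) (c : Fin 𝓣.N → α)
    (hc : ∀ q : {q : 𝓣.Face × 𝓣.Face //
      q.1.1 < q.2.1 ∧ surf d (𝓣.faceSet q.1 ∩ 𝓣.faceSet q.2) ≠ 0}, c q.1.1.1 = c q.1.2.1)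
    (K₀ K₁ : Fin 𝓣.N) : c K₁ = c K₀ := by
  classical
  by_contra hne
  set A : Set (E d) := ⋃ (K : Fin 𝓣.N) (_ : c K = c K₀), closure (𝓣.elem K).carrier with hA
  set B : Set (E d) := ⋃ (K : Fin 𝓣.N) (_ : c K ≠ c K₀), closure (𝓣.elem K).carrier with hB
  have hAc : IsClosed A := isClosed_iUnion_of_finite fun K =>
    isClosed_iUnion_of_finite fun _ => isClosed_closure
  have hBc : IsClosed B := isClosed_iUnion_of_finite fun K =>
    isClosed_iUnion_of_finite fun _ => isClosed_closure
  have hAB : ∀ x ∈ Ω, x ∈ A ∨ x ∈ B := by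
    intro x hx
    have h := subset_closure hx
    rw [← 𝓣.cover] at h
    obtain ⟨K, hK⟩ := Set.mem_iUnion.1 h
    by_cases hcK : c K = c K₀
    · exact .inl (Set.mem_iUnion₂.2 ⟨K, hcK, hK⟩)
    · exact .inr (Set.mem_iUnion₂.2 ⟨K, hcK, hK⟩)
  have hface : ∀ K K', K ≠ K' → ∀ x ∈ closure (𝓣.elem K).carrier,
      x ∈ closure (𝓣.elem K').carrier → ∃ i, x ∈ (𝓣.elem K).face i := fun K K' hKK x hx hx' =>
    (𝓣.elem K).exists_mem_face hx (notMem_carrier_of_mem_closure hKK.symm hx')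
  -- A common point lies on faces of two elements with different values of c. These faces do not
  -- form a mortar, so their intersection is null.
  have hZ : surf d (A ∩ B) = 0 := by
    have hsub : A ∩ B ⊆ ⋃ (F : 𝓣.Face) (G : 𝓣.Face)
        (_ : surf d (𝓣.faceSet F ∩ 𝓣.faceSet G) = 0), 𝓣.faceSet F ∩ 𝓣.faceSet G := by
      rintro x ⟨hxA, hxB⟩
      obtain ⟨K, hK, hx⟩ := Set.mem_iUnion₂.1 hxA
      obtain ⟨K', hK', hx'⟩ := Set.mem_iUnion₂.1 hxB
      have hKK : K ≠ K' := fun h => hK' (h ▸ hK)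
      obtain ⟨i, hi⟩ := hface K K' hKK x hx hx'
      obtain ⟨j, hj⟩ := hface K' K hKK.symm x hx' hx
      simp only [Set.mem_iUnion]
      refine ⟨⟨K, i⟩, ⟨K', j⟩, ?_, hi, hj⟩
      by_contra h0
      rcases lt_or_gt_of_ne hKK with hlt | hlt
      · exact hK' ((hc ⟨(⟨K, i⟩, ⟨K', j⟩), hlt, h0⟩).symm.trans hK)
      · exact hK' ((hc ⟨(⟨K', j⟩, ⟨K, i⟩), hlt, by rwa [Set.inter_comm]⟩).trans hK)
    refine measure_mono_null hsub ?_
    simp only [measure_iUnion_null_iff]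
    exact fun _ _ h => h
  -- If both failed, a small ball would contain a point off A and a point off B. A translated
  -- segment between nearby points avoids A ∩ B, so its connectedness yields a point outside both
  -- sets, although A ∪ B covers Ω.
  have hball : ∀ x ∈ Ω, A ∈ 𝓝 x ∨ B ∈ 𝓝 x := by
    intro x hx
    obtain ⟨ε, hε, hεΩ⟩ := Metric.isOpen_iff.1 hΩo x hx
    by_contra! hcon
    have hex : ∀ S : Set (E d), S ∉ 𝓝 x → ∃ y ∈ Metric.ball x ε, y ∉ S := by
      intro S hS
      by_contra! h
      exact hS (mem_of_superset (Metric.ball_mem_nhds x hε) h)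
    obtain ⟨y, hy, hyA⟩ := hex A hcon.1
    obtain ⟨z, hz, hzB⟩ := hex B hcon.2
    have hyz : y ≠ z := by
      rintro rfl
      rcases hAB y (hεΩ hy) with h | h
      exacts [hyA h, hzB h]
    obtain ⟨r₁, hr₁, hr₁s⟩ := Metric.isOpen_iff.1 (Metric.isOpen_ball.inter hAc.isOpen_compl) y
      ⟨hy, hyA⟩
    obtain ⟨r₂, hr₂, hr₂s⟩ := Metric.isOpen_iff.1 (Metric.isOpen_ball.inter hBc.isOpen_compl) z
      ⟨hz, hzB⟩
    obtain ⟨h, hh, hseg⟩ := exists_translate_segment_avoiding hd hZ hyz (lt_min hr₁ hr₂)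
    have hyh : y + h ∈ Metric.ball x ε ∩ Aᶜ := hr₁s (by
      simpa using hh.trans_le (min_le_left _ _))
    have hzh : z + h ∈ Metric.ball x ε ∩ Bᶜ := hr₂s (by
      simpa using hh.trans_le (min_le_right _ _))
    have hsegΩ : segment ℝ (y + h) (z + h) ⊆ Ω :=
      ((convex_ball x ε).segment_subset hyh.1 hzh.1).trans hεΩ
    obtain ⟨w, hw, hwA, hwB⟩ := (convex_segment (𝕜 := ℝ) (y + h) (z + h)).isPreconnected Aᶜ Bᶜ
      hAc.isOpen_compl hBc.isOpen_compl (fun w hw => by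
        by_contra hcon
        simp only [Set.mem_union, Set.mem_compl_iff, not_or, not_not] at hcon
        exact hseg w hw hcon)
      ⟨_, left_mem_segment _ _ _, hyh.2⟩ ⟨_, right_mem_segment _ _ _, hzh.2⟩
    rcases hAB w (hsegΩ hw) with h | h
    exacts [hwA h, hwB h]
  have hmeet : ∀ K, (Ω ∩ (𝓣.elem K).carrier).Nonempty := fun K => by
    obtain ⟨x, hx⟩ := (𝓣.elem K).nonempty
    exact ⟨x, carrier_subset hΩr K hx, hx⟩
  -- The interiors of A and B now cover Ω and both meet it, so by connectedness they intersect. Two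
  -- elements with different values of c would then overlap.
  obtain ⟨x, hx, hxA, hxB⟩ := hΩc.isPreconnected (interior A) (interior B) isOpen_interior
    isOpen_interior (fun x hx => by
      rcases hball x hx with h | h
      · exact .inl (mem_interior_iff_mem_nhds.2 h)
      · exact .inr (mem_interior_iff_mem_nhds.2 h))
    (by
      obtain ⟨x, hx, hxK⟩ := hmeet K₀
      exact ⟨x, hx, interior_maximal (subset_closure.trans (Set.subset_iUnion₂ (s := fun K
        (_ : c K = c K₀) => closure (𝓣.elem K).carrier) K₀ rfl)) (𝓣.elem K₀).isOpen_carrier hxK⟩)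
    (by
      obtain ⟨x, hx, hxK⟩ := hmeet K₁
      exact ⟨x, hx, interior_maximal (subset_closure.trans (Set.subset_iUnion₂ (s := fun K
        (_ : c K ≠ c K₀) => closure (𝓣.elem K).carrier) K₁ hne)) (𝓣.elem K₁).isOpen_carrier hxK⟩)
  obtain ⟨K, hK, hxK⟩ := Set.mem_iUnion₂.1 (interior_subset hxA)
  obtain ⟨y, hyB, hyK⟩ := mem_closure_iff.1 hxK _ isOpen_interior hxB
  obtain ⟨K', hK', hyK'⟩ := Set.mem_iUnion₂.1 (interior_subset hyB)
  exact notMem_carrier_of_mem_closure (fun h => hK' (by rw [h]; exact hK)) hyK' hyK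

/-- A part of the boundary of positive surface measure meets a boundary mortar in a set of positive
surface measure. -/
theorem exists_boundary_mortar (hΩo : IsOpen Ω) (hΩr : interior (closure Ω) = Ω)
    {S : Set (E d)} (hS : S ⊆ frontier Ω) (hS0 : surf d S ≠ 0) :
    ∃ F : {F : 𝓣.Face // surf d (𝓣.faceSet F ∩ frontier Ω) ≠ 0},
      surf d (𝓣.mortarSet (.inr F) ∩ S) ≠ 0 := by
  by_contra! hcon
  have hsub : S ⊆ ⋃ F : 𝓣.Face, 𝓣.faceSet F ∩ S := by
    intro x hx
    have hfr := hS hx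
    rw [hΩo.frontier_eq, ← 𝓣.cover] at hfr
    obtain ⟨K, hK⟩ := Set.mem_iUnion.1 hfr.1
    obtain ⟨i, hi⟩ := (𝓣.elem K).exists_mem_face hK fun h => hfr.2 (carrier_subset hΩr K h)
    exact Set.mem_iUnion.2 ⟨⟨K, i⟩, hi, hx⟩
  refine hS0 (measure_mono_null hsub (measure_iUnion_null fun F => ?_))
  by_cases hF : surf d (𝓣.faceSet F ∩ frontier Ω) = 0
  · exact measure_mono_null (Set.inter_subset_inter_right _ hS) hF
  · refine measure_mono_null ?_ (hcon ⟨F, hF⟩)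
    exact fun x hx => ⟨⟨hx.1, hS hx.2⟩, hx.2⟩

end Mesh

/-- Some boundary mortar meets Γ_D ∪ Γ_R in positive measure. It cannot be of Neumann type because
the parts are disjoint. -/
theorem BoundaryParts.exists_liesOn {d : ℕ} {Ω : Set (E d)} {Γ : BoundaryParts Ω} {𝓣 : Mesh Ω}
    (hΓ : Γ.ResolvedBy 𝓣) (hΩo : IsOpen Ω) (hΩr : interior (closure Ω) = Ω)
    (h : surf d (Γ.D ∪ Γ.R) ≠ 0) : ∃ F, 𝓣.LiesOn (.inr F) Γ.D ∨ 𝓣.LiesOn (.inr F) Γ.R := by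
  obtain ⟨F, hF⟩ := Mesh.exists_boundary_mortar (𝓣 := 𝓣) hΩo hΩr (S := Γ.D ∪ Γ.R)
    (by rw [← Γ.union]; intro x hx; rcases hx with hx | hx
        exacts [.inl (.inl hx), .inr hx]) h
  refine ⟨F, ?_⟩
  rcases hΓ F with h | h | h
  · exact .inl h
  · refine absurd (measure_mono_null ?_ h) hF
    rintro x ⟨hx, hx' | hx'⟩
    · exact ⟨hx, fun hN => Set.disjoint_left.1 Γ.disjoint_DN hx' hN⟩
    · exact ⟨hx, fun hN => Set.disjoint_left.1 Γ.disjoint_NR hN hx'⟩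
  · exact .inr h

/-! ## Scalar form of the scheme -/

/-- The value of a polynomial at a point. -/
def ev {d : ℕ} (q : MvPolynomial (Fin d) ℝ) (x : E d) : ℝ := MvPolynomial.eval (fun k => x k) q

section Ev

variable {d : ℕ}

@[simp] theorem ev_add (q r : MvPolynomial (Fin d) ℝ) (x : E d) : ev (q + r) x = ev q x + ev r x :=
  map_add _ _ _

@[simp] theorem ev_smul (c : ℝ) (q : MvPolynomial (Fin d) ℝ) (x : E d) :
    ev (c • q) x = c * ev q x := by simp [ev]

@[simp] theorem ev_zero (x : E d) : ev (0 : MvPolynomial (Fin d) ℝ) x = 0 := map_zero _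

@[simp] theorem ev_mul (q r : MvPolynomial (Fin d) ℝ) (x : E d) : ev (q * r) x = ev q x * ev r x :=
  map_mul _ _ _

@[simp] theorem ev_C (c : ℝ) (x : E d) : ev (MvPolynomial.C c : MvPolynomial (Fin d) ℝ) x = c := by
  simp [ev]

@[fun_prop] theorem continuous_ev (q : MvPolynomial (Fin d) ℝ) : Continuous (ev q) :=
  continuous_eval q

theorem vec_apply {ι : Type} (s : ι → MvPolynomial (Fin d) ℝ) (x : E d) (i : ι) :
    vec s x i = ev (s i) x := rfl

/-- The normal component of a vector of polynomials. -/
def normalTrace (n : E d) (s : Fin d → MvPolynomial (Fin d) ℝ) (x : E d) : ℝ :=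
  ∑ i, n i * ev (s i) x

@[fun_prop] theorem continuous_normalTrace (n : E d) (s : Fin d → MvPolynomial (Fin d) ℝ) :
    Continuous (normalTrace n s) := by
  unfold normalTrace
  fun_prop

theorem polyOn.continuous {p : ℕ} {D : Set (E d)} (w : polyOn p D) : Continuous w.1 := by
  obtain ⟨q, -, hq⟩ := w.2
  rw [← hq]
  exact (continuous_eval q).comp continuous_subtype_val

theorem polyOn.exists_ev {p : ℕ} {D : Set (E d)} (w : polyOn p D) :
    ∃ q : MvPolynomial (Fin d) ℝ, ∀ x : D, w.1 x = ev q x := by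
  obtain ⟨q, -, hq⟩ := w.2
  exact ⟨q, fun x => by rw [← hq]; rfl⟩

instance finite_polyOn (p : ℕ) (D : Set (E d)) : Module.Finite ℝ (polyOn p D) := by
  unfold polyOn
  infer_instance

end Ev

section Forms

variable {d : ℕ} {Ω : Set (E d)} (κ : E d → Matrix (Fin d) (Fin d) ℝ) (𝓣 : Mesh Ω)
  (p : Fin 𝓣.N → ℕ)

/-- The numerical flux of the diffusion system on a mortar `e` of the face `F`. -/
def numFlux {𝓣 : Mesh Ω} {p : Fin 𝓣.N → ℕ} (F : 𝓣.Face) (s : Fin d → Poly d (p F.1))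
    (u : Fin 1 → Poly d (p F.1)) (uh : TraceSpace 𝓣 p (Fin 1)) (e : 𝓣.Mortar)
    (x : 𝓣.mortarSet e) : ℝ :=
  normalTrace (𝓣.normal F) (coes s) x + (ev (u 0).1 x - (uh e 0).1 x)

/-- The left hand side of the first local equation. -/
def form₁ (K : Fin 𝓣.N) (s : Fin d → Poly d (p K)) (u : Fin 1 → Poly d (p K))
    (uh : TraceSpace 𝓣 p (Fin 1)) (t : Fin d → Poly d (p K)) : ℝ :=
  -(∑ k, ∫ x in (𝓣.elem K).carrier, ev (u 0).1 x * ev (MvPolynomial.pderiv k (t k).1) x)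
  + (∫ x in (𝓣.elem K).carrier, ((κ x)⁻¹ *ᵥ vec (coes s) x) ⬝ᵥ vec (coes t) x)
  + ∑ i : Fin (𝓣.elem K).numFaces, ∑ e : 𝓣.Mortar with (⟨K, i⟩ : 𝓣.Face) ∈ 𝓣.sides e,
      ∫ x, (uh e 0).1 x * normalTrace (𝓣.normal ⟨K, i⟩) (coes t) x ∂𝓣.mortarMeasure e

/-- The left hand side of the second local equation. -/
def form₂ (K : Fin 𝓣.N) (s : Fin d → Poly d (p K)) (u : Fin 1 → Poly d (p K))
    (uh : TraceSpace 𝓣 p (Fin 1)) (v : Fin 1 → Poly d (p K)) : ℝ :=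
  -(∑ k, ∫ x in (𝓣.elem K).carrier, ev (s k).1 x * ev (MvPolynomial.pderiv k (v 0).1) x)
  + ∑ i : Fin (𝓣.elem K).numFaces, ∑ e : 𝓣.Mortar with (⟨K, i⟩ : 𝓣.Face) ∈ 𝓣.sides e,
      ∫ x, numFlux ⟨K, i⟩ s u uh e x * ev (v 0).1 x ∂𝓣.mortarMeasure e

/-- The jump of the numerical flux on a mortar, tested with `vh`. -/
def jumpForm (s : VolSpace 𝓣 p (Fin d)) (u : VolSpace 𝓣 p (Fin 1)) (uh : TraceSpace 𝓣 p (Fin 1))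
    (e : 𝓣.Mortar) (vh : Fin 1 → polyOn (𝓣.mortarDegree p e) (𝓣.mortarSet e)) : ℝ :=
  ∫ x, (∑ F ∈ 𝓣.sides e, numFlux F (s F.1) (u F.1) uh e x) * (vh 0).1 x ∂𝓣.mortarMeasure e

theorem flux_diffusionSystem (x : E d) {n : E d} (hn : ‖n‖ = 1) (s : Fin d → ℝ) (u uh : Fin 1 → ℝ) :
    flux (diffusionSystem κ) x n s u uh = fun _ => ∑ i, n i * s i + (u 0 - uh 0) := by
  ext j
  rw [Subsingleton.elim j 0, flux, diffusionSystem_Bn, diffusionSystem_Cn, diffusionSystem_T κ x hn]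
  simp [mulVec, dotProduct]

variable {κ 𝓣 p}

theorem isLocalSolution_diffusionSystem_iff (f : E d → Fin d ⊕ Fin 1 → ℝ)
    (uh : TraceSpace 𝓣 p (Fin 1)) (K : Fin 𝓣.N) (s : Fin d → Poly d (p K))
    (u : Fin 1 → Poly d (p K)) :
    IsLocalSolution (diffusionSystem κ) 𝓣 p f uh K s u ↔
      (∀ t, form₁ κ 𝓣 p K s u uh t =
        ∫ x in (𝓣.elem K).carrier, (fun i => f x (.inl i)) ⬝ᵥ vec (coes t) x) ∧
      (∀ v, form₂ 𝓣 p K s u uh v =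
        ∫ x in (𝓣.elem K).carrier, (fun j => f x (.inr j)) ⬝ᵥ vec (coes v) x) := by
  have hG : ∀ x, (diffusionSystem κ).G x = fromBlocks (κ x)⁻¹ 0 0 0 := fun _ => rfl
  unfold IsLocalSolution
  refine and_congr (forall_congr' fun t => ?_) (forall_congr' fun v => ?_)
  · have h1 : ∀ k x, ((diffusionSystem κ).B k x *ᵥ vec (coes u) x) ⬝ᵥ vec (dcoes k t) x =
        ev (u 0).1 x * ev (MvPolynomial.pderiv k (t k).1) x := by
      intro k x
      simp [mulVec, dotProduct, vec_apply]
    have h2 : ∀ (F : 𝓣.Face) e (x : 𝓣.mortarSet e),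
        ((diffusionSystem κ).Bn x (𝓣.normal F) *ᵥ tvec (uh e) x) ⬝ᵥ vec (coes t) x =
        (uh e 0).1 x * normalTrace (𝓣.normal F) (coes t) x := by
      intro F e x
      simp only [diffusionSystem_Bn, mulVec, dotProduct, vec_apply, normalTrace, of_apply,
        Finset.univ_unique, Finset.sum_singleton, Finset.mul_sum, Fin.default_eq_zero]
      exact Finset.sum_congr rfl fun i _ => by ring
    simp only [h1, h2, hG, toBlocks_fromBlocks₁₁, toBlocks_fromBlocks₁₂, zero_mulVec, add_zero,
      Mesh.boundaryIntegral, form₁]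
  · have h1 : ∀ k x, (((diffusionSystem κ).B k x)ᵀ *ᵥ vec (coes s) x +
        (diffusionSystem κ).C k x *ᵥ vec (coes u) x) ⬝ᵥ vec (dcoes k v) x =
        ev (s k).1 x * ev (MvPolynomial.pderiv k (v 0).1) x := by
      intro k x
      simp [mulVec, dotProduct, vec_apply]
    have h2 : ∀ (F : 𝓣.Face) (s : Fin d → Poly d (p F.1)) (u v : Fin 1 → Poly d (p F.1)) e
        (x : 𝓣.mortarSet e),
        flux (diffusionSystem κ) x (𝓣.normal F) (vec (coes s) x) (vec (coes u) x) (tvec (uh e) x) ⬝ᵥ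
          vec (coes v) x = numFlux F s u uh e x * ev (v 0).1 x := by
      intro F s u v e x
      rw [flux_diffusionSystem κ _ (𝓣.norm_normal F)]
      simp [dotProduct, vec_apply, numFlux, normalTrace]
    have h2' : ∀ i e (x : 𝓣.mortarSet e),
        flux (diffusionSystem κ) x (𝓣.normal ⟨K, i⟩) (vec (coes s) x) (vec (coes u) x)
          (tvec (uh e) x) ⬝ᵥ vec (coes v) x = numFlux ⟨K, i⟩ s u uh e x * ev (v 0).1 x :=
      fun i e x => h2 ⟨K, i⟩ s u v e x
    simp only [h1, h2', hG, toBlocks_fromBlocks₂₁, toBlocks_fromBlocks₂₂, zero_mulVec, add_zero,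
      Mesh.boundaryIntegral, form₂, zero_dotProduct, integral_zero]

theorem jumpIntegral_diffusionSystem (s : VolSpace 𝓣 p (Fin d)) (u : VolSpace 𝓣 p (Fin 1))
    (uh : TraceSpace 𝓣 p (Fin 1)) (e : 𝓣.Mortar)
    (vh : Fin 1 → polyOn (𝓣.mortarDegree p e) (𝓣.mortarSet e)) :
    jumpIntegral (diffusionSystem κ) 𝓣 p s u uh e vh = jumpForm 𝓣 p s u uh e vh := by
  unfold jumpIntegral jumpForm
  refine integral_congr_ae (ae_of_all _ fun x => ?_)
  simp only [flux_diffusionSystem κ _ (𝓣.norm_normal _)]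
  simp [dotProduct, numFlux, normalTrace, vec_apply]

end Forms

/-! ## Integrability -/

section Integrability

variable {d : ℕ} {Ω : Set (E d)} {𝓣 : Mesh Ω}

instance isFiniteMeasure_carrier (K : Element d) : IsFiniteMeasure (volume.restrict K.carrier) :=
  ⟨by rw [Measure.restrict_apply_univ]; exact K.isBounded_carrier.measure_lt_top⟩

theorem Element.memLp_top (K : Element d) {f : E d → ℝ} (hf : Continuous f) :
    MemLp f ⊤ (volume.restrict K.carrier) := by
  obtain ⟨M, hM⟩ := K.isCompact_closure.exists_bound_of_continuousOn hf.continuousOn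
  refine memLp_top_of_bound hf.aestronglyMeasurable M ?_
  exact (ae_restrict_mem K.isOpen_carrier.measurableSet).mono fun x hx => hM x (subset_closure hx)

theorem Element.integrable (K : Element d) {f : E d → ℝ} (hf : Continuous f) :
    Integrable f (volume.restrict K.carrier) := (K.memLp_top hf).integrable le_top

namespace Mesh

theorem map_mortarMeasure (e : 𝓣.Mortar) :
    Measure.map Subtype.val (𝓣.mortarMeasure e) = (surf d).restrict (𝓣.mortarSet e) := by
  rw [mortarMeasure, map_comap_subtype_coe (measurableSet_mortarSet e)]

theorem ae_mortarMeasure_iff {e : 𝓣.Mortar} {P : E d → Prop} :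
    (∀ᵐ x : 𝓣.mortarSet e ∂𝓣.mortarMeasure e, P x) ↔ ∀ᵐ x ∂(surf d).restrict (𝓣.mortarSet e), P x := by
  rw [← map_mortarMeasure, (MeasurableEmbedding.subtype_coe (measurableSet_mortarSet e)).ae_map_iff]

theorem isFiniteMeasure_mortarMeasure (hd : 0 < d) (e : 𝓣.Mortar) :
    IsFiniteMeasure (𝓣.mortarMeasure e) := by
  refine ⟨?_⟩
  have h := congrArg (fun μ => μ Set.univ) (map_mortarMeasure e)
  simp only [Measure.restrict_apply_univ] at h
  rw [Measure.map_apply measurable_subtype_coe MeasurableSet.univ, Set.preimage_univ] at h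
  rw [h]
  exact surf_mortarSet_lt_top hd e

theorem mortarMeasure_ne_zero (e : 𝓣.Mortar) : 𝓣.mortarMeasure e ≠ 0 := by
  intro h
  have h1 := map_mortarMeasure e
  rw [h, Measure.map_zero] at h1
  exact surf_mortarSet_ne_zero e (Measure.restrict_eq_zero.1 h1.symm)

theorem memLp_top_mortar (e : 𝓣.Mortar) {f : 𝓣.mortarSet e → ℝ} (hf : Continuous f) :
    MemLp f ⊤ (𝓣.mortarMeasure e) := by
  have : CompactSpace (𝓣.mortarSet e) := isCompact_iff_compactSpace.1
    (Metric.isCompact_of_isClosed_isBounded (isClosed_mortarSet e) (isBounded_mortarSet e))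
  obtain ⟨M, hM⟩ := isCompact_univ.exists_bound_of_continuousOn hf.continuousOn
  exact memLp_top_of_bound hf.aestronglyMeasurable M (ae_of_all _ fun x => hM x (Set.mem_univ x))

theorem integrable_mortar (hd : 0 < d) (e : 𝓣.Mortar) {f : 𝓣.mortarSet e → ℝ}
    (hf : Continuous f) : Integrable f (𝓣.mortarMeasure e) := by
  have := isFiniteMeasure_mortarMeasure hd e
  exact (memLp_top_mortar e hf).integrable le_top

theorem memLp_mortar {e : 𝓣.Mortar} {f : E d → ℝ} {r : ENNReal}
    (hf : MemLp f r ((surf d).restrict (𝓣.mortarSet e))) :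
    MemLp (fun x : 𝓣.mortarSet e => f x) r (𝓣.mortarMeasure e) := by
  rw [← map_mortarMeasure] at hf
  exact ((MeasurableEmbedding.subtype_coe (measurableSet_mortarSet e)).memLp_map_measure_iff).1 hf

theorem LiesOn.restrict_le {e : 𝓣.Mortar} {S : Set (E d)} (h : 𝓣.LiesOn e S) :
    (surf d).restrict (𝓣.mortarSet e) ≤ (surf d).restrict S := by
  refine Measure.restrict_mono' ?_ le_rfl
  rw [LiesOn, measure_eq_zero_iff_ae_notMem] at h
  filter_upwards [h] with x hx hxe
  by_contra hxS
  exact hx ⟨hxe, hxS⟩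

theorem LiesOn.ae_mem {e : 𝓣.Mortar} {S : Set (E d)} (h : 𝓣.LiesOn e S) :
    ∀ᵐ x : 𝓣.mortarSet e ∂𝓣.mortarMeasure e, (x : E d) ∈ S := by
  rw [ae_mortarMeasure_iff, ae_restrict_iff' (measurableSet_mortarSet e)]
  rw [LiesOn, measure_eq_zero_iff_ae_notMem] at h
  filter_upwards [h] with x hx hxe
  by_contra hxS
  exact hx ⟨hxe, hxS⟩

end Mesh

end Integrability

/-! ## Bilinear forms and square linear systems -/

section Bilinear

variable {V V' : Type*} [AddCommGroup V] [Module ℝ V] [AddCommGroup V'] [Module ℝ V']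

/-- A real function of two vector variables is bilinear. -/
def IsBilin (F : V → V' → ℝ) : Prop := ∃ B : V →ₗ[ℝ] V' →ₗ[ℝ] ℝ, ∀ v v', B v v' = F v v'

theorem IsBilin.add {F G : V → V' → ℝ} (hF : IsBilin F) (hG : IsBilin G) :
    IsBilin fun v v' => F v v' + G v v' := by
  obtain ⟨B, hB⟩ := hF
  obtain ⟨C, hC⟩ := hG
  exact ⟨B + C, fun v v' => by simp [hB, hC]⟩

theorem IsBilin.neg {F : V → V' → ℝ} (hF : IsBilin F) : IsBilin fun v v' => -F v v' := by
  obtain ⟨B, hB⟩ := hF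
  exact ⟨-B, fun v v' => by simp [hB]⟩

theorem IsBilin.sub {F G : V → V' → ℝ} (hF : IsBilin F) (hG : IsBilin G) :
    IsBilin fun v v' => F v v' - G v v' := by
  simpa only [sub_eq_add_neg] using hF.add hG.neg

theorem IsBilin.sum {ι : Type*} {I : Finset ι} {F : ι → V → V' → ℝ} (hF : ∀ i ∈ I, IsBilin (F i)) :
    IsBilin fun v v' => ∑ i ∈ I, F i v v' := by
  classical
  induction I using Finset.induction_on with
  | empty => exact ⟨0, by simp⟩
  | insert i I hi ih =>
    simp only [Finset.sum_insert hi]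
    exact (hF i (Finset.mem_insert_self _ _)).add
      (ih fun j hj => hF j (Finset.mem_insert_of_mem hj))

/-- Essential boundedness of all three factors on a finite measure space makes the products
integrable, so the integral splits. -/
theorem isBilin_integral {α : Type*} [MeasurableSpace α] {μ : Measure α} [IsFiniteMeasure μ]
    {w : α → ℝ} (hw : MemLp w ⊤ μ) (P : V →ₗ[ℝ] α → ℝ) (hP : ∀ v, MemLp (P v) ⊤ μ)
    (Q : V' →ₗ[ℝ] α → ℝ) (hQ : ∀ v, MemLp (Q v) ⊤ μ) :
    IsBilin fun v v' => ∫ x, w x * P v x * Q v' x ∂μ := by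
  have hint : ∀ v v', Integrable (fun x => w x * P v x * Q v' x) μ := fun v v' =>
    (((hQ v').mul ((hP v).mul hw (r := ⊤)) (r := ⊤)).integrable le_top)
  refine ⟨LinearMap.mk₂ ℝ (fun v v' => ∫ x, w x * P v x * Q v' x ∂μ) ?_ ?_ ?_ ?_, fun _ _ => rfl⟩
  · intro v₁ v₂ v'
    rw [← integral_add (hint _ _) (hint _ _)]
    exact integral_congr_ae (ae_of_all _ fun x => by simp only [map_add, Pi.add_apply]; ring)
  · intro c v v'
    rw [smul_eq_mul, ← integral_const_mul]
    exact integral_congr_ae (ae_of_all _ fun x => by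
      simp only [map_smul, Pi.smul_apply, smul_eq_mul]; ring)
  · intro v v₁ v₂
    rw [← integral_add (hint _ _) (hint _ _)]
    exact integral_congr_ae (ae_of_all _ fun x => by simp only [map_add, Pi.add_apply]; ring)
  · intro c v v'
    rw [smul_eq_mul, ← integral_const_mul]
    exact integral_congr_ae (ae_of_all _ fun x => by
      simp only [map_smul, Pi.smul_apply, smul_eq_mul]; ring)

theorem isBilin_integral_one {α : Type*} [MeasurableSpace α] {μ : Measure α} [IsFiniteMeasure μ]
    (P : V →ₗ[ℝ] α → ℝ) (hP : ∀ v, MemLp (P v) ⊤ μ)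
    (Q : V' →ₗ[ℝ] α → ℝ) (hQ : ∀ v, MemLp (Q v) ⊤ μ) :
    IsBilin fun v v' => ∫ x, P v x * Q v' x ∂μ := by
  simpa using isBilin_integral (memLp_top_const (1 : ℝ)) P hP Q hQ

theorem exists_dual_integral {α : Type*} [MeasurableSpace α] {μ : Measure α}
    {f : α → ℝ} (hf : Integrable f μ) (Q : V' →ₗ[ℝ] α → ℝ) (hQ : ∀ v, MemLp (Q v) ⊤ μ) :
    ∃ ℓ : Module.Dual ℝ V', ∀ v, ℓ v = ∫ x, f x * Q v x ∂μ := by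
  have hint : ∀ v, Integrable (fun x => f x * Q v x) μ := fun v =>
    (memLp_one_iff_integrable.2 hf).integrable_mul (hQ v)
  refine ⟨{ toFun := fun v => ∫ x, f x * Q v x ∂μ, map_add' := ?_, map_smul' := ?_ }, fun _ => rfl⟩
  · intro v₁ v₂
    rw [← integral_add (hint _) (hint _)]
    exact integral_congr_ae (ae_of_all _ fun x => by simp only [map_add, Pi.add_apply]; ring)
  · intro c v
    rw [RingHom.id_apply, smul_eq_mul, ← integral_const_mul]
    exact integral_congr_ae (ae_of_all _ fun x => by
      simp only [map_smul, Pi.smul_apply, smul_eq_mul]; ring)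

theorem existsUnique_of_finrank_eq {W W' : Type*} [AddCommGroup W] [Module ℝ W] [AddCommGroup W']
    [Module ℝ W'] [FiniteDimensional ℝ W] [FiniteDimensional ℝ W']
    (h : Module.finrank ℝ W = Module.finrank ℝ W') (A : W →ₗ[ℝ] W') (hA : ∀ w, A w = 0 → w = 0)
    (b : W') : ∃! w, A w = b := by
  have hinj : Function.Injective A := (injective_iff_map_eq_zero A).2 hA
  obtain ⟨w, hw⟩ := (LinearMap.injective_iff_surjective_of_finrank_eq_finrank h).1 hinj b
  exact ⟨w, hw, fun w' hw' => hinj (hw'.trans hw.symm)⟩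

end Bilinear

/-! ## Linearity of the scheme -/

section Linearity

variable {d : ℕ} {Ω : Set (E d)} {κ : E d → Matrix (Fin d) (Fin d) ℝ} {𝓣 : Mesh Ω}
  {p : Fin 𝓣.N → ℕ}

/-- Values of a component of a polynomial vector. -/
def evLin {ι : Type} (r : ℕ) (i : ι) : (ι → Poly d r) →ₗ[ℝ] E d → ℝ where
  toFun t := ev (t i).1
  map_add' t t' := by ext x; simp
  map_smul' c t := by ext x; simp

/-- Values of a partial derivative of a component of a polynomial vector. -/
def dervLin {ι : Type} (r : ℕ) (i : ι) (k : Fin d) : (ι → Poly d r) →ₗ[ℝ] E d → ℝ where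
  toFun t := ev (MvPolynomial.pderiv k (t i).1)
  map_add' t t' := by ext x; simp
  map_smul' c t := by ext x; simp

/-- Values on a mortar of a component of a polynomial vector. -/
def evMortarLin {ι : Type} (r : ℕ) (i : ι) (e : 𝓣.Mortar) :
    (ι → Poly d r) →ₗ[ℝ] 𝓣.mortarSet e → ℝ where
  toFun t x := ev (t i).1 x
  map_add' t t' := by ext x; simp
  map_smul' c t := by ext x; simp

/-- Values on a mortar of the normal component of a polynomial vector. -/
def normalTraceLin (r : ℕ) (F : 𝓣.Face) (e : 𝓣.Mortar) :
    (Fin d → Poly d r) →ₗ[ℝ] 𝓣.mortarSet e → ℝ where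
  toFun t x := normalTrace (𝓣.normal F) (coes t) x
  map_add' t t' := by
    ext x
    change ∑ i, 𝓣.normal F i * ev ((t i).1 + (t' i).1) x = _
    simp only [ev_add, mul_add, Finset.sum_add_distrib]
    rfl
  map_smul' c t := by
    ext x
    change ∑ i, 𝓣.normal F i * ev (c • (t i).1) x = c * ∑ i, 𝓣.normal F i * ev (t i).1 x
    rw [Finset.mul_sum]
    exact Finset.sum_congr rfl fun i _ => by rw [ev_smul]; ring

/-- Values of a trace field on one mortar. -/
def traceLin (p : Fin 𝓣.N → ℕ) (e : 𝓣.Mortar) :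
    (Fin 1 → polyOn (𝓣.mortarDegree p e) (𝓣.mortarSet e)) →ₗ[ℝ] 𝓣.mortarSet e → ℝ where
  toFun vh := (vh 0).1
  map_add' _ _ := rfl
  map_smul' _ _ := rfl

/-- The unknowns that enter the local equations on an element. -/
abbrev LocalSpace (𝓣 : Mesh Ω) (p : Fin 𝓣.N → ℕ) (K : Fin 𝓣.N) : Type :=
  (Fin d → Poly d (p K)) × (Fin 1 → Poly d (p K)) × TraceSpace 𝓣 p (Fin 1)

/-- The first volume unknown. -/
def fluxPart (𝓣 : Mesh Ω) (p : Fin 𝓣.N → ℕ) (K : Fin 𝓣.N) :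
    LocalSpace 𝓣 p K →ₗ[ℝ] Fin d → Poly d (p K) :=
  LinearMap.fst ℝ _ _

/-- The second volume unknown. -/
def scalarPart (𝓣 : Mesh Ω) (p : Fin 𝓣.N → ℕ) (K : Fin 𝓣.N) :
    LocalSpace 𝓣 p K →ₗ[ℝ] Fin 1 → Poly d (p K) :=
  (LinearMap.fst ℝ _ (TraceSpace 𝓣 p (Fin 1))).comp (LinearMap.snd ℝ (Fin d → Poly d (p K)) _)

/-- The values of the trace unknown on a mortar. -/
def tracePart (𝓣 : Mesh Ω) (p : Fin 𝓣.N → ℕ) (K : Fin 𝓣.N) (e : 𝓣.Mortar) :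
    LocalSpace 𝓣 p K →ₗ[ℝ] 𝓣.mortarSet e → ℝ where
  toFun w := (w.2.2 e 0).1
  map_add' _ _ := rfl
  map_smul' _ _ := rfl

/-- The numerical flux as a linear map. -/
def numFluxLin (p : Fin 𝓣.N → ℕ) (F : 𝓣.Face) (e : 𝓣.Mortar) :
    LocalSpace 𝓣 p F.1 →ₗ[ℝ] 𝓣.mortarSet e → ℝ :=
  (normalTraceLin _ F e).comp (fluxPart 𝓣 p F.1) +
    ((evMortarLin _ 0 e).comp (scalarPart 𝓣 p F.1) - tracePart 𝓣 p F.1 e)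

theorem continuous_trace {e : 𝓣.Mortar}
    (vh : Fin 1 → polyOn (𝓣.mortarDegree p e) (𝓣.mortarSet e)) : Continuous (vh 0).1 :=
  polyOn.continuous _

theorem continuous_numFlux (F : 𝓣.Face) (s : Fin d → Poly d (p F.1))
    (u : Fin 1 → Poly d (p F.1)) (uh : TraceSpace 𝓣 p (Fin 1)) (e : 𝓣.Mortar) :
    Continuous (numFlux F s u uh e) :=
  ((continuous_normalTrace _ _).comp continuous_subtype_val).add
    (((continuous_ev _).comp continuous_subtype_val).sub (continuous_trace (uh e)))

theorem IsDiffusivity.memLp_inv_carrier (hκ : IsDiffusivity Ω κ)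
    (hΩr : interior (closure Ω) = Ω) (K : Fin 𝓣.N) (i j : Fin d) :
    MemLp (fun x => (κ x)⁻¹ i j) ⊤ (volume.restrict (𝓣.elem K).carrier) :=
  (hκ.memLp_inv i j).mono_measure (Measure.restrict_mono (Mesh.carrier_subset hΩr K) le_rfl)

theorem integral_inv_eq_sum (hκ : IsDiffusivity Ω κ) (hΩr : interior (closure Ω) = Ω)
    (K : Fin 𝓣.N) (s t : Fin d → MvPolynomial (Fin d) ℝ) :
    ∫ x in (𝓣.elem K).carrier, ((κ x)⁻¹ *ᵥ vec s x) ⬝ᵥ vec t x =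
      ∑ i, ∑ j, ∫ x in (𝓣.elem K).carrier, (κ x)⁻¹ i j * ev (s j) x * ev (t i) x := by
  have hint : ∀ i j, Integrable (fun x => (κ x)⁻¹ i j * ev (s j) x * ev (t i) x)
      (volume.restrict (𝓣.elem K).carrier) := fun i j => by
    have h := ((𝓣.elem K).memLp_top (continuous_ev (t i))).mul
      (((𝓣.elem K).memLp_top (continuous_ev (s j))).mul
        (hκ.memLp_inv_carrier hΩr K i j) (r := ⊤)) (r := ⊤)
    exact h.integrable le_top
  simp_rw [← integral_finsetSum _ fun j _ => hint _ j]
  rw [← integral_finsetSum _ fun i _ => integrable_finsetSum _ fun j _ => hint i j]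
  refine integral_congr_ae (ae_of_all _ fun x => ?_)
  simp only [mulVec, dotProduct, vec_apply, Finset.sum_mul]

theorem isBilin_form₁ (hd : 0 < d) (hκ : IsDiffusivity Ω κ) (hΩr : interior (closure Ω) = Ω)
    (K : Fin 𝓣.N) :
    IsBilin fun (w : LocalSpace 𝓣 p K)
      (t : Fin d → Poly d (p K)) => form₁ κ 𝓣 p K w.1 w.2.1 w.2.2 t := by
  have hfin := Mesh.isFiniteMeasure_mortarMeasure (𝓣 := 𝓣) hd
  unfold form₁
  refine IsBilin.add (IsBilin.add (IsBilin.neg (IsBilin.sum fun k _ => ?_)) ?_)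
    (IsBilin.sum fun i _ => IsBilin.sum fun e _ => ?_)
  · exact isBilin_integral_one
      ((evLin (p K) (0 : Fin 1)).comp (scalarPart 𝓣 p K))
      (fun w => (𝓣.elem K).memLp_top (continuous_ev _))
      (dervLin (p K) k k) (fun t => (𝓣.elem K).memLp_top (continuous_ev _))
  · simp_rw [integral_inv_eq_sum hκ hΩr]
    refine IsBilin.sum fun i _ => IsBilin.sum fun j _ => ?_
    exact isBilin_integral (hκ.memLp_inv_carrier hΩr K i j)
      ((evLin (p K) j).comp (fluxPart 𝓣 p K))
      (fun w => (𝓣.elem K).memLp_top (continuous_ev _))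
      (evLin (p K) i) (fun t => (𝓣.elem K).memLp_top (continuous_ev _))
  · exact isBilin_integral_one
      (tracePart 𝓣 p K e)
      (fun w : LocalSpace 𝓣 p K => Mesh.memLp_top_mortar e (continuous_trace (w.2.2 e)))
      (normalTraceLin (p K) ⟨K, i⟩ e)
      (fun t => Mesh.memLp_top_mortar e
        ((continuous_normalTrace _ _).comp continuous_subtype_val))

theorem isBilin_form₂ (hd : 0 < d) (K : Fin 𝓣.N) :
    IsBilin fun (w : LocalSpace 𝓣 p K)
      (v : Fin 1 → Poly d (p K)) => form₂ 𝓣 p K w.1 w.2.1 w.2.2 v := by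
  have hfin := Mesh.isFiniteMeasure_mortarMeasure (𝓣 := 𝓣) hd
  unfold form₂
  refine IsBilin.add (IsBilin.neg (IsBilin.sum fun k _ => ?_))
    (IsBilin.sum fun i _ => IsBilin.sum fun e _ => ?_)
  · exact isBilin_integral_one
      ((evLin (p K) k).comp (fluxPart 𝓣 p K))
      (fun w => (𝓣.elem K).memLp_top (continuous_ev _))
      (dervLin (p K) 0 k) (fun t => (𝓣.elem K).memLp_top (continuous_ev _))
  · exact isBilin_integral_one (numFluxLin p ⟨K, i⟩ e)
      (fun w => Mesh.memLp_top_mortar e (continuous_numFlux ⟨K, i⟩ w.1 w.2.1 w.2.2 e))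
      (evMortarLin (p K) 0 e)
      (fun t => Mesh.memLp_top_mortar e ((continuous_ev _).comp continuous_subtype_val))

theorem isBilin_jumpForm (hd : 0 < d) (e : 𝓣.Mortar) :
    IsBilin fun (w : VolSpace 𝓣 p (Fin d) × VolSpace 𝓣 p (Fin 1) × TraceSpace 𝓣 p (Fin 1))
      (vh : Fin 1 → polyOn (𝓣.mortarDegree p e) (𝓣.mortarSet e)) =>
        jumpForm 𝓣 p w.1 w.2.1 w.2.2 e vh := by
  have hfin := Mesh.isFiniteMeasure_mortarMeasure (𝓣 := 𝓣) hd
  let L : ∀ F : 𝓣.Face, (VolSpace 𝓣 p (Fin d) × VolSpace 𝓣 p (Fin 1) × TraceSpace 𝓣 p (Fin 1)) →ₗ[ℝ]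
      LocalSpace 𝓣 p F.1 := fun F =>
    (LinearMap.proj F.1).prodMap ((LinearMap.proj F.1).prodMap LinearMap.id)
  let P := ∑ F ∈ 𝓣.sides e, (numFluxLin p F e).comp (L F)
  have hP : ∀ w x, P w x = ∑ F ∈ 𝓣.sides e, numFlux F (w.1 F.1) (w.2.1 F.1) w.2.2 e x := by
    intro w x
    simp only [P, LinearMap.sum_apply, Finset.sum_apply]
    rfl
  have h := isBilin_integral_one (μ := 𝓣.mortarMeasure e) P
    (fun w => Mesh.memLp_top_mortar e (by
      rw [show P w = _ from funext (hP w)]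
      exact continuous_finsetSum _ fun F _ => continuous_numFlux F _ _ _ e))
    (traceLin p e) (fun vh => Mesh.memLp_top_mortar e (continuous_trace vh))
  simp_rw [hP] at h
  exact h

theorem exists_dual_volume {ι : Type} [Fintype ι] (hΩr : interior (closure Ω) = Ω) (K : Fin 𝓣.N)
    {f : E d → ι → ℝ} (hf : ∀ i, MemLp (fun x => f x i) 2 (volume.restrict Ω)) (r : ℕ) :
    ∃ ℓ : Module.Dual ℝ (ι → Poly d r), ∀ t,
      ℓ t = ∫ x in (𝓣.elem K).carrier, f x ⬝ᵥ vec (coes t) x := by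
  have hfi : ∀ i, Integrable (fun x => f x i) (volume.restrict (𝓣.elem K).carrier) := fun i =>
    ((hf i).mono_measure (Measure.restrict_mono (Mesh.carrier_subset hΩr K) le_rfl)).integrable
      (by norm_num)
  choose ℓ hℓ using fun i => exists_dual_integral (hfi i) (evLin (d := d) r i)
    fun t => (𝓣.elem K).memLp_top (continuous_ev _)
  refine ⟨∑ i, ℓ i, fun t => ?_⟩
  have hint : ∀ i, Integrable (fun x => f x i * ev (t i).1 x)
      (volume.restrict (𝓣.elem K).carrier) := fun i =>
    (memLp_one_iff_integrable.2 (hfi i)).integrable_mul ((𝓣.elem K).memLp_top (continuous_ev _))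
  rw [LinearMap.sum_apply]
  simp_rw [hℓ]
  exact (integral_finsetSum _ fun i _ => hint i).symm

theorem exists_dual_mortar (hd : 0 < d) (e : 𝓣.Mortar) {g : E d → Fin 1 → ℝ}
    (hg : MemLp (fun x => g x 0) 2 ((surf d).restrict (𝓣.mortarSet e))) :
    ∃ ℓ : Module.Dual ℝ (Fin 1 → polyOn (𝓣.mortarDegree p e) (𝓣.mortarSet e)), ∀ vh,
      ℓ vh = ∫ x : 𝓣.mortarSet e, g x 0 * (vh 0).1 x ∂𝓣.mortarMeasure e := by
  have hfin := Mesh.isFiniteMeasure_mortarMeasure (𝓣 := 𝓣) hd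
  exact exists_dual_integral ((Mesh.memLp_mortar hg).integrable (by norm_num)) (traceLin p e)
    fun vh => Mesh.memLp_top_mortar e (continuous_trace vh)

/-- The local equations are a square linear system. -/
theorem existsUnique_isLocalSolution (hd : 0 < d) (hκ : IsDiffusivity Ω κ)
    (hΩr : interior (closure Ω) = Ω) (K : Fin 𝓣.N)
    (huniq : ∀ (s : Fin d → Poly d (p K)) (u : Fin 1 → Poly d (p K)),
      (∀ t, form₁ κ 𝓣 p K s u 0 t = 0) → (∀ v, form₂ 𝓣 p K s u 0 v = 0) → s = 0 ∧ u = 0)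
    {f : E d → Fin d ⊕ Fin 1 → ℝ} (hf : ∀ i, MemLp (fun x => f x i) 2 (volume.restrict Ω))
    (uh : TraceSpace 𝓣 p (Fin 1)) :
    ∃! su : (Fin d → Poly d (p K)) × (Fin 1 → Poly d (p K)),
      IsLocalSolution (diffusionSystem κ) 𝓣 p f uh K su.1 su.2 := by
  obtain ⟨B₁, hB₁⟩ := isBilin_form₁ (p := p) hd hκ hΩr K
  obtain ⟨B₂, hB₂⟩ := isBilin_form₂ (p := p) hd K
  obtain ⟨ℓ₁, hℓ₁⟩ := exists_dual_volume (𝓣 := 𝓣) hΩr K (f := fun x i => f x (.inl i))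
    (fun i => hf _) (p K)
  obtain ⟨ℓ₂, hℓ₂⟩ := exists_dual_volume (𝓣 := 𝓣) hΩr K (f := fun x i => f x (.inr i))
    (fun i => hf _) (p K)
  -- The trace is given data, so the operator acts on volume unknowns with zero trace, and the
  -- contribution of `uh` moves to the right-hand side.
  let J : ((Fin d → Poly d (p K)) × (Fin 1 → Poly d (p K))) →ₗ[ℝ]
      LocalSpace 𝓣 p K :=
    (LinearMap.fst ℝ _ _).prod ((LinearMap.snd ℝ _ _).prod 0)
  let A := (B₁.comp J).prod (B₂.comp J)
  have hsplit : ∀ su : (Fin d → Poly d (p K)) × (Fin 1 → Poly d (p K)),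
      ((su.1, su.2, uh) : LocalSpace 𝓣 p K) =
        J su + (0, 0, uh) := by
    rintro ⟨s, u⟩
    simp [J]
  obtain ⟨su, hsu, huni⟩ := existsUnique_of_finrank_eq
    (W' := Module.Dual ℝ (Fin d → Poly d (p K)) × Module.Dual ℝ (Fin 1 → Poly d (p K)))
    (by simp only [Module.finrank_prod, Subspace.dual_finrank_eq]) A
    (fun su hsu => by
      have h1 : B₁ (J su) = 0 := congrArg Prod.fst hsu
      have h2 : B₂ (J su) = 0 := congrArg Prod.snd hsu
      obtain ⟨hs, hu⟩ := huniq su.1 su.2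
        (fun t => (hB₁ (J su) t).symm.trans (by rw [h1]; rfl))
        (fun v => (hB₂ (J su) v).symm.trans (by rw [h2]; rfl))
      exact Prod.ext hs hu)
    (ℓ₁ - B₁ (0, 0, uh), ℓ₂ - B₂ (0, 0, uh))
  have hiff : ∀ su : (Fin d → Poly d (p K)) × (Fin 1 → Poly d (p K)),
      IsLocalSolution (diffusionSystem κ) 𝓣 p f uh K su.1 su.2 ↔
        A su = (ℓ₁ - B₁ (0, 0, uh), ℓ₂ - B₂ (0, 0, uh)) := by
    intro su
    rw [isLocalSolution_diffusionSystem_iff, Prod.ext_iff]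
    refine and_congr ?_ ?_
    · change _ ↔ B₁ (J su) = ℓ₁ - B₁ (0, 0, uh)
      rw [eq_sub_iff_add_eq, ← map_add, ← hsplit, LinearMap.ext_iff]
      exact forall_congr' fun t => by rw [hB₁ (su.1, su.2, uh), hℓ₁]
    · change _ ↔ B₂ (J su) = ℓ₂ - B₂ (0, 0, uh)
      rw [eq_sub_iff_add_eq, ← map_add, ← hsplit, LinearMap.ext_iff]
      exact forall_congr' fun t => by rw [hB₂ (su.1, su.2, uh), hℓ₂]
  exact ⟨su, (hiff su).2 hsu, fun su' hsu' => huni su' ((hiff su').1 hsu')⟩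

end Linearity

/-! ## The energy identity -/

section Energy

variable {d : ℕ} {Ω : Set (E d)} {κ : E d → Matrix (Fin d) (Fin d) ℝ} {𝓣 : Mesh Ω}
  {p : Fin 𝓣.N → ℕ}

theorem volume_carrier_ne_zero (K : Element d) : volume K.carrier ≠ 0 :=
  (K.isOpen_carrier.measure_pos volume K.nonempty).ne'

/-- Integration by parts on an element. -/
theorem integral_mul_div_add (hd : 0 < d) (hΩo : IsOpen Ω) (hΩr : interior (closure Ω) = Ω)
    (K : Fin 𝓣.N) (u : MvPolynomial (Fin d) ℝ) (t : Fin d → MvPolynomial (Fin d) ℝ) :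
    (∑ k, ∫ x in (𝓣.elem K).carrier, ev u x * ev (MvPolynomial.pderiv k (t k)) x) +
      (∑ k, ∫ x in (𝓣.elem K).carrier, ev (t k) x * ev (MvPolynomial.pderiv k u) x) =
    ∑ i : Fin (𝓣.elem K).numFaces, ∑ e : 𝓣.Mortar with (⟨K, i⟩ : 𝓣.Face) ∈ 𝓣.sides e,
      ∫ x : 𝓣.mortarSet e, ev u x * normalTrace (𝓣.normal ⟨K, i⟩) t x ∂𝓣.mortarMeasure e := by
  have h : ∀ k, (∫ x in (𝓣.elem K).carrier, ev u x * ev (MvPolynomial.pderiv k (t k)) x) +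
      (∫ x in (𝓣.elem K).carrier, ev (t k) x * ev (MvPolynomial.pderiv k u) x) =
      𝓣.boundaryIntegral K (fun F _ x => 𝓣.normal F k * ev (u * t k) x) := by
    intro k
    rw [← integral_add ((𝓣.elem K).integrable (by fun_prop)) ((𝓣.elem K).integrable (by fun_prop))]
    refine Eq.trans (integral_congr_ae (ae_of_all _ fun x => ?_))
      (Mesh.integral_pderiv hd hΩo hΩr K k (u * t k))
    simp only [MvPolynomial.pderiv_mul, map_add, map_mul, ev]
    ring
  rw [← Finset.sum_add_distrib]
  simp_rw [h, Mesh.boundaryIntegral]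
  rw [Finset.sum_comm]
  refine Finset.sum_congr rfl fun i _ => ?_
  rw [Finset.sum_comm]
  refine Finset.sum_congr rfl fun e _ => ?_
  have hint : ∀ k, Integrable (fun x : 𝓣.mortarSet e => 𝓣.normal ⟨K, i⟩ k * ev (u * t k) x)
      (𝓣.mortarMeasure e) := fun k => Mesh.integrable_mortar hd e
    (continuous_const.mul ((continuous_ev _).comp continuous_subtype_val))
  rw [← integral_finsetSum _ fun k _ => hint k]
  refine integral_congr_ae (ae_of_all _ fun x => ?_)
  simp only [normalTrace, ev_mul, Finset.mul_sum]
  exact Finset.sum_congr rfl fun k _ => by ring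

/-- The sum of the local equations, tested with the solution. -/
theorem form₁_add_form₂ (hd : 0 < d) (hΩo : IsOpen Ω) (hΩr : interior (closure Ω) = Ω)
    (K : Fin 𝓣.N) (s : Fin d → Poly d (p K)) (u : Fin 1 → Poly d (p K))
    (uh : TraceSpace 𝓣 p (Fin 1)) :
    form₁ κ 𝓣 p K s u uh s + form₂ 𝓣 p K s u uh u =
      (∫ x in (𝓣.elem K).carrier, ((κ x)⁻¹ *ᵥ vec (coes s) x) ⬝ᵥ vec (coes s) x) +
      ∑ i : Fin (𝓣.elem K).numFaces, ∑ e : 𝓣.Mortar with (⟨K, i⟩ : 𝓣.Face) ∈ 𝓣.sides e,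
        ((∫ x, numFlux ⟨K, i⟩ s u uh e x * (uh e 0).1 x ∂𝓣.mortarMeasure e) +
          ∫ x : 𝓣.mortarSet e, (ev (u 0).1 x - (uh e 0).1 x) ^ 2 ∂𝓣.mortarMeasure e) := by
  have hG := integral_mul_div_add hd hΩo hΩr K (u 0).1 (coes s)
  -- Pointwise on a mortar, with q = σ·n + (u - û): q û + (u - û)² = û σ·n + q u - u σ·n. The last
  -- term is the one supplied by integration by parts.
  have hb : (∑ i : Fin (𝓣.elem K).numFaces, ∑ e : 𝓣.Mortar with (⟨K, i⟩ : 𝓣.Face) ∈ 𝓣.sides e,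
        ((∫ x, numFlux ⟨K, i⟩ s u uh e x * (uh e 0).1 x ∂𝓣.mortarMeasure e) +
          ∫ x : 𝓣.mortarSet e, (ev (u 0).1 x - (uh e 0).1 x) ^ 2 ∂𝓣.mortarMeasure e)) =
      (∑ i : Fin (𝓣.elem K).numFaces, ∑ e : 𝓣.Mortar with (⟨K, i⟩ : 𝓣.Face) ∈ 𝓣.sides e,
        ∫ x, (uh e 0).1 x * normalTrace (𝓣.normal ⟨K, i⟩) (coes s) x ∂𝓣.mortarMeasure e) +
      (∑ i : Fin (𝓣.elem K).numFaces, ∑ e : 𝓣.Mortar with (⟨K, i⟩ : 𝓣.Face) ∈ 𝓣.sides e,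
        ∫ x, numFlux ⟨K, i⟩ s u uh e x * ev (u 0).1 x ∂𝓣.mortarMeasure e) -
      ∑ i : Fin (𝓣.elem K).numFaces, ∑ e : 𝓣.Mortar with (⟨K, i⟩ : 𝓣.Face) ∈ 𝓣.sides e,
        ∫ x : 𝓣.mortarSet e, ev (u 0).1 x * normalTrace (𝓣.normal ⟨K, i⟩) (coes s) x
          ∂𝓣.mortarMeasure e := by
    rw [← Finset.sum_add_distrib, ← Finset.sum_sub_distrib]
    refine Finset.sum_congr rfl fun i _ => ?_
    rw [← Finset.sum_add_distrib, ← Finset.sum_sub_distrib]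
    refine Finset.sum_congr rfl fun e _ => ?_
    have c1 : Continuous fun x : 𝓣.mortarSet e => (uh e 0).1 x := continuous_trace (uh e)
    have c2 : Continuous fun x : 𝓣.mortarSet e => ev (u 0).1 x :=
      (continuous_ev _).comp continuous_subtype_val
    have c3 : Continuous fun x : 𝓣.mortarSet e => normalTrace (𝓣.normal ⟨K, i⟩) (coes s) x :=
      (continuous_normalTrace _ _).comp continuous_subtype_val
    have c4 : Continuous (numFlux ⟨K, i⟩ s u uh e) := continuous_numFlux ⟨K, i⟩ s u uh e
    have i1 := Mesh.integrable_mortar hd e (c4.fun_mul c1)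
    have i2 := Mesh.integrable_mortar hd e ((c2.fun_sub c1).fun_pow 2)
    have i3 := Mesh.integrable_mortar hd e (c1.fun_mul c3)
    have i4 := Mesh.integrable_mortar hd e (c4.fun_mul c2)
    have i5 := Mesh.integrable_mortar hd e (c2.fun_mul c3)
    rw [← integral_add i1 i2, ← integral_add i3 i4, ← integral_sub (i3.fun_add i4) i5]
    refine integral_congr_ae (ae_of_all _ fun x => ?_)
    simp only [numFlux]
    ring
  rw [hb, form₁, form₂, ← hG]
  ring

theorem integral_inv_nonneg {k₀ : ℝ} (hk₀ : 0 < k₀)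
    (hk : ∀ᵐ x ∂volume.restrict Ω, ∀ w, k₀ * (w ⬝ᵥ w) ≤ w ⬝ᵥ ((κ x)⁻¹ *ᵥ w))
    (hΩr : interior (closure Ω) = Ω) (K : Fin 𝓣.N) (s : Fin d → MvPolynomial (Fin d) ℝ) :
    0 ≤ ∫ x in (𝓣.elem K).carrier, ((κ x)⁻¹ *ᵥ vec s x) ⬝ᵥ vec s x := by
  refine integral_nonneg_of_ae ?_
  filter_upwards [ae_restrict_of_ae_restrict_of_subset (Mesh.carrier_subset hΩr K) hk] with x hx
  rw [dotProduct_comm]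
  exact (mul_nonneg hk₀.le (dotProduct_self_nonneg _)).trans (hx _)

/-- Coercivity of κ⁻¹ forces σ = 0 almost everywhere on an open set, and a polynomial that vanishes
there is the zero polynomial. -/
theorem eq_zero_of_integral_inv_eq_zero (hκ : IsDiffusivity Ω κ) {k₀ : ℝ} (hk₀ : 0 < k₀)
    (hk : ∀ᵐ x ∂volume.restrict Ω, ∀ w, k₀ * (w ⬝ᵥ w) ≤ w ⬝ᵥ ((κ x)⁻¹ *ᵥ w))
    (hΩr : interior (closure Ω) = Ω) (K : Fin 𝓣.N) {s : Fin d → MvPolynomial (Fin d) ℝ}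
    (hs : ∫ x in (𝓣.elem K).carrier, ((κ x)⁻¹ *ᵥ vec s x) ⬝ᵥ vec s x = 0) : s = 0 := by
  have hk' := ae_restrict_of_ae_restrict_of_subset (Mesh.carrier_subset hΩr K) hk
  have hpos : ∀ᵐ x ∂volume.restrict (𝓣.elem K).carrier,
      k₀ * (vec s x ⬝ᵥ vec s x) ≤ ((κ x)⁻¹ *ᵥ vec s x) ⬝ᵥ vec s x := by
    filter_upwards [hk'] with x hx
    rw [dotProduct_comm ((κ x)⁻¹ *ᵥ vec s x)]
    exact hx _
  have hint : Integrable (fun x => ((κ x)⁻¹ *ᵥ vec s x) ⬝ᵥ vec s x)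
      (volume.restrict (𝓣.elem K).carrier) := by
    simp only [dotProduct, mulVec, vec_apply]
    refine integrable_finsetSum _ fun i _ => ?_
    simp only [Finset.sum_mul]
    refine integrable_finsetSum _ fun j _ => ?_
    exact (((𝓣.elem K).memLp_top (continuous_ev (s i))).mul
      (((𝓣.elem K).memLp_top (continuous_ev (s j))).mul
        (hκ.memLp_inv_carrier hΩr K i j) (r := ⊤)) (r := ⊤)).integrable le_top
  have h0 := (integral_eq_zero_iff_of_nonneg_ae (hpos.mono fun x hx =>
    (mul_nonneg hk₀.le (dotProduct_self_nonneg _)).trans hx) hint).1 hs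
  funext i
  refine eq_zero_of_ae_eval_eq_zero (volume_carrier_ne_zero (𝓣.elem K)) ?_
  filter_upwards [hpos, h0] with x hx hx0
  have h1 : vec s x ⬝ᵥ vec s x = 0 := by
    have : k₀ * (vec s x ⬝ᵥ vec s x) ≤ 0 := hx.trans_eq hx0
    exact le_antisymm (nonpos_of_mul_nonpos_right this hk₀) (dotProduct_self_nonneg _)
  exact congrFun (dotProduct_self_eq_zero.1 h1) i

/-- If the flux vanishes and the traces match, the first local equation makes the scalar unknown
constant. -/
theorem exists_eq_C_of_form₁ (hd : 0 < d) (hΩo : IsOpen Ω) (hΩr : interior (closure Ω) = Ω)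
    (K : Fin 𝓣.N) {u : Fin 1 → Poly d (p K)} {uh : TraceSpace 𝓣 p (Fin 1)}
    (h : ∀ t, form₁ κ 𝓣 p K 0 u uh t = 0)
    (hu : ∀ i e, (⟨K, i⟩ : 𝓣.Face) ∈ 𝓣.sides e →
      ∀ᵐ x : 𝓣.mortarSet e ∂𝓣.mortarMeasure e, ev (u 0).1 x = (uh e 0).1 x) :
    ∃ c, (u 0).1 = MvPolynomial.C c := by
  -- The test field ∇u, whose degree does not exceed p_K.
  let t : Fin d → Poly d (p K) := fun k => ⟨MvPolynomial.pderiv k (u 0).1,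
    (MvPolynomial.mem_restrictTotalDegree _ _ _).2 ((totalDegree_pderiv_le _ k).trans
      ((MvPolynomial.mem_restrictTotalDegree _ _ _).1 (u 0).2))⟩
  have ht := h t
  have hG := integral_mul_div_add hd hΩo hΩr K (u 0).1 (coes t)
  have hz : ∫ x in (𝓣.elem K).carrier,
      ((κ x)⁻¹ *ᵥ vec (coes (0 : Fin d → Poly d (p K))) x) ⬝ᵥ vec (coes t) x = 0 := by
    have : ∀ x : E d, vec (coes (0 : Fin d → Poly d (p K))) x = 0 := fun x =>
      funext fun i => ev_zero x
    simp [this]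
  have hb : (∑ i : Fin (𝓣.elem K).numFaces, ∑ e : 𝓣.Mortar with (⟨K, i⟩ : 𝓣.Face) ∈ 𝓣.sides e,
        ∫ x, (uh e 0).1 x * normalTrace (𝓣.normal ⟨K, i⟩) (coes t) x ∂𝓣.mortarMeasure e) =
      ∑ i : Fin (𝓣.elem K).numFaces, ∑ e : 𝓣.Mortar with (⟨K, i⟩ : 𝓣.Face) ∈ 𝓣.sides e,
        ∫ x : 𝓣.mortarSet e, ev (u 0).1 x * normalTrace (𝓣.normal ⟨K, i⟩) (coes t) x
          ∂𝓣.mortarMeasure e := by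
    refine Finset.sum_congr rfl fun i _ => Finset.sum_congr rfl fun e he => ?_
    refine integral_congr_ae ((hu i e (Finset.mem_filter.1 he).2).mono fun x hx => ?_)
    simp only [hx]
  -- With û replaced by u, integration by parts turns -(u, ∇·t) + ⟨û, t·n⟩ into (∇u, t) = ‖∇u‖².
  rw [form₁, hz, hb, ← hG, add_zero, neg_add_cancel_left] at ht
  have hnn : ∀ k ∈ Finset.univ, 0 ≤ ∫ x in (𝓣.elem K).carrier,
      ev (coes t k) x * ev (MvPolynomial.pderiv k (u 0).1) x := fun k _ =>
    integral_nonneg fun x => mul_self_nonneg (ev (MvPolynomial.pderiv k (u 0).1) x)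
  refine eq_C_of_pderiv_eq_zero fun k => ?_
  have hk := (Finset.sum_eq_zero_iff_of_nonneg hnn).1 ht k (Finset.mem_univ k)
  have h0 := (integral_eq_zero_iff_of_nonneg
    (fun x => mul_self_nonneg (ev (MvPolynomial.pderiv k (u 0).1) x))
    ((𝓣.elem K).integrable (by fun_prop))).1 hk
  exact eq_zero_of_ae_eval_eq_zero (volume_carrier_ne_zero (𝓣.elem K))
    (h0.mono fun x hx => mul_self_eq_zero.1 hx)

/-- The divergence theorem applied to a coordinate function: an element without mortars would have
zero volume. -/
theorem Mesh.exists_mortar (hd : 0 < d) (hΩo : IsOpen Ω) (hΩr : interior (closure Ω) = Ω)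
    (K : Fin 𝓣.N) : ∃ (i : Fin (𝓣.elem K).numFaces) (e : 𝓣.Mortar), (⟨K, i⟩ : 𝓣.Face) ∈ 𝓣.sides e := by
  by_contra! hne
  have h := Mesh.integral_pderiv hd hΩo hΩr K ⟨0, hd⟩ (MvPolynomial.X ⟨0, hd⟩)
  have h0 : ∀ f, 𝓣.boundaryIntegral K f = 0 := fun f =>
    Finset.sum_eq_zero fun i _ => Finset.sum_eq_zero fun e he =>
      absurd (Finset.mem_filter.1 he).2 (hne i e)
  rw [h0] at h
  simp only [MvPolynomial.pderiv_X_self, map_one, integral_const, smul_eq_mul, mul_one,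
    measureReal_restrict_apply_univ] at h
  exact volume_carrier_ne_zero (𝓣.elem K)
    ((measureReal_eq_zero_iff (𝓣.elem K).isBounded_carrier.measure_lt_top.ne).1 h)

theorem Mesh.exists_of_ae (e : 𝓣.Mortar) {P : 𝓣.mortarSet e → Prop}
    (h : ∀ᵐ x : 𝓣.mortarSet e ∂𝓣.mortarMeasure e, P x) : ∃ x, P x := by
  have : (ae (𝓣.mortarMeasure e)).NeBot := ae_neBot.2 (Mesh.mortarMeasure_ne_zero e)
  exact h.exists

theorem Mesh.ae_eq_zero_of_integral_sq (hd : 0 < d) (e : 𝓣.Mortar) {f : 𝓣.mortarSet e → ℝ}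
    (hf : Continuous f) (h : ∫ x, f x ^ 2 ∂𝓣.mortarMeasure e = 0) :
    ∀ᵐ x : 𝓣.mortarSet e ∂𝓣.mortarMeasure e, f x = 0 :=
  ((integral_eq_zero_iff_of_nonneg (fun _ => sq_nonneg _)
    (Mesh.integrable_mortar hd e (hf.pow 2))).1 h).mono fun _ hx => (pow_eq_zero_iff two_ne_zero).1 hx

theorem scalar_eq_zero {r : ℕ} {u : Fin 1 → Poly d r} (h : (u 0).1 = MvPolynomial.C 0) : u = 0 := by
  funext j
  rw [Subsingleton.elim j 0]
  exact Subtype.ext (h.trans (map_zero _))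

/-- With û = 0 the energy identity is (κ⁻¹σ, σ) + ‖u‖² = 0, the norm being over the boundary. So σ =
0, u is constant on the element, and the constant vanishes on a mortar. -/
theorem eq_zero_of_local_homogeneous (hd : 0 < d) (hκ : IsDiffusivity Ω κ) (hΩo : IsOpen Ω)
    (hΩr : interior (closure Ω) = Ω) (K : Fin 𝓣.N) (s : Fin d → Poly d (p K))
    (u : Fin 1 → Poly d (p K)) (h₁ : ∀ t, form₁ κ 𝓣 p K s u 0 t = 0)
    (h₂ : ∀ v, form₂ 𝓣 p K s u 0 v = 0) : s = 0 ∧ u = 0 := by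
  obtain ⟨k₀, hk₀, hk⟩ := hκ.exists_inv_coercive
  have hE := form₁_add_form₂ (κ := κ) hd hΩo hΩr K s u 0
  have h0 : ∀ (e : 𝓣.Mortar) (x : 𝓣.mortarSet e),
      ((0 : TraceSpace 𝓣 p (Fin 1)) e 0).1 x = 0 := fun _ _ => rfl
  simp only [h₁, h₂, h0, mul_zero, integral_zero, sub_zero, zero_add, add_zero] at hE
  have hnn : ∀ (i : Fin (𝓣.elem K).numFaces), ∀ e ∈ Finset.univ.filter
      (fun e : 𝓣.Mortar => (⟨K, i⟩ : 𝓣.Face) ∈ 𝓣.sides e),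
      0 ≤ ∫ x : 𝓣.mortarSet e, ev (u 0).1 x ^ 2 ∂𝓣.mortarMeasure e :=
    fun i e _ => integral_nonneg fun _ => sq_nonneg _
  have hnn' := fun i => Finset.sum_nonneg (hnn i)
  have hv := integral_inv_nonneg hk₀ hk hΩr K (coes s)
  have hsum := Finset.sum_nonneg fun i (_ : i ∈ Finset.univ) => hnn' i
  have hs0 : coes s = 0 := eq_zero_of_integral_inv_eq_zero hκ hk₀ hk hΩr K (by linarith)
  have hs : s = 0 := funext fun i => Subtype.ext (congrFun hs0 i)
  subst hs
  have hsum0 := (Finset.sum_eq_zero_iff_of_nonneg fun i (_ : i ∈ Finset.univ) => hnn' i).1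
    (by linarith : (∑ i : Fin (𝓣.elem K).numFaces,
      ∑ e : 𝓣.Mortar with (⟨K, i⟩ : 𝓣.Face) ∈ 𝓣.sides e,
        ∫ x : 𝓣.mortarSet e, ev (u 0).1 x ^ 2 ∂𝓣.mortarMeasure e) = 0)
  have hu : ∀ i e, (⟨K, i⟩ : 𝓣.Face) ∈ 𝓣.sides e →
      ∀ᵐ x : 𝓣.mortarSet e ∂𝓣.mortarMeasure e, ev (u 0).1 x = 0 := fun i e he =>
    Mesh.ae_eq_zero_of_integral_sq hd e ((continuous_ev _).comp continuous_subtype_val)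
      ((Finset.sum_eq_zero_iff_of_nonneg (hnn i)).1 (hsum0 i (Finset.mem_univ i)) e
        (Finset.mem_filter.2 ⟨Finset.mem_univ e, he⟩))
  obtain ⟨c, hc⟩ := exists_eq_C_of_form₁ hd hΩo hΩr K h₁ hu
  obtain ⟨i, e, he⟩ := Mesh.exists_mortar hd hΩo hΩr K
  obtain ⟨x, hx⟩ := Mesh.exists_of_ae e (hu i e he)
  rw [hc, ev_C] at hx
  exact ⟨rfl, scalar_eq_zero (by rw [hc, hx])⟩

theorem locallyWellPosed_diffusionSystem (hd : 0 < d) (hκ : IsDiffusivity Ω κ) (hΩo : IsOpen Ω)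
    (hΩr : interior (closure Ω) = Ω) : LocallyWellPosed (diffusionSystem κ) 𝓣 p :=
  fun _ hf uh K => existsUnique_isLocalSolution hd hκ hΩr K
    (eq_zero_of_local_homogeneous hd hκ hΩo hΩr K) hf uh

end Energy

/-! ## The global problem -/

section Global

variable {d : ℕ} {Ω : Set (E d)} {κ : E d → Matrix (Fin d) (Fin d) ℝ} {𝓣 : Mesh Ω}
  {p : Fin 𝓣.N → ℕ} {Γ : BoundaryParts Ω} {ρ : E d → ℝ}

open scoped Classical in
/-- The left hand side of the conservation and boundary conditions. -/
def mortarForm (𝓣 : Mesh Ω) (p : Fin 𝓣.N → ℕ) (Γ : BoundaryParts Ω) (ρ : E d → ℝ)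
    (w : VolSpace 𝓣 p (Fin d) × VolSpace 𝓣 p (Fin 1) × TraceSpace 𝓣 p (Fin 1)) :
    (e : 𝓣.Mortar) → (Fin 1 → polyOn (𝓣.mortarDegree p e) (𝓣.mortarSet e)) → ℝ
  | .inl q, vh => jumpForm 𝓣 p w.1 w.2.1 w.2.2 (.inl q) vh
  | .inr F, vh =>
    if 𝓣.LiesOn (.inr F) Γ.D then
      ∫ x, (w.2.2 (.inr F) 0).1 x * (vh 0).1 x ∂𝓣.mortarMeasure (.inr F)
    else jumpForm 𝓣 p w.1 w.2.1 w.2.2 (.inr F) vh -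
      ∫ x : 𝓣.mortarSet (.inr F), ρ x * (w.2.2 (.inr F) 0).1 x * (vh 0).1 x
        ∂𝓣.mortarMeasure (.inr F)

open scoped Classical in
/-- The right hand side of the conservation and boundary conditions. -/
def mortarData (𝓣 : Mesh Ω) (p : Fin 𝓣.N → ℕ) (Γ : BoundaryParts Ω) (g : E d → Fin 1 → ℝ) :
    (e : 𝓣.Mortar) → (Fin 1 → polyOn (𝓣.mortarDegree p e) (𝓣.mortarSet e)) → ℝ
  | .inl _, _ => 0
  | .inr F, vh =>
    if 𝓣.LiesOn (.inr F) Γ.D then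
      ∫ x : 𝓣.mortarSet (.inr F), g x 0 * (vh 0).1 x ∂𝓣.mortarMeasure (.inr F)
    else -∫ x : 𝓣.mortarSet (.inr F), g x 0 * (vh 0).1 x ∂𝓣.mortarMeasure (.inr F)

theorem Mesh.LiesOn.mono {e : 𝓣.Mortar} {S S' : Set (E d)} (h : 𝓣.LiesOn e S) (hS : S ⊆ S') :
    𝓣.LiesOn e S' := measure_mono_null (Set.sdiff_subset_sdiff_right hS) h

/-- Mortars have positive measure, so the type of a boundary mortar is unique and the case
distinction in `mortarForm` is consistent. -/
theorem Mesh.LiesOn.not_of_disjoint {e : 𝓣.Mortar} {S S' : Set (E d)} (h : 𝓣.LiesOn e S)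
    (hS : Disjoint S S') : ¬𝓣.LiesOn e S' := by
  intro h'
  obtain ⟨x, hx, hx'⟩ := Mesh.exists_of_ae e (h.ae_mem.and h'.ae_mem)
  exact Set.disjoint_left.1 hS hx hx'

theorem BoundaryParts.ResolvedBy.liesOn_union (hΓ : Γ.ResolvedBy 𝓣)
    {F : {F : 𝓣.Face // surf d (𝓣.faceSet F ∩ frontier Ω) ≠ 0}}
    (hF : ¬𝓣.LiesOn (.inr F) Γ.D) : 𝓣.LiesOn (.inr F) (Γ.N ∪ Γ.R) := by
  rcases hΓ F with h | h | h
  · exact absurd h hF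
  · exact h.mono Set.subset_union_left
  · exact h.mono Set.subset_union_right

theorem memLp_mortar_coefficient (hρ : MemLp ρ ⊤ ((surf d).restrict (Γ.N ∪ Γ.R)))
    {e : 𝓣.Mortar} (he : 𝓣.LiesOn e (Γ.N ∪ Γ.R)) :
    MemLp (fun x : 𝓣.mortarSet e => ρ x) ⊤ (𝓣.mortarMeasure e) :=
  Mesh.memLp_mortar (hρ.mono_measure he.restrict_le)

theorem memLp_mortar_data {g : E d → Fin 1 → ℝ}
    (hg : ∀ j, MemLp (fun x => g x j) 2 ((surf d).restrict (frontier Ω)))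
    (F : {F : 𝓣.Face // surf d (𝓣.faceSet F ∩ frontier Ω) ≠ 0}) :
    MemLp (fun x => g x 0) 2 ((surf d).restrict (𝓣.mortarSet (.inr F))) :=
  (hg 0).mono_measure (Measure.restrict_mono Set.inter_subset_right le_rfl)

theorem isBilin_mortarForm (hd : 0 < d) (hΓ : Γ.ResolvedBy 𝓣)
    (hρ : MemLp ρ ⊤ ((surf d).restrict (Γ.N ∪ Γ.R))) (e : 𝓣.Mortar) :
    IsBilin fun w vh => mortarForm 𝓣 p Γ ρ w e vh := by
  have hfin := Mesh.isFiniteMeasure_mortarMeasure (𝓣 := 𝓣) hd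
  rcases e with q | F
  · exact isBilin_jumpForm hd _
  · let P : (VolSpace 𝓣 p (Fin d) × VolSpace 𝓣 p (Fin 1) × TraceSpace 𝓣 p (Fin 1)) →ₗ[ℝ]
        𝓣.mortarSet (.inr F) → ℝ :=
      { toFun := fun w => (w.2.2 (.inr F) 0).1
        map_add' := fun _ _ => rfl
        map_smul' := fun _ _ => rfl }
    have hP : ∀ w, MemLp (P w) ⊤ (𝓣.mortarMeasure (.inr F)) := fun w =>
      Mesh.memLp_top_mortar _ (continuous_trace (w.2.2 (.inr F)))
    have hQ : ∀ vh, MemLp (traceLin p (.inr F) vh) ⊤ (𝓣.mortarMeasure (.inr F)) := fun vh =>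
      Mesh.memLp_top_mortar _ (continuous_trace vh)
    by_cases hF : 𝓣.LiesOn (.inr F) Γ.D
    · simp only [mortarForm, if_pos hF]
      exact isBilin_integral_one P hP (traceLin p (.inr F)) hQ
    · simp only [mortarForm, if_neg hF]
      exact (isBilin_jumpForm hd _).sub (isBilin_integral
        (memLp_mortar_coefficient hρ (hΓ.liesOn_union hF)) P hP (traceLin p (.inr F)) hQ)

theorem exists_dual_mortarData (hd : 0 < d) {g : E d → Fin 1 → ℝ}
    (hg : ∀ j, MemLp (fun x => g x j) 2 ((surf d).restrict (frontier Ω))) (e : 𝓣.Mortar) :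
    ∃ ℓ : Module.Dual ℝ (Fin 1 → polyOn (𝓣.mortarDegree p e) (𝓣.mortarSet e)),
      ∀ vh, ℓ vh = mortarData 𝓣 p Γ g e vh := by
  rcases e with q | F
  · exact ⟨0, fun _ => rfl⟩
  · obtain ⟨ℓ, hℓ⟩ := exists_dual_mortar (p := p) hd (.inr F) (memLp_mortar_data hg F)
    by_cases hF : 𝓣.LiesOn (.inr F) Γ.D
    · exact ⟨ℓ, fun vh => by simp only [mortarData, if_pos hF, hℓ]⟩
    · exact ⟨-ℓ, fun vh => by simp only [mortarData, if_neg hF, LinearMap.neg_apply, hℓ]⟩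

/-- On a resolving mesh each boundary mortar has exactly one type, so there is precisely one
variational equation per mortar. This is what makes the system square. -/
theorem isHDGSolution_diffusionSystem_iff (hd : 0 < d) (hΓ : Γ.ResolvedBy 𝓣)
    (hρ : MemLp ρ ⊤ ((surf d).restrict (Γ.N ∪ Γ.R))) {f : E d → Fin d ⊕ Fin 1 → ℝ}
    {g : E d → Fin 1 → ℝ}
    (hg : ∀ j, MemLp (fun x => g x j) 2 ((surf d).restrict (frontier Ω)))
    (w : VolSpace 𝓣 p (Fin d) × VolSpace 𝓣 p (Fin 1) × TraceSpace 𝓣 p (Fin 1)) :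
    IsHDGSolution (diffusionSystem κ) 𝓣 p Γ ρ f g w.1 w.2.1 w.2.2 ↔
      (∀ K, IsLocalSolution (diffusionSystem κ) 𝓣 p f w.2.2 K (w.1 K) (w.2.1 K)) ∧
      ∀ e vh, mortarForm 𝓣 p Γ ρ w e vh = mortarData 𝓣 p Γ g e vh := by
  have hfin := Mesh.isFiniteMeasure_mortarMeasure (𝓣 := 𝓣) hd
  have hD : ∀ F, 𝓣.LiesOn (.inr F) Γ.D →
      ∀ vh : Fin 1 → polyOn (𝓣.mortarDegree p (.inr F)) (𝓣.mortarSet (.inr F)),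
      ((∫ x, tvec (w.2.2 (.inr F)) x ⬝ᵥ tvec vh x ∂𝓣.mortarMeasure (.inr F) =
        ∫ x : 𝓣.mortarSet (.inr F), g x ⬝ᵥ tvec vh x ∂𝓣.mortarMeasure (.inr F)) ↔
      mortarForm 𝓣 p Γ ρ w (.inr F) vh = mortarData 𝓣 p Γ g (.inr F) vh) := by
    intro F hF vh
    simp only [mortarForm, mortarData, if_pos hF, dotProduct, Finset.univ_unique,
      Fin.default_eq_zero, Finset.sum_singleton]
  have hN : ∀ F, ¬𝓣.LiesOn (.inr F) Γ.D →
      ∀ vh : Fin 1 → polyOn (𝓣.mortarDegree p (.inr F)) (𝓣.mortarSet (.inr F)),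
      (jumpIntegral (diffusionSystem κ) 𝓣 p w.1 w.2.1 w.2.2 (.inr F) vh =
        (∫ x : 𝓣.mortarSet (.inr F), ((ρ x • (1 : Matrix (Fin 1) (Fin 1) ℝ) +
          (diffusionSystem κ).Cn x (𝓣.normal F.1)) *ᵥ tvec (w.2.2 (.inr F)) x - g x)
            ⬝ᵥ tvec vh x ∂𝓣.mortarMeasure (.inr F)) ↔
      mortarForm 𝓣 p Γ ρ w (.inr F) vh = mortarData 𝓣 p Γ g (.inr F) vh) := by
    intro F hF vh
    have i1 : Integrable (fun x : 𝓣.mortarSet (.inr F) =>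
        ρ x * (w.2.2 (.inr F) 0).1 x * (vh 0).1 x) (𝓣.mortarMeasure (.inr F)) :=
      ((Mesh.memLp_top_mortar _ (continuous_trace vh)).mul
        ((Mesh.memLp_top_mortar _ (continuous_trace (w.2.2 (.inr F)))).mul
          (memLp_mortar_coefficient hρ (hΓ.liesOn_union hF)) (r := ⊤)) (r := ⊤)).integrable le_top
    have i2 : Integrable (fun x : 𝓣.mortarSet (.inr F) => g x 0 * (vh 0).1 x)
        (𝓣.mortarMeasure (.inr F)) :=
      (memLp_one_iff_integrable.2 ((Mesh.memLp_mortar (memLp_mortar_data hg F)).integrable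
        (by norm_num))).integrable_mul (Mesh.memLp_top_mortar _ (continuous_trace vh))
    have hrhs : (∫ x : 𝓣.mortarSet (.inr F), ((ρ x • (1 : Matrix (Fin 1) (Fin 1) ℝ) +
          (diffusionSystem κ).Cn x (𝓣.normal F.1)) *ᵥ tvec (w.2.2 (.inr F)) x - g x)
            ⬝ᵥ tvec vh x ∂𝓣.mortarMeasure (.inr F)) =
        (∫ x : 𝓣.mortarSet (.inr F), ρ x * (w.2.2 (.inr F) 0).1 x * (vh 0).1 x
          ∂𝓣.mortarMeasure (.inr F)) -
        ∫ x : 𝓣.mortarSet (.inr F), g x 0 * (vh 0).1 x ∂𝓣.mortarMeasure (.inr F) := by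
      rw [← integral_sub i1 i2]
      refine integral_congr_ae (ae_of_all _ fun x => ?_)
      simp [dotProduct, mulVec, sub_mul]
    rw [hrhs, jumpIntegral_diffusionSystem]
    simp only [mortarForm, mortarData, if_neg hF]
    rw [sub_eq_iff_eq_add, neg_add_eq_sub]
  unfold IsHDGSolution
  refine and_congr_right fun _ => ⟨?_, ?_⟩
  · rintro ⟨h1, h2, h3⟩ (q | F) vh
    · exact (jumpIntegral_diffusionSystem _ _ _ _ _).symm.trans (h1 q vh)
    · by_cases hF : 𝓣.LiesOn (.inr F) Γ.D
      · exact (hD F hF vh).1 (h3 F hF vh)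
      · exact (hN F hF vh).1 (h2 F ((hΓ F).resolve_left hF) vh)
  · intro h
    refine ⟨fun q vh => (jumpIntegral_diffusionSystem _ _ _ _ _).trans (h (.inl q) vh),
      fun F hF vh => (hN F ?_ vh).2 (h _ vh), fun F hF vh => (hD F hF vh).2 (h _ vh)⟩
    rcases hF with hF | hF
    · exact hF.not_of_disjoint Γ.disjoint_DN.symm
    · exact hF.not_of_disjoint Γ.disjoint_DR.symm

/-- The complete formulation is a square linear system. -/
theorem existsUnique_isHDGSolution (hd : 0 < d) (hκ : IsDiffusivity Ω κ)
    (hΩr : interior (closure Ω) = Ω) (hΓ : Γ.ResolvedBy 𝓣)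
    (hρ : MemLp ρ ⊤ ((surf d).restrict (Γ.N ∪ Γ.R)))
    (huniq : ∀ w : VolSpace 𝓣 p (Fin d) × VolSpace 𝓣 p (Fin 1) × TraceSpace 𝓣 p (Fin 1),
      (∀ K t, form₁ κ 𝓣 p K (w.1 K) (w.2.1 K) w.2.2 t = 0) →
      (∀ K v, form₂ 𝓣 p K (w.1 K) (w.2.1 K) w.2.2 v = 0) →
      (∀ e vh, mortarForm 𝓣 p Γ ρ w e vh = 0) → w = 0)
    {f : E d → Fin d ⊕ Fin 1 → ℝ} (hf : ∀ i, MemLp (fun x => f x i) 2 (volume.restrict Ω))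
    {g : E d → Fin 1 → ℝ}
    (hg : ∀ j, MemLp (fun x => g x j) 2 ((surf d).restrict (frontier Ω))) :
    ∃! w : VolSpace 𝓣 p (Fin d) × VolSpace 𝓣 p (Fin 1) × TraceSpace 𝓣 p (Fin 1),
      IsHDGSolution (diffusionSystem κ) 𝓣 p Γ ρ f g w.1 w.2.1 w.2.2 := by
  choose B₁ hB₁ using fun K => isBilin_form₁ (p := p) hd hκ hΩr K
  choose B₂ hB₂ using fun K => isBilin_form₂ (p := p) hd K
  choose B₃ hB₃ using fun e => isBilin_mortarForm (p := p) hd hΓ hρ e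
  choose ℓ₁ hℓ₁ using fun K => exists_dual_volume (𝓣 := 𝓣) hΩr K (f := fun x i => f x (.inl i))
    (fun i => hf _) (p K)
  choose ℓ₂ hℓ₂ using fun K => exists_dual_volume (𝓣 := 𝓣) hΩr K (f := fun x i => f x (.inr i))
    (fun i => hf _) (p K)
  choose ℓ₃ hℓ₃ using fun e => exists_dual_mortarData (p := p) (Γ := Γ) hd hg e
  let L : ∀ K, (VolSpace 𝓣 p (Fin d) × VolSpace 𝓣 p (Fin 1) × TraceSpace 𝓣 p (Fin 1)) →ₗ[ℝ]
      LocalSpace 𝓣 p K := fun K =>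
    (LinearMap.proj K).prodMap ((LinearMap.proj K).prodMap LinearMap.id)
  let A := (LinearMap.pi fun K => (B₁ K).comp (L K)).prod
    ((LinearMap.pi fun K => (B₂ K).comp (L K)).prod (LinearMap.pi B₃))
  -- The target is the product of the duals of the component spaces of the unknown, hence has the
  -- same dimension.
  obtain ⟨w, hw, huni⟩ := existsUnique_of_finrank_eq
    (by simp only [Module.finrank_prod, Module.finrank_pi_fintype, Subspace.dual_finrank_eq]) A
    (fun w hw => by
      have h1 : ∀ K, B₁ K (L K w) = 0 := fun K => congrFun (congrArg Prod.fst hw) K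
      have h2 : ∀ K, B₂ K (L K w) = 0 := fun K => congrFun (congrArg (fun z => z.2.1) hw) K
      have h3 : ∀ e, B₃ e w = 0 := fun e => congrFun (congrArg (fun z => z.2.2) hw) e
      exact huniq w
        (fun K t => (hB₁ K (L K w) t).symm.trans (by rw [h1]; rfl))
        (fun K v => (hB₂ K (L K w) v).symm.trans (by rw [h2]; rfl))
        (fun e vh => (hB₃ e w vh).symm.trans (by rw [h3]; rfl)))
    (ℓ₁, ℓ₂, ℓ₃)
  have hiff : ∀ w : VolSpace 𝓣 p (Fin d) × VolSpace 𝓣 p (Fin 1) × TraceSpace 𝓣 p (Fin 1),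
      IsHDGSolution (diffusionSystem κ) 𝓣 p Γ ρ f g w.1 w.2.1 w.2.2 ↔ A w = (ℓ₁, ℓ₂, ℓ₃) := by
    intro w
    rw [isHDGSolution_diffusionSystem_iff hd hΓ hρ hg, Prod.ext_iff, Prod.ext_iff]
    simp only [isLocalSolution_diffusionSystem_iff, forall_and, and_assoc]
    refine and_congr ?_ (and_congr ?_ ?_)
    · rw [funext_iff]
      refine forall_congr' fun K => ?_
      change _ ↔ B₁ K (L K w) = ℓ₁ K
      rw [LinearMap.ext_iff]
      exact forall_congr' fun t => by rw [hB₁ K (L K w), hℓ₁]; rfl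
    · rw [funext_iff]
      refine forall_congr' fun K => ?_
      change _ ↔ B₂ K (L K w) = ℓ₂ K
      rw [LinearMap.ext_iff]
      exact forall_congr' fun t => by rw [hB₂ K (L K w), hℓ₂]; rfl
    · rw [funext_iff]
      refine forall_congr' fun e => ?_
      change _ ↔ B₃ e w = ℓ₃ e
      rw [LinearMap.ext_iff]
      exact forall_congr' fun vh => by rw [hB₃ e w, hℓ₃]
  exact ⟨w, (hiff w).2 hw, fun w' hw' => huni w' ((hiff w').1 hw')⟩

theorem jumpForm_eq_sum (hd : 0 < d) (s : VolSpace 𝓣 p (Fin d)) (u : VolSpace 𝓣 p (Fin 1))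
    (uh : TraceSpace 𝓣 p (Fin 1)) (e : 𝓣.Mortar)
    (vh : Fin 1 → polyOn (𝓣.mortarDegree p e) (𝓣.mortarSet e)) :
    jumpForm 𝓣 p s u uh e vh = ∑ F ∈ 𝓣.sides e,
      ∫ x, numFlux F (s F.1) (u F.1) uh e x * (vh 0).1 x ∂𝓣.mortarMeasure e := by
  have hint : ∀ F : 𝓣.Face, Integrable (fun x => numFlux F (s F.1) (u F.1) uh e x * (vh 0).1 x)
      (𝓣.mortarMeasure e) := fun F => Mesh.integrable_mortar hd e
    ((continuous_numFlux F (s F.1) (u F.1) uh e).mul (continuous_trace vh))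
  rw [← integral_finsetSum _ fun F _ => hint F]
  simp only [jumpForm, Finset.sum_mul]

/-- Regrouping by mortars collects the one-sided fluxes of the two neighbours into the jump. -/
theorem sum_elements_eq_sum_mortars (X : 𝓣.Face → 𝓣.Mortar → ℝ) :
    ∑ K, ∑ i : Fin (𝓣.elem K).numFaces, ∑ e : 𝓣.Mortar with (⟨K, i⟩ : 𝓣.Face) ∈ 𝓣.sides e,
      X ⟨K, i⟩ e = ∑ e, ∑ F ∈ 𝓣.sides e, X F e := by
  rw [← Fintype.sum_sigma (fun F : 𝓣.Face => ∑ e : 𝓣.Mortar with F ∈ 𝓣.sides e, X F e)]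
  exact Finset.sum_comm' (by simp)

/-- Trace unknowns are functions, not classes, so vanishing is needed at every point. It follows
because a mortar has positive measure in its hyperplane. -/
theorem trace_eq_zero_of_ae (hd : 0 < d) {e : 𝓣.Mortar}
    {vh : Fin 1 → polyOn (𝓣.mortarDegree p e) (𝓣.mortarSet e)}
    (h : ∀ᵐ x : 𝓣.mortarSet e ∂𝓣.mortarMeasure e, (vh 0).1 x = 0) : vh = 0 := by
  obtain ⟨q, hq⟩ := polyOn.exists_ev (vh 0)
  obtain ⟨F, hF⟩ := Mesh.exists_mem_sides e
  have hsub := (Mesh.mortarSet_subset_faceSet hF).trans (𝓣.faceSet_subset_hyperplane F)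
  simp only [hq] at h
  rw [Mesh.ae_mortarMeasure_iff (P := fun x => ev q x = 0)] at h
  funext j
  rw [Subsingleton.elim j 0]
  refine Subtype.ext (funext fun x => ?_)
  rw [hq]
  exact eval_eq_zero_of_ae_surf hd (𝓣.norm_normal F) (Mesh.measurableSet_mortarSet e) hsub
    (Mesh.surf_mortarSet_ne_zero e) h (hsub x.2)

/-- The homogeneous formulation forces the trace to vanish in the boundary conditions, and the
numerical flux does no negative work on it. -/
theorem mortar_energy (hd : 0 < d) (hΓ : Γ.ResolvedBy 𝓣)
    (hρ : MemLp ρ ⊤ ((surf d).restrict (Γ.N ∪ Γ.R))) (hρ0 : ∀ x ∈ Γ.N ∪ Γ.R, 0 ≤ ρ x)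
    (hρR : ∀ x ∈ Γ.R, 0 < ρ x)
    {w : VolSpace 𝓣 p (Fin d) × VolSpace 𝓣 p (Fin 1) × TraceSpace 𝓣 p (Fin 1)} {e : 𝓣.Mortar}
    (h : ∀ vh, mortarForm 𝓣 p Γ ρ w e vh = 0) :
    0 ≤ jumpForm 𝓣 p w.1 w.2.1 w.2.2 e (w.2.2 e) ∧
      (𝓣.LiesOn e Γ.D ∨ 𝓣.LiesOn e Γ.R → (∃ F, e = .inr F) →
        jumpForm 𝓣 p w.1 w.2.1 w.2.2 e (w.2.2 e) = 0 →
        ∀ᵐ x : 𝓣.mortarSet e ∂𝓣.mortarMeasure e, (w.2.2 e 0).1 x = 0) := by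
  have he := h (w.2.2 e)
  rcases e with q | F
  · exact ⟨he.ge, fun _ ⟨F, hF⟩ => by cases hF⟩
  have hc := continuous_trace (w.2.2 (.inr F))
  by_cases hF : 𝓣.LiesOn (.inr F) Γ.D
  -- Testing the Dirichlet condition with û gives ∫ û² = 0, so any pairing of the flux with û
  -- vanishes too.
  · simp only [mortarForm, if_pos hF, ← pow_two] at he
    have h0 := Mesh.ae_eq_zero_of_integral_sq hd _ hc he
    refine ⟨(integral_eq_zero_of_ae (h0.mono fun x hx => ?_)).ge, fun _ _ _ => h0⟩
    simp only [hx, mul_zero, Pi.zero_apply]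
  -- Testing with û identifies the work of the flux as ∫ λ û². It is nonnegative, and on a Robin
  -- mortar it vanishes only if û does.
  · simp only [mortarForm, if_neg hF, sub_eq_zero] at he
    have hfin := Mesh.isFiniteMeasure_mortarMeasure (𝓣 := 𝓣) hd (.inr F)
    have hNR := hΓ.liesOn_union hF
    have hnn : ∀ᵐ x : 𝓣.mortarSet (.inr F) ∂𝓣.mortarMeasure (.inr F),
        0 ≤ ρ x * (w.2.2 (.inr F) 0).1 x * (w.2.2 (.inr F) 0).1 x := by
      filter_upwards [hNR.ae_mem] with x hx
      rw [mul_assoc]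
      exact mul_nonneg (hρ0 x hx) (mul_self_nonneg _)
    refine ⟨he ▸ integral_nonneg_of_ae hnn, fun hR _ h0 => ?_⟩
    have hR := hR.resolve_left hF
    rw [he] at h0
    have hint : Integrable (fun x : 𝓣.mortarSet (.inr F) =>
        ρ x * (w.2.2 (.inr F) 0).1 x * (w.2.2 (.inr F) 0).1 x) (𝓣.mortarMeasure (.inr F)) :=
      ((Mesh.memLp_top_mortar _ hc).mul ((Mesh.memLp_top_mortar _ hc).mul
        (memLp_mortar_coefficient hρ hNR) (r := ⊤)) (r := ⊤)).integrable le_top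
    filter_upwards [hR.ae_mem, (integral_eq_zero_iff_of_nonneg_ae hnn hint).1 h0] with x hx hx0
    simp only [Pi.zero_apply, mul_assoc] at hx0
    exact mul_self_eq_zero.1 ((mul_eq_zero.1 hx0).resolve_left (hρR x hx).ne')

theorem eq_zero_of_global_homogeneous (hd : 0 < d) (hκ : IsDiffusivity Ω κ) (hΩo : IsOpen Ω)
    (hΩc : IsConnected Ω) (hΩr : interior (closure Ω) = Ω) (hΓ : Γ.ResolvedBy 𝓣)
    (hDR : surf d (Γ.D ∪ Γ.R) ≠ 0) (hρ : MemLp ρ ⊤ ((surf d).restrict (Γ.N ∪ Γ.R)))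
    (hρ0 : ∀ x ∈ Γ.N ∪ Γ.R, 0 ≤ ρ x) (hρR : ∀ x ∈ Γ.R, 0 < ρ x)
    (w : VolSpace 𝓣 p (Fin d) × VolSpace 𝓣 p (Fin 1) × TraceSpace 𝓣 p (Fin 1))
    (h₁ : ∀ K t, form₁ κ 𝓣 p K (w.1 K) (w.2.1 K) w.2.2 t = 0)
    (h₂ : ∀ K v, form₂ 𝓣 p K (w.1 K) (w.2.1 K) w.2.2 v = 0)
    (h₃ : ∀ e vh, mortarForm 𝓣 p Γ ρ w e vh = 0) : w = 0 := by
  obtain ⟨s, u, uh⟩ := w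
  simp only at h₁ h₂
  obtain ⟨k₀, hk₀, hk⟩ := hκ.exists_inv_coercive
  have hJ := fun e => mortar_energy hd hΓ hρ hρ0 hρR (h₃ e)
  simp only at hJ
  have hE : ∑ K, (form₁ κ 𝓣 p K (s K) (u K) uh (s K) + form₂ 𝓣 p K (s K) (u K) uh (u K)) =
      (∑ K, ∫ x in (𝓣.elem K).carrier, ((κ x)⁻¹ *ᵥ vec (coes (s K)) x) ⬝ᵥ vec (coes (s K)) x) +
      ∑ e, ∑ F ∈ 𝓣.sides e,
        ((∫ x, numFlux F (s F.1) (u F.1) uh e x * (uh e 0).1 x ∂𝓣.mortarMeasure e) +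
          ∫ x : 𝓣.mortarSet e, (ev (u F.1 0).1 x - (uh e 0).1 x) ^ 2 ∂𝓣.mortarMeasure e) := by
    rw [← sum_elements_eq_sum_mortars (fun F e =>
      (∫ x, numFlux F (s F.1) (u F.1) uh e x * (uh e 0).1 x ∂𝓣.mortarMeasure e) +
        ∫ x : 𝓣.mortarSet e, (ev (u F.1 0).1 x - (uh e 0).1 x) ^ 2 ∂𝓣.mortarMeasure e),
      ← Finset.sum_add_distrib]
    exact Finset.sum_congr rfl fun K _ => form₁_add_form₂ hd hΩo hΩr K (s K) (u K) uh
  simp only [h₁, h₂, add_zero, Finset.sum_const_zero, Finset.sum_add_distrib,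
    ← jumpForm_eq_sum hd] at hE
  have hv := fun K => integral_inv_nonneg hk₀ hk hΩr K (coes (s K))
  have hp : ∀ e, ∀ F ∈ 𝓣.sides e,
      0 ≤ ∫ x : 𝓣.mortarSet e, (ev (u F.1 0).1 x - (uh e 0).1 x) ^ 2 ∂𝓣.mortarMeasure e :=
    fun e F _ => integral_nonneg fun _ => sq_nonneg _
  have hp' := fun e => Finset.sum_nonneg (hp e)
  have hv0 := Finset.sum_nonneg fun K (_ : K ∈ Finset.univ) => hv K
  have hJ0 := Finset.sum_nonneg fun e (_ : e ∈ Finset.univ) => (hJ e).1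
  have hp0 := Finset.sum_nonneg fun e (_ : e ∈ Finset.univ) => hp' e
  -- The volume energy, the work of the fluxes and the penalty are sums of nonnegative terms with
  -- total zero, so every term vanishes.
  have hvz := (Finset.sum_eq_zero_iff_of_nonneg fun K (_ : K ∈ Finset.univ) => hv K).1
    (by linarith)
  have hJz := (Finset.sum_eq_zero_iff_of_nonneg fun e (_ : e ∈ Finset.univ) => (hJ e).1).1
    (by linarith)
  have hpz := (Finset.sum_eq_zero_iff_of_nonneg fun e (_ : e ∈ Finset.univ) => hp' e).1
    (by linarith)
  have hs : s = 0 := funext fun K => funext fun i => Subtype.ext (congrFun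
    (eq_zero_of_integral_inv_eq_zero hκ hk₀ hk hΩr K (hvz K (Finset.mem_univ K))) i)
  have hmatch : ∀ e, ∀ F ∈ 𝓣.sides e, ∀ᵐ x : 𝓣.mortarSet e ∂𝓣.mortarMeasure e,
      ev (u F.1 0).1 x = (uh e 0).1 x := fun e F hF =>
    (Mesh.ae_eq_zero_of_integral_sq hd e
      (((continuous_ev _).comp continuous_subtype_val).sub (continuous_trace (uh e)))
      ((Finset.sum_eq_zero_iff_of_nonneg (hp e)).1 (hpz e (Finset.mem_univ e)) F hF)).mono
      fun x hx => sub_eq_zero.1 hx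
  subst hs
  choose c hc using fun K => exists_eq_C_of_form₁ hd hΩo hΩr K (h₁ K)
    fun i e he => hmatch e ⟨K, i⟩ he
  have hcm : ∀ e, ∀ F ∈ 𝓣.sides e, ∀ᵐ x : 𝓣.mortarSet e ∂𝓣.mortarMeasure e,
      c F.1 = (uh e 0).1 x := fun e F hF => (hmatch e F hF).mono fun x hx => by
    rwa [hc, ev_C] at hx
  -- Both neighbours of an interior mortar match the same û there, so their constants agree.
  have hcc := Mesh.eq_of_forall_interior_mortar hd hΩo hΩc hΩr c fun q => by
    obtain ⟨x, hx, hx'⟩ := Mesh.exists_of_ae (.inl q)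
      ((hcm (.inl q) q.1.1 (by simp [Mesh.sides])).and
        (hcm (.inl q) q.1.2 (by simp [Mesh.sides])))
    exact hx.trans hx'.symm
  have hc0 : ∀ K, c K = 0 := by
    obtain ⟨F, hF⟩ := BoundaryParts.exists_liesOn hΓ hΩo hΩr hDR
    obtain ⟨x, hx, hx'⟩ := Mesh.exists_of_ae (.inr F)
      ((hcm (.inr F) F.1 (by simp [Mesh.sides])).and
        ((hJ (.inr F)).2 hF ⟨F, rfl⟩ (hJz _ (Finset.mem_univ _))))
    exact fun K => (hcc F.1.1 K).trans (hx.trans hx')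
  have hu : u = 0 := funext fun K => scalar_eq_zero (by rw [hc, hc0])
  have huh : uh = 0 := funext fun e => by
    obtain ⟨F, hF⟩ := Mesh.exists_mem_sides e
    exact trace_eq_zero_of_ae hd ((hcm e F hF).mono fun x hx => hx.symm.trans (hc0 _))
  rw [hu, huh]
  rfl

theorem globallyWellPosed_diffusionSystem (hd : 0 < d) (hκ : IsDiffusivity Ω κ) (hΩo : IsOpen Ω)
    (hΩc : IsConnected Ω) (hΩr : interior (closure Ω) = Ω) (hΓ : Γ.ResolvedBy 𝓣)
    (hDR : surf d (Γ.D ∪ Γ.R) ≠ 0) (hρ : MemLp ρ ⊤ ((surf d).restrict (Γ.N ∪ Γ.R)))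
    (hρ0 : ∀ x ∈ Γ.N ∪ Γ.R, 0 ≤ ρ x) (hρR : ∀ x ∈ Γ.R, 0 < ρ x) :
    GloballyWellPosed (diffusionSystem κ) 𝓣 p Γ ρ :=
  fun _ hf _ hg => existsUnique_isHDGSolution hd hκ hΩr hΓ hρ
    (eq_zero_of_global_homogeneous hd hκ hΩo hΩc hΩr hΓ hDR hρ hρ0 hρR) hf hg

end Global

end HDG

end

/-! ### The main theorem -/

theorem mainTheorem7 (d : ℕ) (hd : 2 ≤ d) (Ω : Set (HDG.E d)) (hΩo : IsOpen Ω)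
    (hΩc : IsConnected Ω) (hΩr : interior (closure Ω) = Ω)
    (κ : HDG.E d → Matrix (Fin d) (Fin d) ℝ) (hκ : HDG.IsDiffusivity Ω κ)
    (Γ : HDG.BoundaryParts Ω) (lam : HDG.E d → ℝ)
    (hlam : MemLp lam ⊤ ((HDG.surf d).restrict (Γ.N ∪ Γ.R)))
    (hlamN : ∀ x ∈ Γ.N, lam x = 0) (hlamR : ∀ x ∈ Γ.R, 0 < lam x) :
    -- the mixed problem is the two-field system
    (∀ x ∈ Ω, ∀ (s : HDG.E d → Fin d → ℝ) (u : HDG.E d → ℝ) (f : ℝ),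
      DifferentiableAt ℝ s x → DifferentiableAt ℝ u x →
      ((HDG.diffusionSystem κ).strongForm (fun y => HDG.pair (s y) (u y)) x = HDG.pair 0 f ↔
        (fun k => fderiv ℝ u x (HDG.basisVec k)) + (κ x)⁻¹ *ᵥ s x = 0 ∧
        ∑ k, fderiv ℝ s x (HDG.basisVec k) k = f)) ∧
    (∀ᵐ x ∂volume.restrict Ω, ∀ s v : Fin d → ℝ, v + (κ x)⁻¹ *ᵥ s = 0 ↔ s = -(κ x *ᵥ v)) ∧
    -- the assumptions of the partially coercive two-field theory hold
    (HDG.diffusionSystem κ).IsPartiallyCoercive Ω ∧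
    -- the boundary operator is admissible and encodes the boundary conditions
    (∀ x ∈ Γ.D, ∀ n : HDG.E d, ‖n‖ = 1 →
      HDG.TwoFieldSystem.AdmissibleBoundaryOp ((HDG.diffusionSystem κ).An x n)
        ((HDG.diffusionSystem κ).boundaryOp 1 (1 / 2) x n) ∧
      ∀ (s s' : Fin d → ℝ) (u u' : ℝ),
        (((HDG.diffusionSystem κ).An x n - (HDG.diffusionSystem κ).boundaryOp 1 (1 / 2) x n) *ᵥ
            HDG.pair s u =
          ((HDG.diffusionSystem κ).An x n - (HDG.diffusionSystem κ).boundaryOp 1 (1 / 2) x n) *ᵥ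
            HDG.pair s' u' ↔ u = u')) ∧
    (∀ x ∈ Γ.N ∪ Γ.R, ∀ n : HDG.E d, ‖n‖ = 1 →
      HDG.TwoFieldSystem.AdmissibleBoundaryOp ((HDG.diffusionSystem κ).An x n)
        ((HDG.diffusionSystem κ).boundaryOp (-1) (lam x) x n) ∧
      ∀ (s s' : Fin d → ℝ) (u u' : ℝ),
        (((HDG.diffusionSystem κ).An x n - (HDG.diffusionSystem κ).boundaryOp (-1) (lam x) x n) *ᵥ
            HDG.pair s u =
          ((HDG.diffusionSystem κ).An x n - (HDG.diffusionSystem κ).boundaryOp (-1) (lam x) x n) *ᵥ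
            HDG.pair s' u' ↔
          -(∑ k, s k * n k) + lam x * u = -(∑ k, s' k * n k) + lam x * u')) ∧
    -- flux case (F2) with `T = 1`
    (HDG.diffusionSystem κ).FluxCaseF2 Ω ∧
    (∀ x ∈ closure Ω, ∀ n : HDG.E d, ‖n‖ = 1 → (HDG.diffusionSystem κ).T x n = 1) ∧
    -- `C / 2 + T > 0`, and the conditions on the blocks `Bₖ`
    (∀ x ∈ closure Ω, ∀ n : HDG.E d, ‖n‖ = 1 →
      HDG.PosForm ((1 / 2 : ℝ) • (HDG.diffusionSystem κ).Cn x n +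
        (HDG.diffusionSystem κ).T x n)) ∧
    (∀ x ∈ closure Ω, ⨅ k, LinearMap.range ((HDG.diffusionSystem κ).B k x).mulVecLin = ⊥) ∧
    (∀ x ∈ closure Ω, ∀ k, LinearMap.ker ((HDG.diffusionSystem κ).B k x).mulVecLin = ⊥) ∧
    -- well-posedness of the `hp`-HDG formulation on every mesh, for all degrees
    (∀ (𝓣 : HDG.Mesh Ω) (p : Fin 𝓣.N → ℕ),
      HDG.LocallyWellPosed (HDG.diffusionSystem κ) 𝓣 p ∧
      (Γ.ResolvedBy 𝓣 → HDG.surf d (Γ.D ∪ Γ.R) ≠ 0 →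
        HDG.GloballyWellPosed (HDG.diffusionSystem κ) 𝓣 p Γ lam)) := by
  have hd0 : 0 < d := by omega
  have hlam0 : ∀ x ∈ Γ.N ∪ Γ.R, 0 ≤ lam x := fun x hx =>
    hx.elim (fun h => (hlamN x h).ge) fun h => (hlamR x h).le
  refine ⟨fun x _ s u f hs hu => HDG.strongForm_diffusionSystem_iff κ x s u f hs hu, hκ.flux_iff,
    HDG.isPartiallyCoercive_diffusionSystem hκ,
    fun x _ n hn => ⟨HDG.admissible_boundaryOp_dirichlet κ x hn,
      HDG.dirichlet_condition_iff κ x⟩,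
    fun x hx n hn => ⟨HDG.admissible_boundaryOp_robin κ x hn (hlam0 x hx),
      HDG.robin_condition_iff κ x (lam x)⟩,
    HDG.fluxCaseF2 κ Ω, fun x _ n hn => HDG.diffusionSystem_T κ x hn,
    fun x _ n hn => HDG.posForm_T κ x hn, fun x _ => HDG.iInf_range_B κ x hd,
    fun x _ => HDG.ker_B κ x, fun 𝓣 p => ⟨?_, fun hΓ hDR => ?_⟩⟩
  · exact HDG.locallyWellPosed_diffusionSystem hd0 hκ hΩo hΩr
  · exact HDG.globallyWellPosed_diffusionSystem hd0 hκ hΩo hΩc hΩr hΓ hDR hlam hlam0 hlamR
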